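/- Let $M$ be a complete (connected, second countable) smooth Riemannian manifold of dimension $n$, with Riemannian measure $dx$ and Levi-Civita connection $\nabla$. Let $\square = dd^*+d^*d$ be the de Rham-Hodge Laplacian, acting on vector fields through the metric identification with 1-forms. Assume that there is a constant $\kappa\in\mathbb R$ with $\mathrm{Ric}\ge-\kappa$, i.e. $\mathrm{Ric}(v,v)\ge-\kappa|v|^2$ for all tangent vectors $v$. Let $\nu>0$ and let $(u,p)$ be a solution, smooth on $[0,T]\times M$, of the Navier-Stokes equation $$\partial_t u_t+\nabla_{u_t}u_t+\nu\,\square u_t=-\nabla p_t,\qquad \mathrm{div}(u_t)=0,\qquad u|_{t=0}=u_0 ,$$ such that $$\int_0^T\!\int_M|u_t|^2\,dx\,dt<\infty\quad\text{and}\quad \int_0^T\!\int_M\Bigl|\bigl(\tfrac12|u_t|^2+p_t\bigr)u_t\Bigr|\,dx\,dt<\infty$$ (both hold automatically when $M$ is compact). Then, for every $t\in[0,T]$, $$\frac12\|u_t\|_2^2+\nu\int_0^t\|\nabla u_s\|_2^2\,ds\le\frac12\|u_0\|_2^2\,\exp(2\nu t\kappa^+),\qquad \kappa^+=\sup\{\kappa,0\},$$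 where $\|\cdot\|_2$ is the $L^2$ norm and $|\nabla u|$ is the pointwise Hilbert-Schmidt norm; both sides are read in $[0,\infty]$ (so if $u_0\in L^2$ then the left-hand side is finite). -/

import Mathlib

open Bundle Manifold MeasureTheory Set
open scoped ContDiff

noncomputable section

namespace RiemNS

variable {n : ℕ} {M : Type*} [TopologicalSpace M]
  [ChartedSpace (EuclideanSpace ℝ (Fin n)) M] [IsManifold (𝓡 n) ∞ M]
  [RiemannianBundle (fun x : M ↦ TangentSpace (𝓡 n) x)]

/-- Vector fields (no regularity imposed) on the `n`-dimensional manifold `M`. -/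
abbrev VField (n : ℕ) (M : Type*) [TopologicalSpace M]
    [ChartedSpace (EuclideanSpace ℝ (Fin n)) M] : Type _ :=
  (x : M) → TangentSpace (𝓡 n) x

instance finiteDimensional_tangentSpace (x : M) :
    FiniteDimensional ℝ (TangentSpace (𝓡 n) x) :=
  inferInstanceAs (FiniteDimensional ℝ (EuclideanSpace ℝ (Fin n)))

/-- An orthonormal basis of the tangent space at `x`. -/
def frame (x : M) :
    OrthonormalBasis (Fin (Module.finrank ℝ (TangentSpace (𝓡 n) x))) ℝ (TangentSpace (𝓡 n) x) :=
  stdOrthonormalBasis ℝ (TangentSpace (𝓡 n) x)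

/-- A vector field, smooth near `x`, with the value `v` at `x`. -/
def ext {x : M} (v : TangentSpace (𝓡 n) x) : VField n M :=
  FiberBundle.extend (EuclideanSpace ℝ (Fin n)) v

/-- The Koszul expression for `⟨∇_X Y, Z⟩` at `x`. -/
def koszul (X Y Z : VField n M) (x : M) : ℝ :=
  (1 / 2) *
    (mvfderiv (𝓡 n) (fun y ↦ inner ℝ (Y y) (Z y)) x (X x)
      + mvfderiv (𝓡 n) (fun y ↦ inner ℝ (Z y) (X y)) x (Y x)
      - mvfderiv (𝓡 n) (fun y ↦ inner ℝ (X y) (Y y)) x (Z x)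
      + inner ℝ (VectorField.mlieBracket (𝓡 n) X Y x) (Z x)
      - inner ℝ (VectorField.mlieBracket (𝓡 n) Y Z x) (X x)
      + inner ℝ (VectorField.mlieBracket (𝓡 n) Z X x) (Y x))

/-- The Levi-Civita derivative: `nabla Y x v` is `∇_v Y`. -/
def nabla (Y : VField n M) (x : M) : TangentSpace (𝓡 n) x →L[ℝ] TangentSpace (𝓡 n) x :=
  ∑ i, ∑ j, koszul (ext (frame x i)) Y (ext (frame x j)) x •
    (innerSL ℝ (frame x i)).smulRight (frame x j)

/-- The curvature `R(X, Y) Z = ∇_X ∇_Y Z - ∇_Y ∇_X Z - ∇_{[X, Y]} Z`. -/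
def curvature (X Y Z : VField n M) : VField n M := fun x ↦
  nabla (fun y ↦ nabla Z y (Y y)) x (X x) - nabla (fun y ↦ nabla Z y (X y)) x (Y x)
    - nabla Z x (VectorField.mlieBracket (𝓡 n) X Y x)

/-- The Ricci tensor `Ric(v, w) = ∑ᵢ ⟨R(eᵢ, v) w, eᵢ⟩`. -/
def ricci (x : M) (v w : TangentSpace (𝓡 n) x) : ℝ :=
  ∑ i, inner ℝ (curvature (ext (frame x i)) (ext v) (ext w) x) (frame x i)

/-- The lower bound `Ric ≥ -κ`. -/
def RicciBoundedBelow (n : ℕ) (M : Type*) [TopologicalSpace M]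
    [ChartedSpace (EuclideanSpace ℝ (Fin n)) M] [IsManifold (𝓡 n) ∞ M]
    [RiemannianBundle (fun x : M ↦ TangentSpace (𝓡 n) x)] (κ : ℝ) : Prop :=
  ∀ (x : M) (v : TangentSpace (𝓡 n) x), -κ * ‖v‖ ^ 2 ≤ ricci x v v

/-- The divergence `div u = tr ∇u`. -/
def divergence (u : VField n M) (x : M) : ℝ :=
  ∑ i, inner ℝ (nabla u x (frame x i)) (frame x i)

/-- The gradient of a function. -/
def gradient (f : M → ℝ) (x : M) : TangentSpace (𝓡 n) x :=
  ∑ i, mvfderiv (𝓡 n) f x (frame x i) • frame x i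

/-- Differential `1`-forms (no regularity imposed). -/
abbrev OneForm (n : ℕ) (M : Type*) [TopologicalSpace M]
    [ChartedSpace (EuclideanSpace ℝ (Fin n)) M] : Type _ :=
  (x : M) → TangentSpace (𝓡 n) x → ℝ

/-- Fields of bilinear forms; `2`-forms are among them. -/
abbrev TwoForm (n : ℕ) (M : Type*) [TopologicalSpace M]
    [ChartedSpace (EuclideanSpace ℝ (Fin n)) M] : Type _ :=
  (x : M) → TangentSpace (𝓡 n) x → TangentSpace (𝓡 n) x → ℝ

/-- The `1`-form `⟨u, ·⟩` of a vector field `u`. -/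
def flat (u : VField n M) : OneForm n M := fun x v ↦ inner ℝ (u x) v

/-- The vector field `α♯` of a `1`-form `α`. -/
def sharp (α : OneForm n M) : VField n M := fun x ↦ ∑ i, α x (frame x i) • frame x i

/-- The differential of a function, as a `1`-form. -/
def dFun (f : M → ℝ) : OneForm n M := fun x v ↦ mvfderiv (𝓡 n) f x v

/-- The exterior derivative of a `1`-form,
`dα(v, w) = V(α(W)) - W(α(V)) - α([V, W])`. -/
def dOne (α : OneForm n M) : TwoForm n M := fun x v w ↦
  mvfderiv (𝓡 n) (fun y ↦ α y (ext w y)) x v - mvfderiv (𝓡 n) (fun y ↦ α y (ext v y)) x w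
    - α x (VectorField.mlieBracket (𝓡 n) (ext v) (ext w) x)

/-- `(∇_v α)(a)` for a `1`-form `α`. -/
def nablaOne (α : OneForm n M) (x : M) (v a : TangentSpace (𝓡 n) x) : ℝ :=
  mvfderiv (𝓡 n) (fun y ↦ α y (ext a y)) x v - α x (nabla (ext a) x v)

/-- `(∇_v β)(a, b)` for a `2`-form `β`. -/
def nablaTwo (β : TwoForm n M) (x : M) (v a b : TangentSpace (𝓡 n) x) : ℝ :=
  mvfderiv (𝓡 n) (fun y ↦ β y (ext a y) (ext b y)) x v
    - β x (nabla (ext a) x v) b - β x a (nabla (ext b) x v)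

/-- The codifferential `d*` on `1`-forms (the formal adjoint of `d`). -/
def codiffOne (α : OneForm n M) (x : M) : ℝ :=
  -∑ i, nablaOne α x (frame x i) (frame x i)

/-- The codifferential `d*` on `2`-forms (the formal adjoint of `d`). -/
def codiffTwo (β : TwoForm n M) : OneForm n M := fun x v ↦
  -∑ i, nablaTwo β x (frame x i) (frame x i) v

/-- The de Rham-Hodge Laplacian `□ = d d* + d* d` on vector fields,
through the identification of vector fields with `1`-forms. -/
def hodgeLaplacian (u : VField n M) : VField n M :=
  sharp fun x v ↦ dFun (codiffOne (flat u)) x v + codiffTwo (dOne (flat u)) x v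

/-- The matrix `(g_ij)` of the metric, at the point `y` of the chart centred at `c`. -/
def chartMetric (c : M) (y : EuclideanSpace ℝ (Fin n)) : Matrix (Fin n) (Fin n) ℝ :=
  Matrix.of fun i j ↦ inner ℝ
    (mfderiv 𝓘(ℝ, EuclideanSpace ℝ (Fin n)) (𝓡 n) (extChartAt (𝓡 n) c).symm y
      (EuclideanSpace.single i (1 : ℝ)))
    (mfderiv 𝓘(ℝ, EuclideanSpace ℝ (Fin n)) (𝓡 n) (extChartAt (𝓡 n) c).symm y
      (EuclideanSpace.single j (1 : ℝ)))

/-- The measure `√(det g) dy` on the domain of the chart centred at `c`, extended by zero. -/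
def chartVolume [MeasurableSpace M] (c : M) : Measure M :=
  Measure.map (extChartAt (𝓡 n) c).symm
    ((volume.restrict (extChartAt (𝓡 n) c).target).withDensity
      fun y ↦ ENNReal.ofReal (Real.sqrt (chartMetric c y).det))

/-- The Riemannian measure. The measures `chartVolume c` are its restrictions to the chart
domains, and on a second countable manifold it is their supremum. -/
def vol (n : ℕ) (M : Type*) [TopologicalSpace M]
    [ChartedSpace (EuclideanSpace ℝ (Fin n)) M] [IsManifold (𝓡 n) ∞ M]
    [RiemannianBundle (fun x : M ↦ TangentSpace (𝓡 n) x)] [MeasurableSpace M] : Measure M :=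
  ⨆ c : M, chartVolume (n := n) c

/-- `‖u‖₂²`, with the value `∞` when `u` is not in `L²`. -/
def normSq [MeasurableSpace M] (u : VField n M) : ENNReal :=
  ∫⁻ x, ENNReal.ofReal (‖u x‖ ^ 2) ∂(vol n M)

/-- `‖∇u‖₂²`, with the pointwise Hilbert-Schmidt norm `|∇u|² = ∑ᵢ |∇_{eᵢ} u|²`. -/
def gradNormSq [MeasurableSpace M] (u : VField n M) : ENNReal :=
  ∫⁻ x, ENNReal.ofReal (∑ i, ‖nabla u x (frame x i)‖ ^ 2) ∂(vol n M)

/-- `(u, p)` is smooth on `[0, T] × M` and solves the Navier-Stokes equation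
`∂ₜ u + ∇_u u + ν □ u = -∇p`, `div u = 0`, with `u = u₀` at time `0`. -/
structure IsSmoothSolution (ν T : ℝ) (u₀ : VField n M) (u : ℝ → VField n M) (p : ℝ → M → ℝ) :
    Prop where
  smooth_velocity : ContMDiffOn (𝓘(ℝ, ℝ).prod (𝓡 n)) (𝓡 n).tangent ∞
    (fun q : ℝ × M ↦ (⟨q.2, u q.1 q.2⟩ : TangentBundle (𝓡 n) M)) (Icc 0 T ×ˢ univ)
  smooth_pressure : ContMDiffOn (𝓘(ℝ, ℝ).prod (𝓡 n)) 𝓘(ℝ, ℝ) ∞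
    (fun q : ℝ × M ↦ p q.1 q.2) (Icc 0 T ×ˢ univ)
  momentum : ∀ t ∈ Icc 0 T, ∀ x : M,
    derivWithin (fun s ↦ u s x) (Icc 0 T) t + nabla (u t) x (u t x) + ν • hodgeLaplacian (u t) x
      = -gradient (p t) x
  incompressible : ∀ t ∈ Icc 0 T, ∀ x : M, divergence (u t) x = 0
  initial : u 0 = u₀

/-- The kinetic energy is integrable in time on `[0, T]`, and the energy flux
`(|u|² / 2 + p) u` is integrable on `[0, T] × M`. -/
structure HasIntegrableEnergy [MeasurableSpace M] (T : ℝ) (u : ℝ → VField n M)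
    (p : ℝ → M → ℝ) : Prop where
  energy : ∫⁻ t in Icc 0 T, normSq (u t) < ⊤
  flux : ∫⁻ t in Icc 0 T, ∫⁻ x,
    ENNReal.ofReal ‖(‖u t x‖ ^ 2 / 2 + p t x) • u t x‖ ∂(vol n M) < ⊤

end RiemNS

end

/-!
The energy balance is localized. Testing the equation against `χ² u`, with `χ` a Lipschitz cutoff,
and integrating by parts turns the viscous term, through the Bochner-Weitzenböck formula
`⟨□u, u⟩ = -⟨Δu, u⟩ + Ric(u, u)`, into `∫ χ² |∇u|² + ∫ χ² Ric(u, u)` up to terms carrying a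
derivative of `χ`; the nonlinear and pressure terms only contribute the flux of `|u|² / 2 + p`
against `∇χ`, as `div u = 0`. If `χ` is `L`-Lipschitz, all these errors are at most `L` times the
flux and the energy, which are integrable in space-time, and `L ∫ χ² |∇u|²`, which the dissipation
absorbs. On a complete manifold closed balls are compact (Hopf-Rinow), so there are cutoffs equal to
`1` on the ball of radius `R` with `L = 1 / R`. Grönwall's inequality with rate `2 ν κ⁺` gives the
localized estimate, and `R → ∞` the theorem.
-/

noncomputable section

namespace RiemNS

open ContinuousLinearMap (flipₗᵢ compL)
open scoped Topology

set_option maxSynthPendingDepth 3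

local notation "𝔼" n:max => EuclideanSpace ℝ (Fin n)

section LocalMetric

variable {E : Type*} [NormedAddCommGroup E] [NormedSpace ℝ E]

/-- `g` is a smooth Riemannian metric on the open subset `Ω` of the vector space `E`; the metric of
a manifold, read in a chart, is of this kind. -/
structure IsLocalMetric (Ω : Set E) (g : E → E →L[ℝ] E →L[ℝ] ℝ) : Prop where
  isOpen : IsOpen Ω
  smooth : ContDiffOn ℝ ∞ g Ω
  symm : ∀ y ∈ Ω, ∀ v w, g y v w = g y w v
  pos : ∀ y ∈ Ω, ∀ v, v ≠ 0 → 0 < g y v v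

/-- The Christoffel symbols of the first kind. -/
def christoffelLower (g : E → E →L[ℝ] E →L[ℝ] ℝ) (y : E) : E →L[ℝ] E →L[ℝ] E →L[ℝ] ℝ :=
  (1 / 2 : ℝ) • (fderiv ℝ g y + (fderiv ℝ g y).flip
    - ((flipₗᵢ ℝ E E ℝ).toContinuousLinearEquiv : (E →L[ℝ] E →L[ℝ] ℝ) →L[ℝ] E →L[ℝ] E →L[ℝ] ℝ).comp
        (fderiv ℝ g y).flip)

/-- The Christoffel symbols of the second kind, which are the zeroth order part of the
Levi-Civita connection. -/
def christoffel (g : E → E →L[ℝ] E →L[ℝ] ℝ) (y : E) : E →L[ℝ] E →L[ℝ] E :=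
  (compL ℝ E (E →L[ℝ] ℝ) E (g y).inverse).comp (christoffelLower g y)

/-- The Levi-Civita derivative `v ↦ ∇_v u` of a vector field `u`, as a field of endomorphisms. -/
def cov (g : E → E →L[ℝ] E →L[ℝ] ℝ) (u : E → E) (y : E) : E →L[ℝ] E :=
  fderiv ℝ u y + (christoffel g y).flip (u y)

/-- The covariant derivative `∇_v N` of a field `N` of endomorphisms. -/
def covEnd (g : E → E →L[ℝ] E →L[ℝ] ℝ) (N : E → E →L[ℝ] E) (y v : E) : E →L[ℝ] E :=
  fderiv ℝ N y v + (christoffel g y v).comp (N y) - (N y).comp (christoffel g y v)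

/-- The curvature tensor `R(v, a) w`, through the Christoffel symbols. -/
def curv (g : E → E →L[ℝ] E →L[ℝ] ℝ) (y v a w : E) : E :=
  fderiv ℝ (christoffel g) y v a w - fderiv ℝ (christoffel g) y a v w
    + christoffel g y v (christoffel g y a w) - christoffel g y a (christoffel g y v w)

section

variable {g : E → E →L[ℝ] E →L[ℝ] ℝ} {N : E → E →L[ℝ] E} {X Y : E → E} {y : E}

lemma christoffelLower_apply (g : E → E →L[ℝ] E →L[ℝ] ℝ) (y v w z : E) :
    christoffelLower g y v w z =
      (1 / 2) * (fderiv ℝ g y v w z + fderiv ℝ g y w v z - fderiv ℝ g y z v w) := by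
  simp [christoffelLower]

lemma cov_apply (g : E → E →L[ℝ] E →L[ℝ] ℝ) (u : E → E) (y v : E) :
    cov g u y v = fderiv ℝ u y v + christoffel g y v (u y) := by
  simp [cov]

lemma covEnd_apply (g : E → E →L[ℝ] E →L[ℝ] ℝ) (N : E → E →L[ℝ] E) (y v a : E) :
    covEnd g N y v a
      = fderiv ℝ N y v a + christoffel g y v (N y a) - N y (christoffel g y v a) := rfl

lemma cov_congr (h : X =ᶠ[𝓝 y] Y) : cov g X y = cov g Y y := by
  rw [cov, cov, h.fderiv_eq, h.eq_of_nhds]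

lemma cov_clm_apply (hN : DifferentiableAt ℝ N y) (hX : DifferentiableAt ℝ X y) (v : E) :
    cov g (fun z ↦ N z (X z)) y v = covEnd g N y v (X y) + N y (cov g X y v) := by
  simp only [cov_apply, covEnd_apply, fderiv_clm_apply hN hX, add_apply,
    ContinuousLinearMap.comp_apply, ContinuousLinearMap.flip_apply, map_add]
  abel

lemma trace_covEnd [FiniteDimensional ℝ E] (hN : DifferentiableAt ℝ N y) (v : E) :
    LinearMap.trace ℝ E (covEnd g N y v : E →ₗ[ℝ] E)
      = fderiv ℝ (fun z ↦ LinearMap.trace ℝ E (N z : E →ₗ[ℝ] E)) y v := by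
  let tr : (E →L[ℝ] E) →L[ℝ] ℝ := LinearMap.toContinuousLinearMap
    ((LinearMap.trace ℝ E).comp (ContinuousLinearMap.coeLM ℝ))
  have hderiv : fderiv ℝ (fun z ↦ tr (N z)) y v = tr (fderiv ℝ N y v) :=
    congrArg (fun l : E →L[ℝ] ℝ ↦ l v) (tr.hasFDerivAt.comp y hN.hasFDerivAt).fderiv
  have hcomm : tr ((christoffel g y v).comp (N y)) = tr ((N y).comp (christoffel g y v)) :=
    LinearMap.trace_mul_comm ℝ _ _
  change tr (covEnd g N y v) = fderiv ℝ (fun z ↦ tr (N z)) y v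
  rw [hderiv, covEnd, map_sub, map_add, hcomm, add_sub_cancel_right]

lemma differentiableAt_bilin_apply (hg : DifferentiableAt ℝ g y) (hX : DifferentiableAt ℝ X y)
    (hY : DifferentiableAt ℝ Y y) : DifferentiableAt ℝ (fun z ↦ g z (X z) (Y z)) y :=
  (hg.clm_apply hX).clm_apply hY

lemma fderiv_bilin_apply (hg : DifferentiableAt ℝ g y) (hX : DifferentiableAt ℝ X y)
    (hY : DifferentiableAt ℝ Y y) (v : E) :
    fderiv ℝ (fun z ↦ g z (X z) (Y z)) y v
      = fderiv ℝ g y v (X y) (Y y) + g y (fderiv ℝ X y v) (Y y) + g y (X y) (fderiv ℝ Y y v) := by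
  simp only [fderiv_clm_apply (hg.clm_apply hX) hY, fderiv_clm_apply hg hX, add_apply,
    ContinuousLinearMap.comp_apply, ContinuousLinearMap.flip_apply]
  ring

end

namespace IsLocalMetric

variable {Ω : Set E} {g : E → E →L[ℝ] E →L[ℝ] ℝ} {y : E}

lemma mem_nhds (hg : IsLocalMetric Ω g) (hy : y ∈ Ω) : Ω ∈ 𝓝 y := hg.isOpen.mem_nhds hy

lemma contDiffAt (hg : IsLocalMetric Ω g) (hy : y ∈ Ω) : ContDiffAt ℝ ∞ g y :=
  hg.smooth.contDiffAt (hg.mem_nhds hy)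

lemma differentiableAt (hg : IsLocalMetric Ω g) (hy : y ∈ Ω) : DifferentiableAt ℝ g y :=
  (hg.contDiffAt hy).differentiableAt (by simp)

lemma contDiffAt_fderiv (hg : IsLocalMetric Ω g) (hy : y ∈ Ω) : ContDiffAt ℝ ∞ (fderiv ℝ g) y :=
  (hg.contDiffAt hy).fderiv_right (by simp)

lemma fderiv_apply_comm (hg : IsLocalMetric Ω g) (hy : y ∈ Ω) (a v w : E) :
    fderiv ℝ g y a v w = fderiv ℝ g y a w v := by
  have hsymm : (fun z ↦ g z v w) =ᶠ[𝓝 y] fun z ↦ g z w v := by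
    filter_upwards [hg.mem_nhds hy] with z hz using hg.symm z hz v w
  have hconst (v w : E) : fderiv ℝ (fun z ↦ g z v w) y a = fderiv ℝ g y a v w := by
    simpa using fderiv_bilin_apply (hg.differentiableAt hy) (differentiableAt_const v)
      (differentiableAt_const w) a
  rw [← hconst, hsymm.fderiv_eq, hconst]

lemma eq_of_forall_apply_eq (hg : IsLocalMetric Ω g) (hy : y ∈ Ω) {v w : E}
    (h : ∀ z, g y v z = g y w z) : v = w := by
  by_contra hne
  have hpos := hg.pos y hy (v - w) (sub_ne_zero.2 hne)
  rw [map_sub (g y), sub_apply, h, sub_self] at hpos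
  exact hpos.false

lemma contDiffAt_christoffelLower (hg : IsLocalMetric Ω g) (hy : y ∈ Ω) :
    ContDiffAt ℝ ∞ (christoffelLower g) y := by
  have h := hg.contDiffAt_fderiv hy
  have hf : ContDiffAt ℝ ∞ (fun z ↦ (fderiv ℝ g z).flip) y :=
    (flipₗᵢ ℝ E E (E →L[ℝ] ℝ)).toContinuousLinearEquiv.contDiff.contDiffAt.comp y h
  exact ((h.add hf).sub (contDiffAt_const.clm_comp hf)).const_smul (1 / 2 : ℝ)

variable [FiniteDimensional ℝ E]

lemma isInvertible (hg : IsLocalMetric Ω g) (hy : y ∈ Ω) : (g y).IsInvertible := by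
  have hinj : Function.Injective (g y : E →ₗ[ℝ] (E →L[ℝ] ℝ)) := fun v w h ↦
    hg.eq_of_forall_apply_eq hy fun z ↦ congrArg (fun l : E →L[ℝ] ℝ ↦ l z) h
  have hdim : Module.finrank ℝ E = Module.finrank ℝ (E →L[ℝ] ℝ) := by
    rw [← (LinearMap.toContinuousLinearMap : (E →ₗ[ℝ] ℝ) ≃ₗ[ℝ] E →L[ℝ] ℝ).finrank_eq,
      Module.finrank_linearMap, Module.finrank_self, mul_one]
  exact ⟨(LinearEquiv.ofInjectiveOfFinrankEq _ hinj hdim).toContinuousLinearEquiv, by ext; rfl⟩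

lemma contDiffAt_inverse (hg : IsLocalMetric Ω g) (hy : y ∈ Ω) :
    ContDiffAt ℝ ∞ (fun z ↦ (g z).inverse) y :=
  (hg.isInvertible hy).contDiffAt_map_inverse.comp y (hg.contDiffAt hy)

lemma contDiffAt_christoffel (hg : IsLocalMetric Ω g) (hy : y ∈ Ω) :
    ContDiffAt ℝ ∞ (christoffel g) y :=
  ((compL ℝ E (E →L[ℝ] ℝ) E).contDiff.contDiffAt.comp y (hg.contDiffAt_inverse hy)).clm_comp
    (hg.contDiffAt_christoffelLower hy)

lemma differentiableAt_christoffel (hg : IsLocalMetric Ω g) (hy : y ∈ Ω) :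
    DifferentiableAt ℝ (christoffel g) y :=
  (hg.contDiffAt_christoffel hy).differentiableAt (by simp)

lemma contDiffAt_cov (hg : IsLocalMetric Ω g) (hy : y ∈ Ω) {u : E → E}
    (hu : ContDiffAt ℝ ∞ u y) : ContDiffAt ℝ ∞ (cov g u) y := by
  have hflip : ContDiffAt ℝ ∞ (fun z ↦ (christoffel g z).flip) y :=
    (flipₗᵢ ℝ E E E).toContinuousLinearEquiv.contDiff.contDiffAt.comp y
      (hg.contDiffAt_christoffel hy)
  exact (hu.fderiv_right (m := ∞) (by simp)).add (hflip.clm_apply hu)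

lemma differentiableAt_cov (hg : IsLocalMetric Ω g) (hy : y ∈ Ω) {u : E → E}
    (hu : ContDiffAt ℝ ∞ u y) : DifferentiableAt ℝ (cov g u) y :=
  (hg.contDiffAt_cov hy hu).differentiableAt (by simp)

lemma apply_christoffel (hg : IsLocalMetric Ω g) (hy : y ∈ Ω) (v w z : E) :
    g y (christoffel g y v w) z =
      (1 / 2) * (fderiv ℝ g y v w z + fderiv ℝ g y w v z - fderiv ℝ g y z v w) := by
  rw [← christoffelLower_apply]
  exact congrArg (fun l : E →L[ℝ] ℝ ↦ l z) ((hg.isInvertible hy).self_apply_inverse _)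

lemma christoffel_comm (hg : IsLocalMetric Ω g) (hy : y ∈ Ω) (v w : E) :
    christoffel g y v w = christoffel g y w v :=
  hg.eq_of_forall_apply_eq hy fun z ↦ by
    rw [hg.apply_christoffel hy, hg.apply_christoffel hy, hg.fderiv_apply_comm hy z v w]
    ring

lemma fderiv_apply_eq_christoffel (hg : IsLocalMetric Ω g) (hy : y ∈ Ω) (a v w : E) :
    fderiv ℝ g y a v w = g y (christoffel g y a v) w + g y v (christoffel g y a w) := by
  rw [hg.symm y hy v, hg.apply_christoffel hy, hg.apply_christoffel hy,
    hg.fderiv_apply_comm hy a w v, hg.fderiv_apply_comm hy v a w, hg.fderiv_apply_comm hy w a v]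
  ring

lemma fderiv_apply_eq_cov (hg : IsLocalMetric Ω g) (hy : y ∈ Ω) {X Y : E → E}
    (hX : DifferentiableAt ℝ X y) (hY : DifferentiableAt ℝ Y y) (v : E) :
    fderiv ℝ (fun z ↦ g z (X z) (Y z)) y v
      = g y (cov g X y v) (Y y) + g y (X y) (cov g Y y v) := by
  rw [fderiv_bilin_apply (hg.differentiableAt hy) hX hY, hg.fderiv_apply_eq_christoffel hy,
    cov_apply, cov_apply]
  simp only [map_add, add_apply]
  ring

lemma lieBracket_eq_cov_sub_cov (hg : IsLocalMetric Ω g) (hy : y ∈ Ω) (X Y : E → E) :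
    VectorField.lieBracket ℝ X Y y = cov g Y y (X y) - cov g X y (Y y) := by
  rw [VectorField.lieBracket_eq, cov_apply, cov_apply, hg.christoffel_comm hy (X y)]
  module

lemma koszul_formula (hg : IsLocalMetric Ω g) (hy : y ∈ Ω) {X Y Z : E → E}
    (hX : DifferentiableAt ℝ X y) (hY : DifferentiableAt ℝ Y y) (hZ : DifferentiableAt ℝ Z y) :
    (1 / 2) * (fderiv ℝ (fun z ↦ g z (Y z) (Z z)) y (X y)
      + fderiv ℝ (fun z ↦ g z (Z z) (X z)) y (Y y)
      - fderiv ℝ (fun z ↦ g z (X z) (Y z)) y (Z y)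
      + g y (VectorField.lieBracket ℝ X Y y) (Z y)
      - g y (VectorField.lieBracket ℝ Y Z y) (X y)
      + g y (VectorField.lieBracket ℝ Z X y) (Y y)) = g y (cov g Y y (X y)) (Z y) := by
  simp only [hg.fderiv_apply_eq_cov hy hX hY, hg.fderiv_apply_eq_cov hy hY hZ,
    hg.fderiv_apply_eq_cov hy hZ hX, hg.lieBracket_eq_cov_sub_cov hy, map_sub, sub_apply]
  rw [hg.symm y hy (Y y), hg.symm y hy (Z y) (cov g X y (Y y)),
    hg.symm y hy (X y) (cov g Y y (Z y))]
  ring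

lemma fderiv_cov_apply (hg : IsLocalMetric Ω g) (hy : y ∈ Ω) {u : E → E}
    (hu : ContDiffAt ℝ ∞ u y) (v a : E) :
    fderiv ℝ (cov g u) y v a = fderiv ℝ (fderiv ℝ u) y v a
      + fderiv ℝ (christoffel g) y v a (u y) + christoffel g y a (fderiv ℝ u y v) := by
  have hdu : DifferentiableAt ℝ (fderiv ℝ u) y :=
    (hu.fderiv_right (m := ∞) (by simp)).differentiableAt (by simp)
  have hflip : HasFDerivAt (fun z ↦ (christoffel g z).flip) _ y :=
    (flipₗᵢ ℝ E E E).toContinuousLinearEquiv.hasFDerivAt.comp y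
      (hg.differentiableAt_christoffel hy).hasFDerivAt
  have hcov : HasFDerivAt (cov g u) _ y :=
    hdu.hasFDerivAt.add (hflip.clm_apply (hu.differentiableAt (by simp)).hasFDerivAt)
  rw [hcov.fderiv]
  simp [add_comm, add_left_comm]

/-- The Ricci identity. -/
lemma covEnd_cov_sub_covEnd_cov (hg : IsLocalMetric Ω g) (hy : y ∈ Ω) {u : E → E}
    (hu : ContDiffAt ℝ ∞ u y) (v a : E) :
    covEnd g (cov g u) y v a - covEnd g (cov g u) y a v = curv g y v a (u y) := by
  have hsymm : fderiv ℝ (fderiv ℝ u) y v a = fderiv ℝ (fderiv ℝ u) y a v := by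
    refine (hu.isSymmSndFDerivAt ?_).eq v a
    rw [minSmoothness_of_isRCLikeNormedField]
    exact WithTop.coe_le_coe.2 le_top
  simp only [covEnd_apply, hg.fderiv_cov_apply hy hu, curv, hsymm, hg.christoffel_comm hy v a,
    cov_apply, map_add]
  abel

lemma curv_eq_cov_commutator (hg : IsLocalMetric Ω g) (hy : y ∈ Ω) {X Y Z : E → E}
    (hX : DifferentiableAt ℝ X y) (hY : DifferentiableAt ℝ Y y) (hZ : ContDiffAt ℝ ∞ Z y) :
    curv g y (X y) (Y y) (Z y)
      = cov g (fun z ↦ cov g Z z (Y z)) y (X y) - cov g (fun z ↦ cov g Z z (X z)) y (Y y)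
        - cov g Z y (VectorField.lieBracket ℝ X Y y) := by
  have hcov := hg.differentiableAt_cov hy hZ
  rw [cov_clm_apply hcov hX, cov_clm_apply hcov hY, ← hg.covEnd_cov_sub_covEnd_cov hy hZ,
    hg.lieBracket_eq_cov_sub_cov hy, map_sub]
  abel

/-- With `N = ∇u`, the form `(a, b) ↦ g (N a) b - g (N b) a` is the exterior derivative of
`g u ·`; this computes its covariant derivative. -/
lemma fderiv_antisymm_apply (hg : IsLocalMetric Ω g) (hy : y ∈ Ω) {N : E → E →L[ℝ] E}
    {a b : E → E} (hN : DifferentiableAt ℝ N y) (ha : DifferentiableAt ℝ a y)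
    (hb : DifferentiableAt ℝ b y) (v : E) :
    fderiv ℝ (fun z ↦ g z (N z (a z)) (b z) - g z (N z (b z)) (a z)) y v
      - (g y (N y (cov g a y v)) (b y) - g y (N y (b y)) (cov g a y v))
      - (g y (N y (a y)) (cov g b y v) - g y (N y (cov g b y v)) (a y))
      = g y (covEnd g N y v (a y)) (b y) - g y (covEnd g N y v (b y)) (a y) := by
  have hNa : DifferentiableAt ℝ (fun z ↦ N z (a z)) y := hN.clm_apply ha
  have hNb : DifferentiableAt ℝ (fun z ↦ N z (b z)) y := hN.clm_apply hb
  have hgy := hg.differentiableAt hy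
  rw [fderiv_fun_sub (differentiableAt_bilin_apply hgy hNa hb)
      (differentiableAt_bilin_apply hgy hNb ha), sub_apply, hg.fderiv_apply_eq_cov hy hNa hb,
    hg.fderiv_apply_eq_cov hy hNb ha, cov_clm_apply hN ha, cov_clm_apply hN hb]
  simp only [map_add, add_apply]
  ring

/-- The field `W` with `g W a = g (∇_a u) u` is the gradient of the energy density `g u u / 2`. -/
lemma apply_cov_of_apply_eq_cov (hg : IsLocalMetric Ω g) (hy : y ∈ Ω) {u W : E → E}
    (hu : ContDiffAt ℝ ∞ u y) (hW : DifferentiableAt ℝ W y)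
    (hWu : ∀ z ∈ Ω, ∀ a, g z (W z) a = g z (cov g u z a) (u z)) (v a : E) :
    g y (cov g W y v) a = g y (covEnd g (cov g u) y v a) (u y)
      + g y (cov g u y a) (cov g u y v) := by
  have hN := hg.differentiableAt_cov hy hu
  have hconst : DifferentiableAt ℝ (fun _ : E ↦ a) y := differentiableAt_const a
  have hWu_nhds : (fun z ↦ g z (W z) a) =ᶠ[𝓝 y] fun z ↦ g z (cov g u z a) (u z) := by
    filter_upwards [hg.mem_nhds hy] with z hz using hWu z hz a
  have hderiv := hg.fderiv_apply_eq_cov hy hW hconst v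
  rw [hWu_nhds.fderiv_eq, hg.fderiv_apply_eq_cov hy (hN.clm_apply hconst)
    (hu.differentiableAt (by simp)), cov_clm_apply hN hconst, hWu y hy] at hderiv
  simp only [map_add, add_apply] at hderiv
  linarith

/-- The Bochner-Weitzenböck formula: the left-hand side is the `d* d` term, and the derivative of
the divergence on the right is the `d d*` term. -/
lemma bochner_formula (hg : IsLocalMetric Ω g) (hy : y ∈ Ω) {ι : Type*} [Fintype ι] {e : ι → E}
    (he : ∀ A : E →L[ℝ] E, ∑ i, g y (A (e i)) (e i) = LinearMap.trace ℝ E (A : E →ₗ[ℝ] E))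
    {u W : E → E} (hu : ContDiffAt ℝ ∞ u y) (hW : DifferentiableAt ℝ W y)
    (hWu : ∀ z ∈ Ω, ∀ a, g z (W z) a = g z (cov g u z a) (u z)) :
    -∑ i, (g y (covEnd g (cov g u) y (e i) (e i)) (u y)
        - g y (covEnd g (cov g u) y (e i) (u y)) (e i))
      = ∑ i, g y (cov g u y (e i)) (cov g u y (e i))
        - LinearMap.trace ℝ E (cov g W y : E →ₗ[ℝ] E)
        + ∑ i, g y (curv g y (e i) (u y) (u y)) (e i)
        + fderiv ℝ (fun z ↦ LinearMap.trace ℝ E (cov g u z : E →ₗ[ℝ] E)) y (u y) := by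
  have hricci : ∑ i, g y (covEnd g (cov g u) y (e i) (u y)) (e i)
      = ∑ i, g y (curv g y (e i) (u y) (u y)) (e i)
        + fderiv ℝ (fun z ↦ LinearMap.trace ℝ E (cov g u z : E →ₗ[ℝ] E)) y (u y) := by
    rw [← trace_covEnd (g := g) (hg.differentiableAt_cov hy hu), ← he, ← Finset.sum_add_distrib]
    refine Finset.sum_congr rfl fun i _ ↦ ?_
    rw [← hg.covEnd_cov_sub_covEnd_cov hy hu, ← add_apply, ← map_add, sub_add_cancel]
  rw [← he (cov g W y), Finset.sum_sub_distrib, hricci]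
  simp only [hg.apply_cov_of_apply_eq_cov hy hu hW hWu, Finset.sum_add_distrib]
  ring

end IsLocalMetric

end LocalMetric

section Density

lemma fderiv_matrix_det {𝕜 F ι : Type*} [NontriviallyNormedField 𝕜] [NormedAddCommGroup F]
    [NormedSpace 𝕜 F] [Fintype ι] [DecidableEq ι] {A : F → Matrix ι ι 𝕜} {x : F}
    (hA : ∀ i j, DifferentiableAt 𝕜 (fun z ↦ A z i j) x) (v : F) :
    fderiv 𝕜 (fun z ↦ (A z).det) x v
      = ((A x).adjugate * Matrix.of fun i j ↦ fderiv 𝕜 (fun z ↦ A z i j) x v).trace := by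
  let det : ContinuousMultilinearMap 𝕜 (fun _ : ι ↦ ι → 𝕜) 𝕜 :=
    ⟨Matrix.detRowAlternating.toMultilinearMap, Continuous.matrix_det continuous_id⟩
  have hrows : HasFDerivAt (fun z i j ↦ A z i j)
      (.pi fun i ↦ .pi fun j ↦ fderiv 𝕜 (fun z ↦ A z i j) x) x :=
    hasFDerivAt_pi.2 fun i ↦ hasFDerivAt_pi.2 fun j ↦ (hA i j).hasFDerivAt
  have hdet : HasFDerivAt (fun z ↦ (A z).det) _ x := (det.hasFDerivAt _).comp x hrows
  calc fderiv 𝕜 (fun z ↦ (A z).det) x v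
      = det.linearDeriv (fun i j ↦ A x i j) (fun i j ↦ fderiv 𝕜 (fun z ↦ A z i j) x v) := by
        rw [hdet.fderiv]; rfl
    _ = ∑ i, ((A x).updateRow i fun j ↦ fderiv 𝕜 (fun z ↦ A z i j) x v).det :=
        det.linearDeriv_apply _ _
    _ = ((Matrix.of fun i j ↦ fderiv 𝕜 (fun z ↦ A z i j) x v) * (A x).adjugate).trace := by
        simp only [← Matrix.cramer_transpose_apply, Matrix.cramer_eq_adjugate_mulVec,
          ← Matrix.adjugate_transpose, Matrix.mulVec_transpose]
        rfl
    _ = _ := Matrix.trace_mul_comm _ _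

variable {ι E : Type*} [Fintype ι] [DecidableEq ι] [NormedAddCommGroup E] [NormedSpace ℝ E]

/-- The Gram matrix of a bilinear form in a basis. -/
def gram (b : Module.Basis ι ℝ E) (B : E →L[ℝ] E →L[ℝ] ℝ) : Matrix ι ι ℝ :=
  LinearMap.toMatrix₂ b b B.toLinearMap₁₂

/-- The Riemannian density `√(det g)` of a metric, relative to the Lebesgue measure for which
the basis `b` spans a unit cube. -/
def density (b : Module.Basis ι ℝ E) (g : E → E →L[ℝ] E →L[ℝ] ℝ) (y : E) : ℝ :=
  √(gram b (g y)).det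

variable {b : Module.Basis ι ℝ E} {Ω : Set E} {g : E → E →L[ℝ] E →L[ℝ] ℝ} {y : E}

lemma gram_apply (B : E →L[ℝ] E →L[ℝ] ℝ) (i j : ι) : gram b B i j = B (b i) (b j) :=
  LinearMap.toMatrix₂_apply ..

lemma gram_posDef (hg : IsLocalMetric Ω g) (hy : y ∈ Ω) : (gram b (g y)).PosDef := by
  rw [Matrix.posDef_iff_dotProduct_mulVec]
  refine ⟨?_, fun x hx ↦ ?_⟩
  · ext i j
    simp only [Matrix.conjTranspose_apply, gram_apply, star_trivial, hg.symm y hy (b j)]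
  · have hpos := hg.pos y hy (b.equivFun.symm x) (b.equivFun.symm.map_ne_zero_iff.2 hx)
    have hgram := dotProduct_toMatrix₂_mulVec b b (g y).toLinearMap₁₂ x x
    exact hpos.trans_eq hgram.symm

lemma gram_det_pos (hg : IsLocalMetric Ω g) (hy : y ∈ Ω) : 0 < (gram b (g y)).det :=
  (gram_posDef hg hy).det_pos

lemma density_pos (hg : IsLocalMetric Ω g) (hy : y ∈ Ω) : 0 < density b g y :=
  Real.sqrt_pos.2 (gram_det_pos hg hy)

lemma contDiffAt_gram_apply (hg : IsLocalMetric Ω g) (hy : y ∈ Ω) (i j : ι) :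
    ContDiffAt ℝ ∞ (fun z ↦ gram b (g z) i j) y := by
  simp only [gram_apply]
  exact ((hg.contDiffAt hy).clm_apply contDiffAt_const).clm_apply contDiffAt_const

lemma contDiffAt_gram_det (hg : IsLocalMetric Ω g) (hy : y ∈ Ω) :
    ContDiffAt ℝ ∞ (fun z ↦ (gram b (g z)).det) y := by
  simp only [Matrix.det_apply']
  exact ContDiffAt.sum fun σ _ ↦ contDiffAt_const.mul
    (contDiffAt_prod fun i _ ↦ contDiffAt_gram_apply hg hy _ _)

lemma contDiffAt_density (hg : IsLocalMetric Ω g) (hy : y ∈ Ω) :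
    ContDiffAt ℝ ∞ (density b g) y :=
  (contDiffAt_gram_det hg hy).sqrt (gram_det_pos hg hy).ne'

variable [FiniteDimensional ℝ E]

lemma fderiv_gram (hg : IsLocalMetric Ω g) (hy : y ∈ Ω) (v : E) :
    (Matrix.of fun i j ↦ fderiv ℝ (fun z ↦ gram b (g z) i j) y v)
      = (LinearMap.toMatrix b b (christoffel g y v : E →ₗ[ℝ] E)).transpose * gram b (g y)
        + gram b (g y) * LinearMap.toMatrix b b (christoffel g y v : E →ₗ[ℝ] E) := by
  rw [gram, ← LinearMap.toMatrix₂_comp, ← LinearMap.toMatrix₂_compl₂, ← map_add]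
  ext i j
  rw [Matrix.of_apply, LinearMap.toMatrix₂_apply]
  simp only [gram_apply]
  rw [fderiv_bilin_apply (hg.differentiableAt hy) (differentiableAt_const _)
    (differentiableAt_const _), hg.fderiv_apply_eq_christoffel hy]
  simp

lemma fderiv_gram_det (hg : IsLocalMetric Ω g) (hy : y ∈ Ω) (v : E) :
    fderiv ℝ (fun z ↦ (gram b (g z)).det) y v
      = 2 * (gram b (g y)).det * LinearMap.trace ℝ E (christoffel g y v : E →ₗ[ℝ] E) := by
  rw [fderiv_matrix_det (A := fun z ↦ gram b (g z)) fun i j ↦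
      (contDiffAt_gram_apply hg hy i j).differentiableAt (by simp), fderiv_gram hg hy,
    LinearMap.trace_eq_matrix_trace ℝ b, mul_add, Matrix.trace_add, ← mul_assoc, ← mul_assoc,
    Matrix.trace_mul_comm, ← mul_assoc, Matrix.adjugate_mul, Matrix.mul_adjugate]
  simp only [smul_mul_assoc, one_mul, Matrix.trace_smul, Matrix.trace_transpose, smul_eq_mul]
  ring

lemma fderiv_density (hg : IsLocalMetric Ω g) (hy : y ∈ Ω) (v : E) :
    fderiv ℝ (density b g) y v
      = density b g y * LinearMap.trace ℝ E (christoffel g y v : E →ₗ[ℝ] E) := by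
  have hdet : 0 < (gram b (g y)).det := gram_det_pos hg hy
  have hsqrt := ((contDiffAt_gram_det (b := b) hg hy).differentiableAt (by simp)).hasFDerivAt.sqrt
    hdet.ne'
  change fderiv ℝ (fun z ↦ √(gram b (g z)).det) y v = _
  rw [hsqrt.fderiv, smul_apply, smul_eq_mul, fderiv_gram_det hg hy, density]
  have hne : √(gram b (g y)).det ≠ 0 := (Real.sqrt_pos.2 hdet).ne'
  field_simp
  rw [Real.sq_sqrt hdet.le]

lemma trace_fderiv_density_smul (hg : IsLocalMetric Ω g) (hy : y ∈ Ω) {V : E → E}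
    (hV : DifferentiableAt ℝ V y) :
    LinearMap.trace ℝ E (fderiv ℝ (fun z ↦ density b g z • V z) y : E →ₗ[ℝ] E)
      = density b g y * LinearMap.trace ℝ E (cov g V y : E →ₗ[ℝ] E) := by
  have hcov : (cov g V y : E →ₗ[ℝ] E) = fderiv ℝ V y + christoffel g y (V y) := by
    ext v
    simp [cov_apply, hg.christoffel_comm hy v]
  have hfderiv : (fderiv ℝ (fun z ↦ density b g z • V z) y : E →ₗ[ℝ] E)
      = density b g y • (fderiv ℝ V y : E →ₗ[ℝ] E)
        + (fderiv ℝ (density b g) y : E →ₗ[ℝ] ℝ).smulRight (V y) := by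
    ext v
    simp [fderiv_fun_smul ((contDiffAt_density hg hy).differentiableAt (by simp)) hV]
  rw [hfderiv, hcov]
  simp only [map_add, map_smul, LinearMap.trace_smulRight, smul_eq_mul, mul_add]
  rw [ContinuousLinearMap.coe_coe, fderiv_density hg hy]

lemma trace_eq_sum_single {n : ℕ}
    (A : EuclideanSpace ℝ (Fin n) →ₗ[ℝ] EuclideanSpace ℝ (Fin n)) :
    LinearMap.trace ℝ (EuclideanSpace ℝ (Fin n)) A = ∑ i, A (EuclideanSpace.single i 1) i := by
  rw [LinearMap.trace_eq_sum_inner _ (EuclideanSpace.basisFun (Fin n) ℝ)]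
  simp [EuclideanSpace.inner_single_left]

end Density

section Chart

variable {n : ℕ} {M : Type*} [TopologicalSpace M]
  [ChartedSpace (𝔼 n) M]

/-- The domain of the chart centred at `c`. -/
abbrev chartDom (c : M) : Set M := (chartAt (𝔼 n) c).source

/-- The image of the chart centred at `c`. -/
abbrev chartTarget (c : M) : Set (𝔼 n) := (extChartAt (𝓡 n) c).target

lemma isOpen_chartDom (c : M) : IsOpen (chartDom (n := n) c) := (chartAt _ c).open_source

lemma isOpen_chartTarget (c : M) : IsOpen (chartTarget (n := n) c) := isOpen_extChartAt_target c

lemma chart_mem_chartTarget {c x : M} (hx : x ∈ chartDom (n := n) c) :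
    extChartAt (𝓡 n) c x ∈ chartTarget c :=
  (extChartAt (𝓡 n) c).map_source (by rwa [extChartAt_source])

lemma chart_symm_mem_chartDom {c : M} {y : 𝔼 n} (hy : y ∈ chartTarget c) :
    (extChartAt (𝓡 n) c).symm y ∈ chartDom (n := n) c := by
  simpa only [extChartAt_source] using (extChartAt (𝓡 n) c).map_target hy

lemma chart_left_inv {c x : M} (hx : x ∈ chartDom (n := n) c) :
    (extChartAt (𝓡 n) c).symm (extChartAt (𝓡 n) c x) = x :=
  (extChartAt (𝓡 n) c).left_inv (by rwa [extChartAt_source])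

lemma chart_right_inv {c : M} {y : 𝔼 n} (hy : y ∈ chartTarget c) :
    extChartAt (𝓡 n) c ((extChartAt (𝓡 n) c).symm y) = y :=
  (extChartAt (𝓡 n) c).right_inv hy

lemma eventually_mem_chartDom {c x : M} (hx : x ∈ chartDom (n := n) c) :
    ∀ᶠ z in 𝓝 x, z ∈ chartDom (n := n) c :=
  (isOpen_chartDom c).mem_nhds hx

lemma eventually_mem_chartTarget {c x : M} (hx : x ∈ chartDom (n := n) c) :
    ∀ᶠ y in 𝓝 (extChartAt (𝓡 n) c x), y ∈ chartTarget (n := n) c :=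
  (isOpen_chartTarget c).mem_nhds (chart_mem_chartTarget hx)

variable [IsManifold (𝓡 n) ∞ M]

lemma contMDiffAt_chart_symm {c : M} {y : 𝔼 n} (hy : y ∈ chartTarget c) :
    ContMDiffAt 𝓘(ℝ, 𝔼 n) (𝓡 n) ∞ (extChartAt (𝓡 n) c).symm y :=
  (contMDiffOn_extChartAt_symm c).contMDiffAt ((isOpen_chartTarget c).mem_nhds hy)

lemma contMDiffAt_chart {c x : M} (hx : x ∈ chartDom (n := n) c) :
    ContMDiffAt (𝓡 n) 𝓘(ℝ, 𝔼 n) ∞ (extChartAt (𝓡 n) c) x :=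
  contMDiffOn_extChartAt.contMDiffAt ((isOpen_chartDom c).mem_nhds hx)

lemma tendsto_chart_symm {c x : M} (hx : x ∈ chartDom (n := n) c) :
    Filter.Tendsto (extChartAt (𝓡 n) c).symm (𝓝 (extChartAt (𝓡 n) c x)) (𝓝 x) := by
  simpa only [chart_left_inv hx] using
    (contMDiffAt_chart_symm (chart_mem_chartTarget hx)).continuousAt.tendsto

/-- The coordinates of tangent vectors at `x` in the chart centred at `c`. -/
def toCoord (c x : M) : TangentSpace (𝓡 n) x →L[ℝ] 𝔼 n :=
  (trivializationAt (𝔼 n) (TangentSpace (𝓡 n)) c).continuousLinearMapAt ℝ x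

/-- The tangent vector at `x` with given coordinates in the chart centred at `c`. -/
def ofCoord (c x : M) : 𝔼 n →L[ℝ] TangentSpace (𝓡 n) x :=
  (trivializationAt (𝔼 n) (TangentSpace (𝓡 n)) c).symmL ℝ x

lemma mem_baseSet {c x : M} (hx : x ∈ chartDom (n := n) c) :
    x ∈ (trivializationAt (𝔼 n) (TangentSpace (𝓡 n)) c).baseSet := by
  simpa using hx

lemma ofCoord_toCoord {c x : M} (hx : x ∈ chartDom (n := n) c) (v : TangentSpace (𝓡 n) x) :
    ofCoord c x (toCoord c x v) = v :=
  Trivialization.symmL_continuousLinearMapAt _ (mem_baseSet hx) v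

lemma toCoord_ofCoord {c x : M} (hx : x ∈ chartDom (n := n) c) (v : 𝔼 n) :
    toCoord c x (ofCoord c x v) = v :=
  Trivialization.continuousLinearMapAt_symmL _ (mem_baseSet hx) v

lemma toCoord_eq_snd {c x : M} (hx : x ∈ chartDom (n := n) c) (v : TangentSpace (𝓡 n) x) :
    toCoord c x v = (trivializationAt (𝔼 n) (TangentSpace (𝓡 n)) c ⟨x, v⟩).2 := by
  rw [toCoord, Trivialization.continuousLinearMapAt_apply,
    Trivialization.coe_linearMapAt_of_mem _ (mem_baseSet hx)]

/-- The coordinate expression, in the chart centred at `c`, of the vector field `V`. -/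
def coordField (c : M) (V : VField n M) (y : 𝔼 n) : 𝔼 n :=
  toCoord c _ (V ((extChartAt (𝓡 n) c).symm y))

lemma coordField_chart {c x : M} (hx : x ∈ chartDom (n := n) c) (V : VField n M) :
    coordField c V (extChartAt (𝓡 n) c x) = toCoord c x (V x) :=
  congrArg (fun z ↦ toCoord c z (V z)) (chart_left_inv hx)

/-- The vector field `V` is smooth near `x`. -/
def SmoothAt (V : VField n M) (x : M) : Prop :=
  ContMDiffAt (𝓡 n) (𝓡 n).tangent ∞ (fun y ↦ (⟨y, V y⟩ : TangentBundle (𝓡 n) M)) x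

lemma smoothAt_iff_contDiffAt {c x : M} (hx : x ∈ chartDom (n := n) c) (V : VField n M) :
    SmoothAt V x ↔ ContDiffAt ℝ ∞ (coordField c V) (extChartAt (𝓡 n) c x) := by
  have hsection : SmoothAt V x ↔ ContMDiffAt (𝓡 n) 𝓘(ℝ, 𝔼 n) ∞ (fun z ↦ toCoord c z (V z)) x := by
    refine ((trivializationAt (𝔼 n) (TangentSpace (𝓡 n)) c).contMDiffAt_section_iff
      (mem_baseSet hx)).trans (Filter.EventuallyEq.contMDiffAt_iff ?_)
    filter_upwards [eventually_mem_chartDom hx] with z hz using (toCoord_eq_snd hz _).symm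
  rw [hsection, ← contMDiffAt_iff_contDiffAt]
  constructor
  · intro h
    exact ContMDiffAt.comp_of_eq (f := (extChartAt (𝓡 n) c).symm) (x := extChartAt (𝓡 n) c x) h
      (contMDiffAt_chart_symm (chart_mem_chartTarget hx)) (chart_left_inv hx)
  · intro h
    refine (ContMDiffAt.comp x h (contMDiffAt_chart hx)).congr_of_eventuallyEq ?_
    filter_upwards [eventually_mem_chartDom hx] with z hz using (coordField_chart hz V).symm

lemma smoothAt_ext_of_mem {x z : M} (v : TangentSpace (𝓡 n) x) (hz : z ∈ chartDom (n := n) x) :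
    SmoothAt (ext v) z := by
  have hx : x ∈ chartDom (n := n) x := mem_chart_source _ x
  rw [smoothAt_iff_contDiffAt hz]
  refine (contDiffAt_const (c := toCoord x x v)).congr_of_eventuallyEq ?_
  filter_upwards [eventually_mem_chartTarget hz] with y hy
  have h := chart_symm_mem_chartDom hy
  rw [coordField, toCoord_eq_snd h, ext, FiberBundle.extend,
    Trivialization.apply_mk_symm _ (mem_baseSet h), toCoord_eq_snd hx]

lemma smoothAt_ext {x : M} (v : TangentSpace (𝓡 n) x) : SmoothAt (ext v) x :=
  smoothAt_ext_of_mem v (mem_chart_source _ x)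

lemma eventually_smoothAt_ext {x : M} (v : TangentSpace (𝓡 n) x) :
    ∀ᶠ z in 𝓝 x, SmoothAt (ext v) z := by
  filter_upwards [eventually_mem_chartDom (n := n) (mem_chart_source _ x)] with z hz
    using smoothAt_ext_of_mem v hz

@[simp] lemma ext_self {x : M} (v : TangentSpace (𝓡 n) x) : ext v x = v :=
  FiberBundle.extend_apply_self (𝔼 n) v

lemma mvfderiv_chart {c x : M} (hx : x ∈ chartDom (n := n) c) {f : M → ℝ} {F : 𝔼 n → ℝ}
    (hF : DifferentiableAt ℝ F (extChartAt (𝓡 n) c x))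
    (h : ∀ y ∈ chartTarget c, f ((extChartAt (𝓡 n) c).symm y) = F y) (v : TangentSpace (𝓡 n) x) :
    mvfderiv (𝓡 n) f x v = fderiv ℝ F (extChartAt (𝓡 n) c x) (toCoord c x v) := by
  have hf : f =ᶠ[𝓝 x] F ∘ extChartAt (𝓡 n) c := by
    filter_upwards [eventually_mem_chartDom hx] with z hz
    rw [Function.comp, ← h _ (chart_mem_chartTarget hz), chart_left_inv hz]
  have hcomp := hF.hasFDerivAt.hasMFDerivAt.comp x (mdifferentiableAt_extChartAt hx).hasMFDerivAt
  rw [mvfderiv, (hcomp.congr_of_eventuallyEq hf).mfderiv, toCoord,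
    TangentBundle.continuousLinearMapAt_trivializationAt hx]
  rfl

lemma mfderiv_chart_symm {c : M} {y : 𝔼 n} (hy : y ∈ chartTarget c) :
    mfderiv 𝓘(ℝ, 𝔼 n) (𝓡 n) (extChartAt (𝓡 n) c).symm y
      = ofCoord c ((extChartAt (𝓡 n) c).symm y) := by
  have hx := chart_symm_mem_chartDom hy
  have hcomp := (mdifferentiableAt_extChartAt hx).hasMFDerivAt.comp y
    ((contMDiffAt_chart_symm hy).mdifferentiableAt (by simp)).hasMFDerivAt
  have hid : (extChartAt (𝓡 n) c ∘ (extChartAt (𝓡 n) c).symm) =ᶠ[𝓝 y] id := by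
    filter_upwards [(isOpen_chartTarget c).mem_nhds hy] with z hz using chart_right_inv hz
  have hinv := (hcomp.congr_of_eventuallyEq hid.symm).mfderiv
  rw [mfderiv_id, ← TangentBundle.continuousLinearMapAt_trivializationAt hx] at hinv
  ext v
  rw [← ofCoord_toCoord hx (mfderiv _ _ _ y v)]
  exact congrArg _ (congrArg (fun l ↦ l v) hinv).symm

lemma mpullback_eq_coordField {c : M} {y : 𝔼 n} (hy : y ∈ chartTarget c) (V : VField n M) :
    VectorField.mpullback 𝓘(ℝ, 𝔼 n) (𝓡 n) (extChartAt (𝓡 n) c).symm V y = coordField c V y := by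
  have hx := chart_symm_mem_chartDom hy
  have hinv : (ofCoord c ((extChartAt (𝓡 n) c).symm y)).inverse
      = toCoord c ((extChartAt (𝓡 n) c).symm y) :=
    ContinuousLinearMap.inverse_eq (by ext v : 1; exact ofCoord_toCoord hx v)
      (by ext v : 1; exact toCoord_ofCoord hx v)
  rw [VectorField.mpullback_apply, mfderiv_chart_symm hy]
  exact congrArg (fun l ↦ l (V ((extChartAt (𝓡 n) c).symm y))) hinv

lemma mlieBracket_eq_lieBracket {E : Type*} [NormedAddCommGroup E] [NormedSpace ℝ E]
    {V W V' W' : E → E} {y : E} (hV : V =ᶠ[𝓝 y] V') (hW : W =ᶠ[𝓝 y] W') :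
    VectorField.mlieBracket 𝓘(ℝ, E) V W y = VectorField.lieBracket ℝ V' W' y := by
  refine Eq.trans ?_ (hV.lieBracket_vectorField_eq hW)
  rw [← VectorField.lieBracketWithin_univ]
  exact congrFun (VectorField.mlieBracketWithin_eq_lieBracketWithin (𝕜 := ℝ) (V := V) (W := W)
    (s := univ)) y

lemma toCoord_mlieBracket {c x : M} (hx : x ∈ chartDom (n := n) c) {V W : VField n M}
    (hV : SmoothAt V x) (hW : SmoothAt W x) :
    toCoord c x (VectorField.mlieBracket (𝓡 n) V W x)
      = VectorField.lieBracket ℝ (coordField c V) (coordField c W) (extChartAt (𝓡 n) c x) := by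
  have hy := chart_mem_chartTarget hx
  have hV' : MDifferentiableAt (𝓡 n) (𝓡 n).tangent
      (fun y ↦ (⟨y, V y⟩ : TangentBundle (𝓡 n) M)) x := hV.mdifferentiableAt (by simp)
  have hW' : MDifferentiableAt (𝓡 n) (𝓡 n).tangent
      (fun y ↦ (⟨y, W y⟩ : TangentBundle (𝓡 n) M)) x := hW.mdifferentiableAt (by simp)
  rw [← chart_left_inv hx] at hV' hW'
  have hle : minSmoothness ℝ 2 ≤ ∞ := by
    rw [minSmoothness_of_isRCLikeNormedField]
    exact WithTop.coe_le_coe.2 le_top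
  have : IsManifold (𝓡 n) (minSmoothness ℝ 2) M := IsManifold.of_le hle
  have hpull := VectorField.mpullback_mlieBracket (I := 𝓘(ℝ, 𝔼 n)) hV' hW'
    (contMDiffAt_chart_symm hy) hle
  rw [mpullback_eq_coordField hy, coordField_chart hx] at hpull
  have hcoord (U : VField n M) :
      (fun y ↦ VectorField.mpullback 𝓘(ℝ, 𝔼 n) (𝓡 n) (extChartAt (𝓡 n) c).symm U y : 𝔼 n → 𝔼 n)
        =ᶠ[𝓝 (extChartAt (𝓡 n) c x)] coordField c U := by
    filter_upwards [eventually_mem_chartTarget hx] with y hy using mpullback_eq_coordField hy U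
  exact hpull.trans (mlieBracket_eq_lieBracket (hcoord V) (hcoord W))

lemma contMDiffOn_ofCoord (c : M) (v : 𝔼 n) :
    ContMDiffOn 𝓘(ℝ, 𝔼 n) (𝓡 n).tangent ∞
      (fun y ↦ (⟨(extChartAt (𝓡 n) c).symm y, ofCoord c _ v⟩ : TangentBundle (𝓡 n) M))
      (chartTarget c) := by
  rw [(trivializationAt (𝔼 n) (TangentSpace (𝓡 n)) c).contMDiffOn_iff
    (fun y hy ↦ (Trivialization.mem_source _).2 (mem_baseSet (chart_symm_mem_chartDom hy)))]
  refine ⟨contMDiffOn_extChartAt_symm c, (contMDiffOn_const (c := v)).congr fun y hy ↦ ?_⟩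
  rw [← toCoord_eq_snd (chart_symm_mem_chartDom hy), toCoord_ofCoord (chart_symm_mem_chartDom hy)]

lemma differentiableAt_coordField {c x : M} (hx : x ∈ chartDom (n := n) c) {V : VField n M}
    (hV : SmoothAt V x) : DifferentiableAt ℝ (coordField c V) (extChartAt (𝓡 n) c x) :=
  ((smoothAt_iff_contDiffAt hx V).1 hV).differentiableAt (by simp)

variable [RiemannianBundle (fun x : M ↦ TangentSpace (𝓡 n) x)]

/-- The metric, read in the chart centred at `c`. -/
def coordMetric (c : M) (y : 𝔼 n) : 𝔼 n →L[ℝ] 𝔼 n →L[ℝ] ℝ :=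
  (innerSL ℝ (E := TangentSpace (𝓡 n) ((extChartAt (𝓡 n) c).symm y))).bilinearComp
    (ofCoord c _) (ofCoord c _)

lemma coordMetric_apply (c : M) (y v w : 𝔼 n) :
    coordMetric c y v w = inner ℝ (ofCoord c ((extChartAt (𝓡 n) c).symm y) v)
      (ofCoord c ((extChartAt (𝓡 n) c).symm y) w) := rfl

lemma coordMetric_chart {c x : M} (hx : x ∈ chartDom (n := n) c) (v w : TangentSpace (𝓡 n) x) :
    coordMetric c (extChartAt (𝓡 n) c x) (toCoord c x v) (toCoord c x w) = inner ℝ v w := by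
  have hcoord (z : M) (hz : z = x) :
      inner ℝ (ofCoord c z (toCoord c x v)) (ofCoord c z (toCoord c x w)) = inner ℝ v w := by
    subst hz
    rw [ofCoord_toCoord hx, ofCoord_toCoord hx]
  exact hcoord _ (chart_left_inv hx)

lemma coordMetric_coordField {c : M} {y : 𝔼 n} (hy : y ∈ chartTarget c) (V W : VField n M) :
    coordMetric c y (coordField c V y) (coordField c W y)
      = inner ℝ (V ((extChartAt (𝓡 n) c).symm y)) (W ((extChartAt (𝓡 n) c).symm y)) := by
  have hx := chart_symm_mem_chartDom hy
  rw [coordMetric_apply, coordField, coordField, ofCoord_toCoord hx, ofCoord_toCoord hx]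

end Chart

section Transfer

variable {n : ℕ} {M : Type*} [TopologicalSpace M]
  [ChartedSpace (𝔼 n) M] [RiemannianBundle (fun x : M ↦ TangentSpace (𝓡 n) x)]

lemma inner_sharp {x : M} {α : OneForm n M} (hα : IsLinearMap ℝ (α x))
    (a : TangentSpace (𝓡 n) x) : inner ℝ (sharp α x) a = α x a := by
  change _ = hα.mk' (α x) a
  conv_rhs => rw [← (frame x).sum_repr' a]
  simp only [sharp, sum_inner, inner_smul_left, map_sum, map_smul, conj_trivial,
    IsLinearMap.mk'_apply]
  exact Finset.sum_congr rfl fun i _ ↦ mul_comm _ _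

variable [IsManifold (𝓡 n) ∞ M]

/-- The gradient of `|u|² / 2`, as the vector field dual to `v ↦ ⟨∇_v u, u⟩`. -/
def gradEnergy (u : VField n M) : VField n M :=
  sharp fun x v ↦ inner ℝ (nabla u x v) (u x)

lemma inner_gradEnergy (u : VField n M) (x : M) (a : TangentSpace (𝓡 n) x) :
    inner ℝ (gradEnergy u x) a = inner ℝ (nabla u x a) (u x) :=
  inner_sharp ⟨fun v w ↦ by rw [map_add, inner_add_left],
    fun r v ↦ by rw [map_smul, real_inner_smul_left, smul_eq_mul]⟩ a

variable [IsContMDiffRiemannianBundle (𝓡 n) ∞ (𝔼 n) (fun x : M ↦ TangentSpace (𝓡 n) x)]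

lemma isLocalMetric_coordMetric (c : M) :
    IsLocalMetric (chartTarget (n := n) c) (coordMetric c) where
  isOpen := isOpen_chartTarget c
  smooth := by
    refine contDiffOn_clm_apply.2 fun v ↦ contDiffOn_clm_apply.2 fun w ↦ ?_
    rw [← contMDiffOn_iff_contDiffOn]
    exact ContMDiffOn.inner_bundle (contMDiffOn_ofCoord c v) (contMDiffOn_ofCoord c w)
  symm y _ v w := by rw [coordMetric_apply, coordMetric_apply, real_inner_comm]
  pos y hy v hv := by
    rw [coordMetric_apply, real_inner_self_eq_norm_sq]
    have hne : ofCoord c ((extChartAt (𝓡 n) c).symm y) v ≠ 0 := fun h ↦ hv <| by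
      rw [← toCoord_ofCoord (chart_symm_mem_chartDom hy) v, h, map_zero]
    positivity

lemma mvfderiv_inner_chart {c x : M} (hx : x ∈ chartDom (n := n) c) {V W : VField n M}
    (hV : SmoothAt V x) (hW : SmoothAt W x) (v : TangentSpace (𝓡 n) x) :
    mvfderiv (𝓡 n) (fun y ↦ inner ℝ (V y) (W y)) x v
      = fderiv ℝ (fun y ↦ coordMetric c y (coordField c V y) (coordField c W y))
          (extChartAt (𝓡 n) c x) (toCoord c x v) :=
  mvfderiv_chart hx (differentiableAt_bilin_apply
    ((isLocalMetric_coordMetric c).differentiableAt (chart_mem_chartTarget hx))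
    (differentiableAt_coordField hx hV) (differentiableAt_coordField hx hW))
    (fun _ hy ↦ (coordMetric_coordField hy V W).symm) v

lemma koszul_chart {c x : M} (hx : x ∈ chartDom (n := n) c) {X Y Z : VField n M}
    (hX : SmoothAt X x) (hY : SmoothAt Y x) (hZ : SmoothAt Z x) :
    koszul X Y Z x = coordMetric c (extChartAt (𝓡 n) c x)
      (cov (coordMetric c) (coordField c Y) (extChartAt (𝓡 n) c x) (toCoord c x (X x)))
      (toCoord c x (Z x)) := by
  have hkoszul := (isLocalMetric_coordMetric c).koszul_formula (chart_mem_chartTarget hx)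
    (differentiableAt_coordField hx hX) (differentiableAt_coordField hx hY)
    (differentiableAt_coordField hx hZ)
  simp only [coordField_chart hx] at hkoszul
  rw [← hkoszul, koszul, mvfderiv_inner_chart hx hY hZ, mvfderiv_inner_chart hx hZ hX,
    mvfderiv_inner_chart hx hX hY, ← coordMetric_chart hx, ← coordMetric_chart hx,
    ← coordMetric_chart hx, toCoord_mlieBracket hx hX hY, toCoord_mlieBracket hx hY hZ,
    toCoord_mlieBracket hx hZ hX]

lemma toCoord_nabla {c x : M} (hx : x ∈ chartDom (n := n) c) {Y : VField n M} (hY : SmoothAt Y x)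
    (v : TangentSpace (𝓡 n) x) :
    toCoord c x (nabla Y x v)
      = cov (coordMetric c) (coordField c Y) (extChartAt (𝓡 n) c x) (toCoord c x v) := by
  set L := cov (coordMetric c) (coordField c Y) (extChartAt (𝓡 n) c x) with hL
  have hkoszul (i j) : koszul (ext (frame x i)) Y (ext (frame x j)) x
      = inner ℝ (frame x j) (ofCoord c x (L (toCoord c x (frame x i)))) := by
    rw [koszul_chart hx (smoothAt_ext _) hY (smoothAt_ext _), ext_self, ext_self, ← hL,
      ← toCoord_ofCoord hx (L (toCoord c x (frame x i))), coordMetric_chart hx, toCoord_ofCoord hx,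
      real_inner_comm]
  have hnabla : nabla Y x v = ofCoord c x (L (toCoord c x v)) := by
    conv_rhs => rw [← (frame x).sum_repr' v]
    simp only [nabla, hkoszul, sum_apply, smul_apply, ContinuousLinearMap.smulRight_apply,
      innerSL_apply_apply, map_sum, map_smul]
    refine Finset.sum_congr rfl fun i _ ↦ ?_
    simp only [smul_comm _ (inner ℝ (frame x i) v), ← Finset.smul_sum]
    rw [(frame x).sum_repr']
  rw [hnabla, toCoord_ofCoord hx]

lemma contDiffAt_cov_coordField {c x : M} (hx : x ∈ chartDom (n := n) c) {Y : VField n M}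
    (hY : SmoothAt Y x) :
    ContDiffAt ℝ ∞ (cov (coordMetric c) (coordField c Y)) (extChartAt (𝓡 n) c x) :=
  (isLocalMetric_coordMetric c).contDiffAt_cov (chart_mem_chartTarget hx)
    ((smoothAt_iff_contDiffAt hx Y).1 hY)

lemma sum_coordMetric_frame {c x : M} (hx : x ∈ chartDom (n := n) c) (A : 𝔼 n →L[ℝ] 𝔼 n) :
    ∑ i, coordMetric c (extChartAt (𝓡 n) c x) (A (toCoord c x (frame x i)))
        (toCoord c x (frame x i))
      = LinearMap.trace ℝ (𝔼 n) A := by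
  let e : TangentSpace (𝓡 n) x ≃ₗ[ℝ] 𝔼 n :=
    LinearEquiv.ofLinearMap (toCoord (n := n) c x).toLinearMap (ofCoord (n := n) c x).toLinearMap
      (by ext v : 1; exact toCoord_ofCoord hx v) (by ext v : 1; exact ofCoord_toCoord hx v)
  rw [← LinearMap.trace_conj' (A : 𝔼 n →ₗ[ℝ] 𝔼 n) e.symm,
    LinearMap.trace_eq_sum_inner _ (frame x)]
  refine Finset.sum_congr rfl fun i _ ↦ ?_
  rw [← coordMetric_chart hx, (isLocalMetric_coordMetric c).symm _ (chart_mem_chartTarget hx)]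
  congr 1
  exact (toCoord_ofCoord hx _).symm

lemma divergence_chart {c x : M} (hx : x ∈ chartDom (n := n) c) {u : VField n M}
    (hu : SmoothAt u x) :
    divergence u x = LinearMap.trace ℝ (𝔼 n)
      (cov (coordMetric c) (coordField c u) (extChartAt (𝓡 n) c x) : 𝔼 n →ₗ[ℝ] 𝔼 n) := by
  rw [divergence, ← sum_coordMetric_frame hx]
  refine Finset.sum_congr rfl fun i _ ↦ ?_
  rw [← coordMetric_chart hx, toCoord_nabla hx hu]

end Transfer

section Bochner

variable {n : ℕ} {M : Type*} [TopologicalSpace M] [ChartedSpace (𝔼 n) M]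
  [IsManifold (𝓡 n) ∞ M] [RiemannianBundle (fun x : M ↦ TangentSpace (𝓡 n) x)]
  [IsContMDiffRiemannianBundle (𝓡 n) ∞ (𝔼 n) (fun x : M ↦ TangentSpace (𝓡 n) x)]

lemma coordField_nabla_eventuallyEq {c x : M} (hx : x ∈ chartDom (n := n) c) {Y Z : VField n M}
    (hZ : ∀ᶠ z in 𝓝 x, SmoothAt Z z) :
    coordField c (fun y ↦ nabla Z y (Y y)) =ᶠ[𝓝 (extChartAt (𝓡 n) c x)]
      fun y ↦ cov (coordMetric c) (coordField c Z) y (coordField c Y y) := by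
  filter_upwards [eventually_mem_chartTarget hx, (tendsto_chart_symm hx).eventually hZ]
    with y hy hZy
  rw [coordField, toCoord_nabla (chart_symm_mem_chartDom hy) hZy, chart_right_inv hy]
  rfl

lemma smoothAt_nabla {x : M} {Y Z : VField n M} (hY : SmoothAt Y x)
    (hZ : ∀ᶠ z in 𝓝 x, SmoothAt Z z) : SmoothAt (fun y ↦ nabla Z y (Y y)) x := by
  have hx : x ∈ chartDom (n := n) x := mem_chart_source _ x
  rw [smoothAt_iff_contDiffAt hx]
  exact ((contDiffAt_cov_coordField hx hZ.self_of_nhds).clm_apply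
    ((smoothAt_iff_contDiffAt hx Y).1 hY)).congr_of_eventuallyEq
      (coordField_nabla_eventuallyEq hx hZ)

lemma toCoord_curvature {c x : M} (hx : x ∈ chartDom (n := n) c) {X Y Z : VField n M}
    (hX : SmoothAt X x) (hY : SmoothAt Y x) (hZ : ∀ᶠ z in 𝓝 x, SmoothAt Z z) :
    toCoord c x (curvature X Y Z x)
      = curv (coordMetric c) (extChartAt (𝓡 n) c x) (toCoord c x (X x)) (toCoord c x (Y x))
        (toCoord c x (Z x)) := by
  have hZx := hZ.self_of_nhds
  have hcurv := (isLocalMetric_coordMetric c).curv_eq_cov_commutator (chart_mem_chartTarget hx)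
    (differentiableAt_coordField hx hX) (differentiableAt_coordField hx hY)
    ((smoothAt_iff_contDiffAt hx Z).1 hZx)
  simp only [coordField_chart hx] at hcurv
  rw [hcurv, curvature, map_sub, map_sub, toCoord_nabla hx (smoothAt_nabla hY hZ),
    toCoord_nabla hx (smoothAt_nabla hX hZ), toCoord_nabla hx hZx, toCoord_mlieBracket hx hX hY,
    cov_congr (coordField_nabla_eventuallyEq hx hZ),
    cov_congr (coordField_nabla_eventuallyEq hx hZ)]

lemma ricci_chart {c x : M} (hx : x ∈ chartDom (n := n) c) (v w : TangentSpace (𝓡 n) x) :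
    ricci x v w = ∑ i, coordMetric c (extChartAt (𝓡 n) c x)
      (curv (coordMetric c) (extChartAt (𝓡 n) c x) (toCoord c x (frame x i)) (toCoord c x v)
        (toCoord c x w)) (toCoord c x (frame x i)) := by
  refine Finset.sum_congr rfl fun i _ ↦ ?_
  rw [← coordMetric_chart hx, toCoord_curvature hx (smoothAt_ext _) (smoothAt_ext _)
    (eventually_smoothAt_ext _), ext_self, ext_self, ext_self]

lemma mvfderiv_inner {x : M} {V W : VField n M} (hV : SmoothAt V x) (hW : SmoothAt W x)
    (v : TangentSpace (𝓡 n) x) :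
    mvfderiv (𝓡 n) (fun y ↦ inner ℝ (V y) (W y)) x v
      = inner ℝ (nabla V x v) (W x) + inner ℝ (V x) (nabla W x v) := by
  have hx : x ∈ chartDom (n := n) x := mem_chart_source _ x
  rw [mvfderiv_inner_chart hx hV hW,
    (isLocalMetric_coordMetric x).fderiv_apply_eq_cov (chart_mem_chartTarget hx)
      (differentiableAt_coordField hx hV) (differentiableAt_coordField hx hW),
    ← toCoord_nabla hx hV, ← toCoord_nabla hx hW, coordField_chart hx, coordField_chart hx,
    coordMetric_chart hx, coordMetric_chart hx]

lemma mlieBracket_eq_nabla_sub_nabla {x : M} {V W : VField n M} (hV : SmoothAt V x)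
    (hW : SmoothAt W x) :
    VectorField.mlieBracket (𝓡 n) V W x = nabla W x (V x) - nabla V x (W x) := by
  have hx : x ∈ chartDom (n := n) x := mem_chart_source _ x
  rw [← ofCoord_toCoord hx (VectorField.mlieBracket (𝓡 n) V W x), toCoord_mlieBracket hx hV hW,
    (isLocalMetric_coordMetric x).lieBracket_eq_cov_sub_cov (chart_mem_chartTarget hx),
    coordField_chart hx, coordField_chart hx, ← toCoord_nabla hx hV, ← toCoord_nabla hx hW,
    ← map_sub, ofCoord_toCoord hx]

lemma dOne_flat {x : M} {u : VField n M} (hu : SmoothAt u x) (a b : TangentSpace (𝓡 n) x) :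
    dOne (flat u) x a b = inner ℝ (nabla u x a) b - inner ℝ (nabla u x b) a := by
  simp only [dOne, flat]
  rw [mvfderiv_inner hu (smoothAt_ext _), mvfderiv_inner hu (smoothAt_ext _),
    mlieBracket_eq_nabla_sub_nabla (smoothAt_ext _) (smoothAt_ext _)]
  simp only [ext_self, inner_sub_right]
  ring

lemma codiffOne_flat {x : M} {u : VField n M} (hu : SmoothAt u x) :
    codiffOne (flat u) x = -divergence u x := by
  refine congrArg Neg.neg (Finset.sum_congr rfl fun i _ ↦ ?_)
  simp only [nablaOne, flat]
  rw [mvfderiv_inner hu (smoothAt_ext _), ext_self, add_sub_cancel_right]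

lemma dFun_codiffOne_flat_chart {c x : M} (hx : x ∈ chartDom (n := n) c) {u : VField n M}
    (hu : ∀ z, SmoothAt u z) (v : TangentSpace (𝓡 n) x) :
    dFun (codiffOne (flat u)) x v
      = -fderiv ℝ (fun z ↦ LinearMap.trace ℝ (𝔼 n)
          (cov (coordMetric c) (coordField c u) z : 𝔼 n →ₗ[ℝ] 𝔼 n))
        (extChartAt (𝓡 n) c x) (toCoord c x v) := by
  let tr : (𝔼 n →L[ℝ] 𝔼 n) →L[ℝ] ℝ := LinearMap.toContinuousLinearMap
    ((LinearMap.trace ℝ (𝔼 n)).comp (ContinuousLinearMap.coeLM ℝ))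
  have hcov := (contDiffAt_cov_coordField hx (hu x)).differentiableAt (by simp)
  have htrace : DifferentiableAt ℝ (fun z ↦ LinearMap.trace ℝ (𝔼 n)
      (cov (coordMetric c) (coordField c u) z : 𝔼 n →ₗ[ℝ] 𝔼 n)) (extChartAt (𝓡 n) c x) :=
    tr.differentiableAt.comp (extChartAt (𝓡 n) c x) hcov
  rw [dFun, mvfderiv_chart hx htrace.neg fun y hy ↦ ?_, fderiv_neg, neg_apply]
  rw [codiffOne_flat (hu _), divergence_chart (chart_symm_mem_chartDom hy) (hu _),
    chart_right_inv hy]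
  rfl

lemma nablaTwo_dOne_flat_chart {c x : M} (hx : x ∈ chartDom (n := n) c) {u : VField n M}
    (hu : ∀ z, SmoothAt u z) (v a b : TangentSpace (𝓡 n) x) :
    nablaTwo (dOne (flat u)) x v a b
      = coordMetric c (extChartAt (𝓡 n) c x)
          (covEnd (coordMetric c) (cov (coordMetric c) (coordField c u)) (extChartAt (𝓡 n) c x)
            (toCoord c x v) (toCoord c x a)) (toCoord c x b)
        - coordMetric c (extChartAt (𝓡 n) c x)
          (covEnd (coordMetric c) (cov (coordMetric c) (coordField c u)) (extChartAt (𝓡 n) c x)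
            (toCoord c x v) (toCoord c x b)) (toCoord c x a) := by
  have hy := chart_mem_chartTarget hx
  have hcov : DifferentiableAt ℝ (cov (coordMetric c) (coordField c u)) (extChartAt (𝓡 n) c x) :=
    (contDiffAt_cov_coordField hx (hu x)).differentiableAt (by simp)
  have ha := differentiableAt_coordField hx (smoothAt_ext a)
  have hb := differentiableAt_coordField hx (smoothAt_ext b)
  have hg := (isLocalMetric_coordMetric c).differentiableAt hy
  have hderiv := (isLocalMetric_coordMetric c).fderiv_antisymm_apply hy hcov ha hb (toCoord c x v)
  simp only [coordField_chart hx, ext_self] at hderiv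
  rw [← hderiv, nablaTwo, mvfderiv_chart hx
    ((differentiableAt_bilin_apply hg (hcov.clm_apply ha) hb).sub
      (differentiableAt_bilin_apply hg (hcov.clm_apply hb) ha)) fun y hy ↦ ?_]
  · rw [dOne_flat (hu x), dOne_flat (hu x)]
    simp only [← coordMetric_chart hx, toCoord_nabla hx (hu x), toCoord_nabla hx (smoothAt_ext _)]
    rfl
  · have hy' := chart_symm_mem_chartDom hy
    rw [dOne_flat (hu _), ← coordMetric_chart hy', ← coordMetric_chart hy',
      toCoord_nabla hy' (hu _), toCoord_nabla hy' (hu _), chart_right_inv hy]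
    rfl

lemma codiffTwo_dOne_flat_chart {c x : M} (hx : x ∈ chartDom (n := n) c) {u : VField n M}
    (hu : ∀ z, SmoothAt u z) (w : TangentSpace (𝓡 n) x) :
    codiffTwo (dOne (flat u)) x w
      = -∑ i, (coordMetric c (extChartAt (𝓡 n) c x)
          (covEnd (coordMetric c) (cov (coordMetric c) (coordField c u)) (extChartAt (𝓡 n) c x)
            (toCoord c x (frame x i)) (toCoord c x (frame x i))) (toCoord c x w)
        - coordMetric c (extChartAt (𝓡 n) c x)
          (covEnd (coordMetric c) (cov (coordMetric c) (coordField c u)) (extChartAt (𝓡 n) c x)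
            (toCoord c x (frame x i)) (toCoord c x w)) (toCoord c x (frame x i))) := by
  simp only [codiffTwo, nablaTwo_dOne_flat_chart hx hu]

lemma isLinearMap_codiffTwo_dOne_flat {u : VField n M} (hu : ∀ z, SmoothAt u z) (x : M) :
    IsLinearMap ℝ (codiffTwo (dOne (flat u)) x) where
  map_add v w := by
    simp only [codiffTwo_dOne_flat_chart (mem_chart_source _ x) hu, map_add, add_apply,
      add_sub_add_comm, Finset.sum_add_distrib, neg_add]
  map_smul a v := by
    simp only [codiffTwo_dOne_flat_chart (mem_chart_source _ x) hu, map_smul, smul_apply,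
      ← smul_sub, ← Finset.smul_sum, smul_neg]

lemma coordMetric_coordField_gradEnergy {c : M} {u : VField n M} (hu : ∀ z, SmoothAt u z)
    {y : 𝔼 n} (hy : y ∈ chartTarget c) (a : 𝔼 n) :
    coordMetric c y (coordField c (gradEnergy u) y) a
      = coordMetric c y (cov (coordMetric c) (coordField c u) y a) (coordField c u y) := by
  have hx := chart_symm_mem_chartDom hy
  have hinner := inner_gradEnergy u _ (ofCoord c ((extChartAt (𝓡 n) c).symm y) a)
  rw [← coordMetric_chart hx, ← coordMetric_chart hx, toCoord_nabla hx (hu _),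
    toCoord_ofCoord hx, chart_right_inv hy] at hinner
  exact hinner

lemma smoothAt_gradEnergy {u : VField n M} (hu : ∀ z, SmoothAt u z) (x : M) :
    SmoothAt (gradEnergy u) x := by
  have hx : x ∈ chartDom (n := n) x := mem_chart_source _ x
  have hg := isLocalMetric_coordMetric (n := n) x
  have hy := chart_mem_chartTarget hx
  have hcoord : coordField x (gradEnergy u) =ᶠ[𝓝 (extChartAt (𝓡 n) x x)] fun y ↦
      (coordMetric x y).inverse
        ((coordMetric x y (coordField x u y)).comp (cov (coordMetric x) (coordField x u) y)) := by
    filter_upwards [eventually_mem_chartTarget hx] with y hy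
    refine ((hg.isInvertible hy).inverse_apply_eq.2 ?_).symm
    ext a
    exact ((coordMetric_coordField_gradEnergy hu hy a).trans (hg.symm y hy _ _)).symm
  rw [smoothAt_iff_contDiffAt hx]
  refine ContDiffAt.congr_of_eventuallyEq ?_ hcoord
  exact ((hg.isInvertible hy).contDiffAt_map_inverse.comp _ (hg.contDiffAt hy)).clm_apply
    (((hg.contDiffAt hy).clm_apply ((smoothAt_iff_contDiffAt hx u).1 (hu x))).clm_comp
      (contDiffAt_cov_coordField hx (hu x)))

/-- The squared pointwise Hilbert-Schmidt norm `|∇u|²`. -/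
def gradSq (u : VField n M) (x : M) : ℝ := ∑ i, ‖nabla u x (frame x i)‖ ^ 2

/-- The Bochner-Weitzenböck formula, applied to the pair `(u, u)`. -/
lemma inner_hodgeLaplacian {u : VField n M} (hu : ∀ z, SmoothAt u z) (x : M) :
    inner ℝ (hodgeLaplacian u x) (u x)
      = gradSq u x - divergence (gradEnergy u) x + ricci x (u x) (u x) := by
  have hx : x ∈ chartDom (n := n) x := mem_chart_source _ x
  have hlin : IsLinearMap ℝ
      fun v ↦ dFun (codiffOne (flat u)) x v + codiffTwo (dOne (flat u)) x v :=
    ((mvfderiv (𝓡 n) (codiffOne (flat u)) x).toLinearMap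
      + (isLinearMap_codiffTwo_dOne_flat hu x).mk' _).isLinear
  have hbochner := (isLocalMetric_coordMetric (n := n) x).bochner_formula
    (chart_mem_chartTarget hx) (e := fun i ↦ toCoord x x (frame x i)) (sum_coordMetric_frame hx)
    ((smoothAt_iff_contDiffAt hx u).1 (hu x))
    (differentiableAt_coordField hx (smoothAt_gradEnergy hu x))
    (fun _ hz ↦ coordMetric_coordField_gradEnergy hu hz)
  rw [coordField_chart hx, ← codiffTwo_dOne_flat_chart hx hu, ← ricci_chart hx,
    ← divergence_chart hx (smoothAt_gradEnergy hu x)] at hbochner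
  simp only [← toCoord_nabla hx (hu x), coordMetric_chart hx, real_inner_self_eq_norm_sq]
    at hbochner
  rw [hodgeLaplacian, inner_sharp hlin, dFun_codiffOne_flat_chart hx hu, hbochner,
    neg_add_cancel_comm_assoc, gradSq]

end Bochner

section Measure

lemma gram_bilinearComp_det {ι E : Type*} [Fintype ι] [DecidableEq ι] [NormedAddCommGroup E]
    [NormedSpace ℝ E] (b : Module.Basis ι ℝ E) (B : E →L[ℝ] E →L[ℝ] ℝ) (L : E →L[ℝ] E) :
    (gram b (B.bilinearComp L L)).det = L.det ^ 2 * (gram b B).det := by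
  have hgram := LinearMap.toMatrix₂_compl₁₂ b b b b B.toLinearMap₁₂ (L : E →ₗ[ℝ] E) L
  calc (gram b (B.bilinearComp L L)).det = _ := congrArg Matrix.det hgram
    _ = _ := by
      rw [Matrix.det_mul, Matrix.det_mul, Matrix.det_transpose, LinearMap.det_toMatrix, gram]
      exact (mul_right_comm _ _ _).trans (congrArg (· * _) (sq _).symm)

lemma restrict_iSup_eq_of_compatible {X ι : Type*} [MeasurableSpace X] {μ : ι → Measure X}
    {U : ι → Set X}
    (hU : ∀ i, MeasurableSet (U i)) (hμ : ∀ i, (μ i).restrict (U i) = μ i)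
    (hcompat : ∀ i j, (μ i).restrict (U j) = (μ j).restrict (U i))
    {f : ℕ → ι} (hf : ⋃ k, U (f k) = univ) (i : ι) : (⨆ j, μ j).restrict (U i) = μ i := by
  let A : ℕ → Set X := disjointed fun k ↦ U (f k)
  have hA : ∀ k, MeasurableSet (A k) := MeasurableSet.disjointed fun k ↦ hU (f k)
  have hAU : ∀ k, A k ⊆ U (f k) := disjointed_subset _
  let ν : Measure X := Measure.sum fun k ↦ (μ (f k)).restrict (A k)
  have hpiece (j : ι) (k : ℕ) : ((μ (f k)).restrict (A k)).restrict (U j)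
      = (μ j).restrict (A k) := by
    rw [Measure.restrict_comm (hU j), hcompat, Measure.restrict_restrict_of_subset (hAU k)]
  have hν (j : ι) : ν.restrict (U j) = μ j := by
    rw [Measure.restrict_sum _ (hU j)]
    simp only [hpiece]
    rw [← Measure.restrict_iUnion (disjoint_disjointed _) hA, iUnion_disjointed, hf,
      Measure.restrict_univ]
  have hle : ⨆ j, μ j ≤ ν := iSup_le fun j ↦ (hν j).symm.trans_le Measure.restrict_le_self
  exact le_antisymm ((Measure.restrict_mono_measure hle _).trans_eq (hν i))
    ((hμ i).symm.trans_le (Measure.restrict_mono_measure (le_iSup μ i) _))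

variable {n : ℕ} {M : Type*} [TopologicalSpace M] [ChartedSpace (𝔼 n) M]

lemma measurableSet_chartTarget (c : M) : MeasurableSet (chartTarget (n := n) c) :=
  (isOpen_chartTarget c).measurableSet

/-- The change of coordinates from the chart centred at `c` to the chart centred at `c'`. -/
def transition (c c' : M) : 𝔼 n → 𝔼 n := extChartAt (𝓡 n) c' ∘ (extChartAt (𝓡 n) c).symm

lemma transition_image_chart_image {c c' : M} {s : Set M} (hs : s ⊆ chartDom (n := n) c) :
    transition c c' '' (extChartAt (𝓡 n) c '' s) = extChartAt (𝓡 n) c' '' s := by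
  rw [transition, image_comp,
    (extChartAt (𝓡 n) c).symm_image_image_of_subset_source (by rwa [extChartAt_source])]

lemma injOn_transition {c c' : M} {s : Set M} (hs : s ⊆ chartDom (n := n) c)
    (hs' : s ⊆ chartDom (n := n) c') :
    InjOn (transition c c') (extChartAt (𝓡 n) c '' s) := by
  rintro _ ⟨x, hx, rfl⟩ _ ⟨y, hy, rfl⟩ hxy
  rw [transition, Function.comp, Function.comp, chart_left_inv (hs hx),
    chart_left_inv (hs hy)] at hxy
  rw [← chart_left_inv (hs' hx), hxy, chart_left_inv (hs' hy)]

section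

variable [MeasurableSpace M] [BorelSpace M]

lemma measurableSet_chartDom (c : M) : MeasurableSet (chartDom (n := n) c) :=
  (isOpen_chartDom c).measurableSet

lemma measurableSet_chart_image {c : M} {s : Set M} (hs : MeasurableSet s)
    (hsc : s ⊆ chartDom (n := n) c) : MeasurableSet (extChartAt (𝓡 n) c '' s) := by
  have hsymm : Measurable ((chartTarget (n := n) c).domRestrict (extChartAt (𝓡 n) c).symm) :=
    (continuousOn_extChartAt_symm (I := 𝓡 n) c).domRestrict.measurable
  rw [(extChartAt (𝓡 n) c).image_eq_target_inter_inv_preimage (by rwa [extChartAt_source]),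
    ← Subtype.image_preimage_coe]
  exact (measurableSet_chartTarget c).subtype_image (hsymm hs)

end

variable [IsManifold (𝓡 n) ∞ M]

/-- The derivative at `y` of the change of coordinates `transition c c'`. -/
def transitionDeriv (c c' : M) (y : 𝔼 n) : 𝔼 n →L[ℝ] 𝔼 n :=
  (toCoord c' ((extChartAt (𝓡 n) c).symm y)).comp (ofCoord c ((extChartAt (𝓡 n) c).symm y))

lemma hasFDerivAt_transition {c c' : M} {y : 𝔼 n} (hy : y ∈ chartTarget c)
    (hy' : (extChartAt (𝓡 n) c).symm y ∈ chartDom (n := n) c') :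
    HasFDerivAt (transition c c') (transitionDeriv c c' y) y := by
  have hcomp := (mdifferentiableAt_extChartAt hy').hasMFDerivAt.comp y
    ((contMDiffAt_chart_symm hy).mdifferentiableAt (by simp)).hasMFDerivAt
  rw [mfderiv_chart_symm hy, ← TangentBundle.continuousLinearMapAt_trivializationAt hy'] at hcomp
  exact hcomp.hasFDerivAt

variable [RiemannianBundle (fun x : M ↦ TangentSpace (𝓡 n) x)]

/-- The density `√(det g)` of the Riemannian measure in the chart centred at `c`. -/
def coordDensity (c : M) : 𝔼 n → ℝ :=
  density (EuclideanSpace.basisFun (Fin n) ℝ).toBasis (coordMetric c)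

lemma sqrt_det_chartMetric {c : M} {y : 𝔼 n} (hy : y ∈ chartTarget c) :
    √(chartMetric c y).det = coordDensity c y := by
  rw [coordDensity, density]
  congr 2
  ext i j
  rw [gram_apply, chartMetric, Matrix.of_apply, mfderiv_chart_symm hy, coordMetric_apply]
  simp only [OrthonormalBasis.coe_toBasis, EuclideanSpace.basisFun_apply]
  rfl

lemma coordDensity_eq_abs_det_mul {c c' : M} {y : 𝔼 n}
    (hy' : (extChartAt (𝓡 n) c).symm y ∈ chartDom (n := n) c') :
    coordDensity c y = |(transitionDeriv c c' y).det| * coordDensity c' (transition c c' y) := by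
  have hmetric : coordMetric c y = (coordMetric c' (transition c c' y)).bilinearComp
      (transitionDeriv c c' y) (transitionDeriv c c' y) := by
    ext v w
    exact (coordMetric_chart hy' (ofCoord c _ v) (ofCoord c _ w)).symm
  rw [coordDensity, density, hmetric, gram_bilinearComp_det, Real.sqrt_mul (sq_nonneg _),
    Real.sqrt_sq_eq_abs]
  rfl

section

variable [IsContMDiffRiemannianBundle (𝓡 n) ∞ (𝔼 n) (fun x : M ↦ TangentSpace (𝓡 n) x)]

lemma coordDensity_pos {c : M} {y : 𝔼 n} (hy : y ∈ chartTarget c) : 0 < coordDensity c y :=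
  density_pos (isLocalMetric_coordMetric c) hy

lemma contDiffAt_coordDensity {c : M} {y : 𝔼 n} (hy : y ∈ chartTarget c) :
    ContDiffAt ℝ ∞ (coordDensity c) y :=
  contDiffAt_density (isLocalMetric_coordMetric c) hy

lemma continuousOn_coordDensity (c : M) : ContinuousOn (coordDensity c) (chartTarget (n := n) c) :=
  fun _ hy ↦ (contDiffAt_coordDensity hy).continuousAt.continuousWithinAt

end

/-- The Riemannian measure, read in the chart centred at `c`. -/
def coordVolume (c : M) : Measure (𝔼 n) :=
  (volume.restrict (chartTarget c)).withDensity fun y ↦ ENNReal.ofReal (coordDensity c y)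

variable [MeasurableSpace M]

lemma chartVolume_eq_map (c : M) :
    chartVolume (n := n) c = Measure.map (extChartAt (𝓡 n) c).symm (coordVolume c) := by
  rw [chartVolume, coordVolume]
  congr 1
  refine withDensity_congr_ae ?_
  filter_upwards [ae_restrict_mem (measurableSet_chartTarget c)] with y hy
  rw [sqrt_det_chartMetric hy]

variable [BorelSpace M]

lemma aemeasurable_chart_symm (c : M) :
    AEMeasurable (extChartAt (𝓡 n) c).symm (coordVolume (n := n) c) :=
  ((continuousOn_extChartAt_symm c).aemeasurable (measurableSet_chartTarget c)).mono_ac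
    (withDensity_absolutelyContinuous _ _)

lemma chartVolume_apply {c : M} {s : Set M} (hs : MeasurableSet s)
    (hsc : s ⊆ chartDom (n := n) c) :
    chartVolume (n := n) c s
      = ∫⁻ y in extChartAt (𝓡 n) c '' s, ENNReal.ofReal (coordDensity c y) := by
  rw [chartVolume_eq_map, Measure.map_apply_of_aemeasurable (aemeasurable_chart_symm c) hs,
    coordVolume, withDensity_apply', Measure.restrict_restrict' (measurableSet_chartTarget c),
    (extChartAt (𝓡 n) c).image_eq_target_inter_inv_preimage (by rwa [extChartAt_source]),
    inter_comm]

lemma chartVolume_restrict_chartDom (c : M) :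
    (chartVolume (n := n) c).restrict (chartDom (n := n) c) = chartVolume (n := n) c := by
  refine Measure.restrict_eq_self_of_ae_mem ?_
  rw [chartVolume_eq_map]
  refine (ae_map_iff (aemeasurable_chart_symm c) (measurableSet_chartDom c)).2 ?_
  refine (withDensity_absolutelyContinuous _ _).ae_le ?_
  filter_upwards [ae_restrict_mem (measurableSet_chartTarget c)] with y hy
    using chart_symm_mem_chartDom hy

lemma chartVolume_congr {c c' : M} {s : Set M} (hs : MeasurableSet s)
    (hsc : s ⊆ chartDom (n := n) c) (hsc' : s ⊆ chartDom (n := n) c') :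
    chartVolume (n := n) c s = chartVolume (n := n) c' s := by
  have hmeas := measurableSet_chart_image hs hsc
  have hmaps : ∀ y ∈ extChartAt (𝓡 n) c '' s,
      y ∈ chartTarget c ∧ (extChartAt (𝓡 n) c).symm y ∈ chartDom (n := n) c' := by
    rintro _ ⟨x, hx, rfl⟩
    exact ⟨chart_mem_chartTarget (hsc hx), by rw [chart_left_inv (hsc hx)]; exact hsc' hx⟩
  rw [chartVolume_apply hs hsc, chartVolume_apply hs hsc',
    ← transition_image_chart_image (c' := c') hsc,
    lintegral_image_eq_lintegral_abs_det_fderiv_mul volume hmeas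
      (fun y hy ↦ (hasFDerivAt_transition (hmaps y hy).1 (hmaps y hy).2).hasFDerivWithinAt)
      (injOn_transition hsc hsc')]
  refine setLIntegral_congr_fun hmeas fun y hy ↦ ?_
  rw [← ENNReal.ofReal_mul (abs_nonneg _), ← coordDensity_eq_abs_det_mul (hmaps y hy).2]

variable [SecondCountableTopology M]

lemma vol_restrict_chartDom (c : M) :
    (vol n M).restrict (chartDom (n := n) c) = chartVolume (n := n) c := by
  obtain ⟨t, ht, hcover⟩ := TopologicalSpace.countable_cover_nhds
    (f := fun x : M ↦ chartDom (n := n) x)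
    fun x ↦ (isOpen_chartDom x).mem_nhds (mem_chart_source _ x)
  obtain ⟨a, ha, -⟩ := mem_iUnion₂.1 (hcover.symm.subset (mem_univ c))
  obtain ⟨f, rfl⟩ := ht.exists_eq_range ⟨a, ha⟩
  refine restrict_iSup_eq_of_compatible measurableSet_chartDom chartVolume_restrict_chartDom
    (fun c c' ↦ ?_) (biUnion_range.symm.trans hcover) c
  ext s hs
  rw [← chartVolume_restrict_chartDom c, ← chartVolume_restrict_chartDom (n := n) c',
    Measure.restrict_restrict (measurableSet_chartDom _),
    Measure.restrict_restrict (measurableSet_chartDom _), Measure.restrict_apply hs,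
    Measure.restrict_apply hs, inter_comm (chartDom c)]
  exact chartVolume_congr
    (hs.inter ((measurableSet_chartDom c').inter (measurableSet_chartDom c)))
    (fun _ hx ↦ hx.2.2) fun _ hx ↦ hx.2.1

lemma vol_apply {c : M} {s : Set M} (hs : MeasurableSet s) (hsc : s ⊆ chartDom (n := n) c) :
    vol n M s = ∫⁻ y in extChartAt (𝓡 n) c '' s, ENNReal.ofReal (coordDensity c y) := by
  rw [← chartVolume_apply hs hsc, ← vol_restrict_chartDom, Measure.restrict_apply hs,
    inter_eq_left.2 hsc]

variable [IsContMDiffRiemannianBundle (𝓡 n) ∞ (𝔼 n) (fun x : M ↦ TangentSpace (𝓡 n) x)]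

instance isLocallyFiniteMeasure_vol : IsLocallyFiniteMeasure (vol n M) := by
  refine ⟨fun x ↦ ?_⟩
  have hx : x ∈ chartDom (n := n) x := mem_chart_source _ x
  obtain ⟨r, hr, hball⟩ := Metric.nhds_basis_closedBall.mem_iff.1 (eventually_mem_chartTarget hx)
  have hopen : IsOpen
      (chartDom (n := n) x ∩ extChartAt (𝓡 n) x ⁻¹' Metric.ball (extChartAt (𝓡 n) x x) r) := by
    rw [chartDom, ← extChartAt_source (𝓡 n)]
    exact (continuousOn_extChartAt x).isOpen_inter_preimage (isOpen_extChartAt_source x)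
      Metric.isOpen_ball
  refine ⟨_, hopen.mem_nhds ⟨hx, Metric.mem_ball_self hr⟩, ?_⟩
  have hint : IntegrableOn (coordDensity (n := n) x)
      (Metric.closedBall (extChartAt (𝓡 n) x x) r) :=
    ((continuousOn_coordDensity x).mono hball).integrableOn_compact (isCompact_closedBall _ r)
  rw [vol_apply hopen.measurableSet inter_subset_left]
  refine (lintegral_mono_set ?_).trans_lt hint.lintegral_lt_top
  rintro _ ⟨z, ⟨-, hz⟩, rfl⟩
  exact Metric.ball_subset_closedBall hz

lemma integral_vol_chart (c : M) {F : M → ℝ} (hF : AEStronglyMeasurable F (vol n M))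
    (hF0 : ∀ x ∉ chartDom (n := n) c, F x = 0) :
    ∫ x, F x ∂(vol n M) = ∫ y in chartTarget (n := n) c,
      coordDensity c y * F ((extChartAt (𝓡 n) c).symm y) := by
  have hF' : AEStronglyMeasurable F
      (Measure.map (extChartAt (𝓡 n) c).symm (coordVolume (n := n) c)) := by
    rw [← chartVolume_eq_map, ← vol_restrict_chartDom]
    exact hF.restrict
  rw [← setIntegral_eq_integral_of_forall_compl_eq_zero hF0, vol_restrict_chartDom,
    chartVolume_eq_map, integral_map (aemeasurable_chart_symm c) hF', coordVolume,
    integral_withDensity_eq_integral_toReal_smul₀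
      ((continuousOn_coordDensity c).aemeasurable (measurableSet_chartTarget c)).ennreal_ofReal
      (Filter.Eventually.of_forall fun _ ↦ ENNReal.ofReal_lt_top)]
  refine setIntegral_congr_fun (measurableSet_chartTarget c) fun y hy ↦ ?_
  rw [ENNReal.toReal_ofReal (coordDensity_pos hy).le, smul_eq_mul]

end Measure

section HopfRinow

/-- The approximate intermediate point property, which characterizes length spaces among
metric spaces. -/
def HasApproxIntermediatePoints (X : Type*) [PseudoMetricSpace X] : Prop :=
  ∀ (x y : X) (r s : ℝ), 0 < r → 0 < s → dist x y < r + s → ∃ z, dist x z ≤ r ∧ dist z y < s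

section

variable {X : Type*} [PseudoMetricSpace X]

lemma isCompact_closedBall_of_le {x : X} {r s : ℝ} (hs : IsCompact (Metric.closedBall x s))
    (hrs : r ≤ s) : IsCompact (Metric.closedBall x r) :=
  hs.of_isClosed_subset Metric.isClosed_closedBall (Metric.closedBall_subset_closedBall hrs)

lemma HasApproxIntermediatePoints.totallyBounded_closedBall (hX : HasApproxIntermediatePoints X)
    {x : X} {r : ℝ} (hr : 0 < r) (hlt : ∀ s < r, IsCompact (Metric.closedBall x s)) :
    TotallyBounded (Metric.closedBall x r) := by
  rw [Metric.totallyBounded_iff]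
  intro ε hε
  set δ := min (ε / 2) r
  have hδ : 0 < δ := lt_min (by positivity) hr
  have hδε : δ ≤ ε / 2 := min_le_left _ _
  have hδr : δ ≤ r := min_le_right _ _
  obtain ⟨t, ht, htcover⟩ := Metric.totallyBounded_iff.1
    (hlt (r - δ / 2) (by linarith)).totallyBounded (ε / 2) (by positivity)
  refine ⟨t, ht, fun y hy ↦ ?_⟩
  obtain ⟨z, hxz, hzy⟩ := hX x y (r - δ / 2) δ (by linarith) hδ
    (by rw [Metric.mem_closedBall'] at hy; linarith)
  obtain ⟨w, hw, hzw⟩ := mem_iUnion₂.1 (htcover (Metric.mem_closedBall'.2 hxz))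
  refine mem_iUnion₂.2 ⟨w, hw, ?_⟩
  rw [Metric.mem_ball] at hzw ⊢
  linarith [dist_triangle y z w, dist_comm z y]

lemma HasApproxIntermediatePoints.exists_isCompact_closedBall_gt [LocallyCompactSpace X]
    (hX : HasApproxIntermediatePoints X) {x : X} {r : ℝ} (hr : 0 < r)
    (hcompact : IsCompact (Metric.closedBall x r)) :
    ∃ s > r, IsCompact (Metric.closedBall x s) := by
  obtain ⟨K, hK, hrK⟩ := exists_compact_superset hcompact
  obtain ⟨δ, hδ, hδK⟩ := hcompact.exists_cthickening_subset_open isOpen_interior hrK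
  refine ⟨r + δ / 2, by linarith, hK.of_isClosed_subset Metric.isClosed_closedBall fun y hy ↦ ?_⟩
  obtain ⟨z, hxz, hzy⟩ := hX x y r δ hr hδ (by rw [Metric.mem_closedBall'] at hy; linarith)
  exact interior_subset (hδK (Metric.mem_cthickening_of_dist_le y z δ _
    (Metric.mem_closedBall'.2 hxz) (by rw [dist_comm]; exact hzy.le)))

/-- The Hopf-Rinow-Cohn-Vossen theorem. The radii of compact balls about `x` form an initial
segment of `ℝ`, which cannot have a finite supremum. -/
theorem HasApproxIntermediatePoints.isCompact_closedBall [CompleteSpace X]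
    [LocallyCompactSpace X] (hX : HasApproxIntermediatePoints X) (x : X) (r : ℝ) :
    IsCompact (Metric.closedBall x r) := by
  by_contra hr
  let S : Set ℝ := {ρ | IsCompact (Metric.closedBall x ρ)}
  have hbdd : BddAbove S :=
    ⟨r, fun ρ hρ ↦ le_of_not_ge fun hle ↦ hr (isCompact_closedBall_of_le hρ hle)⟩
  obtain ⟨K, hK, hxK⟩ := exists_compact_mem_nhds x
  obtain ⟨ρ₀, hρ₀, hρ₀K⟩ := Metric.nhds_basis_closedBall.mem_iff.1 hxK
  have hρ₀S : ρ₀ ∈ S := hK.of_isClosed_subset Metric.isClosed_closedBall hρ₀K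
  have hpos : 0 < sSup S := hρ₀.trans_le (le_csSup hbdd hρ₀S)
  have hlt : ∀ ρ < sSup S, IsCompact (Metric.closedBall x ρ) := fun ρ hρ ↦ by
    obtain ⟨σ, hσ, hρσ⟩ := exists_lt_of_lt_csSup ⟨ρ₀, hρ₀S⟩ hρ
    exact isCompact_closedBall_of_le hσ hρσ.le
  have hsup : IsCompact (Metric.closedBall x (sSup S)) :=
    (hX.totallyBounded_closedBall hpos hlt).isCompact_of_isClosed Metric.isClosed_closedBall
  obtain ⟨ρ, hρ, hρS⟩ := hX.exists_isCompact_closedBall_gt hpos hsup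
  exact hρ.not_ge (le_csSup hbdd hρS)

end

lemma hasApproxIntermediatePoints_of_isRiemannianManifold (n : ℕ) (M : Type*) [MetricSpace M]
    [ChartedSpace (𝔼 n) M] [RiemannianBundle (fun x : M ↦ TangentSpace (𝓡 n) x)]
    [IsRiemannianManifold (𝓡 n) M] : HasApproxIntermediatePoints M := by
  intro x y r s hr hs hxy
  rcases le_or_gt (dist x y) r with hle | hgt
  · exact ⟨y, hle, by rwa [dist_self]⟩
  have hedist : riemannianEDist (𝓡 n) x y < ENNReal.ofReal (r + s) := by
    rw [← IsRiemannianManifold.out (I := 𝓡 n) x y, edist_dist]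
    exact (ENNReal.ofReal_lt_ofReal_iff (by positivity)).2 hxy
  obtain ⟨γ, h0, h1, hγ, hlength⟩ := exists_lt_of_riemannianEDist_lt hedist
  have hcont : ContinuousOn (fun t ↦ dist x (γ t)) (Icc 0 1) :=
    Continuous.comp_continuousOn (g := fun z ↦ dist x z) (by fun_prop) hγ.continuousOn
  obtain ⟨t, ht, htr : dist x (γ t) = r⟩ := intermediate_value_Icc zero_le_one hcont
    (show r ∈ Icc (dist x (γ 0)) (dist x (γ 1)) by rw [h0, h1, dist_self]; exact ⟨hr.le, hgt.le⟩)
  have hfst := riemannianEDist_le_pathELength (hγ.mono (Icc_subset_Icc_right ht.2)) h0 rfl ht.1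
  have hsnd := riemannianEDist_le_pathELength (hγ.mono (Icc_subset_Icc_left ht.1)) rfl h1 ht.2
  rw [← IsRiemannianManifold.out (I := 𝓡 n), edist_dist] at hfst hsnd
  have hsum := (add_le_add hfst hsnd).trans_lt (by rwa [pathELength_add ht.1 ht.2])
  rw [← ENNReal.ofReal_add dist_nonneg dist_nonneg, ENNReal.ofReal_lt_ofReal_iff (by positivity),
    htr] at hsum
  exact ⟨γ t, htr.le, by linarith⟩

theorem isCompact_closedBall_of_completeSpace (n : ℕ) {M : Type*} [MetricSpace M] [CompleteSpace M]
    [ChartedSpace (𝔼 n) M] [RiemannianBundle (fun x : M ↦ TangentSpace (𝓡 n) x)]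
    [IsRiemannianManifold (𝓡 n) M] (x : M) (r : ℝ) : IsCompact (Metric.closedBall x r) := by
  have : LocallyCompactSpace M := Manifold.locallyCompact_of_finiteDimensional (𝓡 n)
  exact (hasApproxIntermediatePoints_of_isRiemannianManifold n M).isCompact_closedBall x r

end HopfRinow

section SmoothFields

variable {n : ℕ} {M : Type*} [TopologicalSpace M]
  [ChartedSpace (𝔼 n) M] [IsManifold (𝓡 n) ∞ M]

lemma coordField_zero (c : M) : coordField c (0 : VField n M) = 0 :=
  funext fun _ ↦ map_zero (toCoord c _)

lemma coordField_add (c : M) (V W : VField n M) :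
    coordField c (V + W) = coordField c V + coordField c W :=
  funext fun _ ↦ map_add (toCoord c _) _ _

lemma coordField_smul (c : M) (f : M → ℝ) (V : VField n M) :
    coordField c (fun x ↦ f x • V x)
      = fun y ↦ f ((extChartAt (𝓡 n) c).symm y) • coordField c V y :=
  funext fun _ ↦ map_smul (toCoord c _) _ _

lemma coordField_eventuallyEq {c x : M} (hx : x ∈ chartDom (n := n) c) {V W : VField n M}
    (h : ∀ᶠ z in 𝓝 x, V z = W z) :
    coordField c V =ᶠ[𝓝 (extChartAt (𝓡 n) c x)] coordField c W := by
  filter_upwards [(tendsto_chart_symm hx).eventually h] with y hy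
  rw [coordField, coordField, hy]

lemma contDiffAt_comp_chart_symm {f : M → ℝ} {c x : M} (hx : x ∈ chartDom (n := n) c)
    (hf : ContMDiffAt (𝓡 n) 𝓘(ℝ, ℝ) ∞ f x) :
    ContDiffAt ℝ ∞ (fun y ↦ f ((extChartAt (𝓡 n) c).symm y)) (extChartAt (𝓡 n) c x) := by
  rw [← contMDiffAt_iff_contDiffAt]
  refine ContMDiffAt.comp _ (g := f) ?_ (contMDiffAt_chart_symm (chart_mem_chartTarget hx))
  rwa [chart_left_inv hx]

lemma SmoothAt.congr {V W : VField n M} {x : M} (hV : SmoothAt V x)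
    (h : ∀ᶠ z in 𝓝 x, W z = V z) : SmoothAt W x := by
  have hx : x ∈ chartDom (n := n) x := mem_chart_source _ x
  rw [smoothAt_iff_contDiffAt hx] at hV ⊢
  exact hV.congr_of_eventuallyEq (coordField_eventuallyEq hx h)

lemma smoothAt_zero (x : M) : SmoothAt (0 : VField n M) x := by
  rw [smoothAt_iff_contDiffAt (mem_chart_source _ x), coordField_zero]
  exact contDiffAt_const

lemma SmoothAt.add {V W : VField n M} {x : M} (hV : SmoothAt V x) (hW : SmoothAt W x) :
    SmoothAt (V + W) x := by
  have hx : x ∈ chartDom (n := n) x := mem_chart_source _ x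
  rw [smoothAt_iff_contDiffAt hx] at *
  rw [coordField_add]
  exact hV.add hW

lemma smoothAt_sum {ι : Type*} (J : Finset ι) {V : ι → VField n M} {x : M}
    (hV : ∀ i, SmoothAt (V i) x) : SmoothAt (∑ i ∈ J, V i) x := by
  classical
  induction J using Finset.induction_on with
  | empty => exact smoothAt_zero x
  | insert i J hi ih => rw [Finset.sum_insert hi]; exact (hV i).add ih

lemma SmoothAt.smul {f : M → ℝ} {V : VField n M} {x : M} (hV : SmoothAt V x)
    (hf : ContMDiffAt (𝓡 n) 𝓘(ℝ, ℝ) ∞ f x) : SmoothAt (fun z ↦ f z • V z) x := by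
  have hx : x ∈ chartDom (n := n) x := mem_chart_source _ x
  rw [smoothAt_iff_contDiffAt hx] at *
  rw [coordField_smul]
  exact (contDiffAt_comp_chart_symm hx hf).smul hV

lemma SmoothAt.contDiffAt_coordField {c : M} {y : 𝔼 n} (hy : y ∈ chartTarget c) {V : VField n M}
    (hV : SmoothAt V ((extChartAt (𝓡 n) c).symm y)) : ContDiffAt ℝ ∞ (coordField c V) y := by
  simpa only [chart_right_inv hy] using
    (smoothAt_iff_contDiffAt (chart_symm_mem_chartDom hy) V).1 hV

lemma continuousAt_of_eq_comp_chart {X : Type*} [TopologicalSpace X] {c x : M}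
    (hx : x ∈ chartDom (n := n) c) {f : M → X} {F : 𝔼 n → X}
    (hF : ContinuousAt F (extChartAt (𝓡 n) c x))
    (h : ∀ z ∈ chartDom (n := n) c, f z = F (extChartAt (𝓡 n) c z)) : ContinuousAt f x := by
  refine (ContinuousAt.comp (f := extChartAt (𝓡 n) c) hF
    (contMDiffAt_chart hx).continuousAt).congr ?_
  filter_upwards [eventually_mem_chartDom hx] with z hz using (h z hz).symm

variable [RiemannianBundle (fun x : M ↦ TangentSpace (𝓡 n) x)]
  [IsContMDiffRiemannianBundle (𝓡 n) ∞ (𝔼 n) (fun x : M ↦ TangentSpace (𝓡 n) x)]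

lemma divergence_congr {V W : VField n M} {x : M} (hV : SmoothAt V x)
    (h : ∀ᶠ z in 𝓝 x, W z = V z) : divergence W x = divergence V x := by
  have hx : x ∈ chartDom (n := n) x := mem_chart_source _ x
  rw [divergence_chart hx hV, divergence_chart hx (hV.congr h),
    cov_congr (coordField_eventuallyEq hx h)]

lemma divergence_of_eventually_zero {V : VField n M} {x : M} (h : ∀ᶠ z in 𝓝 x, V z = 0) :
    divergence V x = 0 := by
  have hx : x ∈ chartDom (n := n) x := mem_chart_source _ x
  have hcov : cov (coordMetric x) (0 : 𝔼 n → 𝔼 n) (extChartAt (𝓡 n) x x) = 0 := by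
    ext v : 1
    simp [cov_apply]
  rw [divergence_congr (smoothAt_zero x) h, divergence_chart hx (smoothAt_zero x),
    coordField_zero, hcov, ContinuousLinearMap.toLinearMap_zero, map_zero]

lemma divergence_add {V W : VField n M} {x : M} (hV : SmoothAt V x) (hW : SmoothAt W x) :
    divergence (V + W) x = divergence V x + divergence W x := by
  have hx : x ∈ chartDom (n := n) x := mem_chart_source _ x
  have hcov : cov (coordMetric x) (coordField x V + coordField x W) (extChartAt (𝓡 n) x x)
      = cov (coordMetric x) (coordField x V) (extChartAt (𝓡 n) x x)
        + cov (coordMetric x) (coordField x W) (extChartAt (𝓡 n) x x) := by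
    ext v : 1
    rw [add_apply, cov_apply, cov_apply, cov_apply, fderiv_add (differentiableAt_coordField hx hV)
      (differentiableAt_coordField hx hW), add_apply, Pi.add_apply, map_add]
    abel
  rw [divergence_chart hx (hV.add hW), divergence_chart hx hV, divergence_chart hx hW,
    coordField_add, hcov, ContinuousLinearMap.toLinearMap_add, map_add]

lemma divergence_sum {ι : Type*} (J : Finset ι) {V : ι → VField n M} {x : M}
    (hV : ∀ i, SmoothAt (V i) x) : divergence (∑ i ∈ J, V i) x = ∑ i ∈ J, divergence (V i) x := by
  classical
  induction J using Finset.induction_on with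
  | empty => exact divergence_of_eventually_zero (.of_forall fun _ ↦ rfl)
  | insert i J hi ih =>
    rw [Finset.sum_insert hi, Finset.sum_insert hi, divergence_add (hV i) (smoothAt_sum J hV), ih]

lemma divergence_smul {f : M → ℝ} {V : VField n M} {x : M}
    (hf : ContMDiffAt (𝓡 n) 𝓘(ℝ, ℝ) ∞ f x) (hV : SmoothAt V x) :
    divergence (fun z ↦ f z • V z) x = f x * divergence V x + mvfderiv (𝓡 n) f x (V x) := by
  have hx : x ∈ chartDom (n := n) x := mem_chart_source _ x
  set F := fun y ↦ f ((extChartAt (𝓡 n) x).symm y)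
  set y := extChartAt (𝓡 n) x x
  have hF : DifferentiableAt ℝ F y := (contDiffAt_comp_chart_symm hx hf).differentiableAt (by simp)
  have hFy : F y = f x := congrArg f (chart_left_inv hx)
  have hcov : cov (coordMetric x) (fun y ↦ F y • coordField x V y) y
      = F y • cov (coordMetric x) (coordField x V) y
        + (fderiv ℝ F y).smulRight (coordField x V y) := by
    ext v : 1
    rw [add_apply, smul_apply, ContinuousLinearMap.smulRight_apply, cov_apply, cov_apply,
      fderiv_fun_smul hF (differentiableAt_coordField hx hV), add_apply, smul_apply,
      ContinuousLinearMap.smulRight_apply, map_smul, smul_add]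
    abel
  have htrace : LinearMap.trace ℝ (𝔼 n)
      ((fderiv ℝ F y).smulRight (coordField x V y) : 𝔼 n →L[ℝ] 𝔼 n)
        = fderiv ℝ F y (coordField x V y) :=
    LinearMap.trace_smulRight (fderiv ℝ F y : 𝔼 n →ₗ[ℝ] ℝ) _
  rw [divergence_chart hx (hV.smul hf), divergence_chart hx hV, coordField_smul,
    mvfderiv_chart hx hF (fun _ _ ↦ rfl), hcov, ContinuousLinearMap.toLinearMap_add,
    ContinuousLinearMap.toLinearMap_smul, map_add, map_smul, htrace, smul_eq_mul, hFy,
    ← coordField_chart hx V]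

lemma continuous_divergence {V : VField n M} (hV : ∀ x, SmoothAt V x) :
    Continuous (divergence V) := by
  refine continuous_iff_continuousAt.2 fun x ↦ ?_
  have hx : x ∈ chartDom (n := n) x := mem_chart_source _ x
  let T : (𝔼 n →L[ℝ] 𝔼 n) →ₗ[ℝ] ℝ := LinearMap.trace ℝ (𝔼 n) ∘ₗ ContinuousLinearMap.coeLM ℝ
  exact continuousAt_of_eq_comp_chart hx (T.continuous_of_finiteDimensional.continuousAt.comp
    (contDiffAt_cov_coordField hx (hV x)).continuousAt) fun z hz ↦ divergence_chart hz (hV z)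

lemma continuous_inner {V W : VField n M} (hV : ∀ x, SmoothAt V x) (hW : ∀ x, SmoothAt W x) :
    Continuous fun x ↦ inner ℝ (V x) (W x) := by
  refine continuous_iff_continuousAt.2 fun x ↦ ?_
  have hx : x ∈ chartDom (n := n) x := mem_chart_source _ x
  have hcoord : ContinuousAt (fun y ↦ coordMetric x y (coordField x V y) (coordField x W y))
      (extChartAt (𝓡 n) x x) :=
    ((((isLocalMetric_coordMetric x).contDiffAt (chart_mem_chartTarget hx)).continuousAt.clm_apply
      (differentiableAt_coordField hx (hV x)).continuousAt).clm_apply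
      (differentiableAt_coordField hx (hW x)).continuousAt)
  refine continuousAt_of_eq_comp_chart hx hcoord fun z hz ↦ ?_
  rw [coordField_chart hz, coordField_chart hz, coordMetric_chart hz]

lemma continuous_norm {V : VField n M} (hV : ∀ x, SmoothAt V x) : Continuous fun x ↦ ‖V x‖ := by
  simpa only [norm_eq_sqrt_real_inner] using (continuous_inner hV hV).sqrt

end SmoothFields

section Slope

/-- The slope `limsup |θ z - θ x| / dist z x` of `θ` at `x` is at most `ℓ`.
Unlike the norm of a derivative, it makes sense for the Lipschitz cutoffs built from the
distance. -/
def SlopeLE {X : Type*} [PseudoMetricSpace X] (θ : X → ℝ) (ℓ : ℝ) (x : X) : Prop :=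
  ∀ K > ℓ, ∀ᶠ z in 𝓝 x, |θ z - θ x| ≤ K * dist z x

lemma slopeLE_sq {X : Type*} [PseudoMetricSpace X] {χ : X → ℝ} {L : NNReal}
    (hχ : LipschitzWith L χ) (x : X) : SlopeLE (fun z ↦ χ z ^ 2) (2 * L * |χ x|) x := by
  intro K hK
  have hlim : Filter.Tendsto (fun z ↦ |χ z + χ x| * L) (𝓝 x) (𝓝 (|χ x + χ x| * L)) :=
    ((hχ.continuous.add continuous_const).abs.mul continuous_const).tendsto x
  have hlt : |χ x + χ x| * L < K := by
    rw [← two_mul, abs_mul, abs_two]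
    linarith
  filter_upwards [hlim.eventually (gt_mem_nhds hlt)] with z hz
  calc |χ z ^ 2 - χ x ^ 2| = |χ z + χ x| * dist (χ z) (χ x) := by
        rw [sq_sub_sq, abs_mul, Real.dist_eq]
    _ ≤ |χ z + χ x| * (L * dist z x) := by gcongr; exact hχ.dist_le_mul z x
    _ ≤ K * dist z x := by rw [← mul_assoc]; gcongr

variable {n : ℕ} {M : Type*} [MetricSpace M] [ChartedSpace (𝔼 n) M] [IsManifold (𝓡 n) ∞ M]

lemma contMDiffAt_chart_symm_segment {c : M} {y w : 𝔼 n} {τ : ℝ}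
    (h : y + τ • w ∈ chartTarget c) :
    ContMDiffAt 𝓘(ℝ, ℝ) (𝓡 n) ∞ (fun s : ℝ ↦ (extChartAt (𝓡 n) c).symm (y + s • w)) τ := by
  have hline : ContDiff ℝ ∞ fun s : ℝ ↦ y + s • w := by fun_prop
  exact (contMDiffAt_chart_symm h).comp τ hline.contMDiff.contMDiffAt

lemma mfderiv_chart_symm_segment {c : M} {y w : 𝔼 n} {τ : ℝ} (h : y + τ • w ∈ chartTarget c) :
    mfderiv 𝓘(ℝ, ℝ) (𝓡 n) (fun s : ℝ ↦ (extChartAt (𝓡 n) c).symm (y + s • w)) τ (1 : ℝ)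
      = ofCoord c ((extChartAt (𝓡 n) c).symm (y + τ • w)) w := by
  have hline : HasFDerivAt (fun s : ℝ ↦ y + s • w)
      ((ContinuousLinearMap.id ℝ ℝ).smulRight w) τ :=
    ((ContinuousLinearMap.id ℝ ℝ).smulRight w).hasFDerivAt.const_add y
  have hcomp := ((contMDiffAt_chart_symm h).mdifferentiableAt (by simp)).hasMFDerivAt.comp τ
    hline.hasMFDerivAt
  rw [mfderiv_chart_symm h] at hcomp
  refine (congrArg (fun l : ℝ →L[ℝ] TangentSpace (𝓡 n) _ ↦ l 1) hcomp.mfderiv).trans ?_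
  change ofCoord c _ ((1 : ℝ) • w) = _
  rw [one_smul]

variable [RiemannianBundle (fun x : M ↦ TangentSpace (𝓡 n) x)] [IsRiemannianManifold (𝓡 n) M]

lemma dist_chart_symm_segment_le {c : M} {y w : 𝔼 n} {s C : ℝ} (hs : 0 ≤ s) (hC : 0 ≤ C)
    (h : ∀ τ ∈ Icc 0 s, y + τ • w ∈ chartTarget (n := n) c)
    (hg : ∀ τ ∈ Icc 0 s, coordMetric c (y + τ • w) w w ≤ C ^ 2) :
    dist ((extChartAt (𝓡 n) c).symm (y + s • w)) ((extChartAt (𝓡 n) c).symm y) ≤ s * C := by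
  set γ : ℝ → M := fun τ ↦ (extChartAt (𝓡 n) c).symm (y + τ • w)
  have hγ : ContMDiffOn 𝓘(ℝ, ℝ) (𝓡 n) 1 γ (Icc 0 s) := fun τ hτ ↦
    ((contMDiffAt_chart_symm_segment (h τ hτ)).of_le (by simp)).contMDiffWithinAt
  have hspeed : ∀ τ ∈ Icc 0 s, ‖mfderiv 𝓘(ℝ, ℝ) (𝓡 n) γ τ (1 : ℝ)‖ₑ ≤ ENNReal.ofReal C := by
    intro τ hτ
    rw [mfderiv_chart_symm_segment (h τ hτ), ← ofReal_norm]
    refine ENNReal.ofReal_le_ofReal (abs_le_of_sq_le_sq' ?_ hC).2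
    rw [← real_inner_self_eq_norm_sq]
    exact hg τ hτ
  have hlength := riemannianEDist_le_pathELength hγ rfl rfl hs
  rw [← IsRiemannianManifold.out (I := 𝓡 n), pathELength_eq_lintegral_mfderiv_Icc] at hlength
  have hdist := hlength.trans (setLIntegral_mono' measurableSet_Icc hspeed)
  rw [setLIntegral_const, Real.volume_Icc, sub_zero, ← ENNReal.ofReal_mul hC, edist_dist,
    ENNReal.ofReal_le_ofReal_iff (by positivity), dist_comm, mul_comm] at hdist
  simpa only [γ, zero_smul, add_zero] using hdist

variable [IsContMDiffRiemannianBundle (𝓡 n) ∞ (𝔼 n) (fun x : M ↦ TangentSpace (𝓡 n) x)]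

lemma locallyLipschitzOn_chart_symm (c : M) :
    LocallyLipschitzOn (chartTarget c) (extChartAt (𝓡 n) c).symm := by
  intro y hy
  have hcont : ContinuousAt (fun z ↦ ‖coordMetric c z‖) y :=
    ((isLocalMetric_coordMetric c).contDiffAt hy).continuousAt.norm
  have hnear : ∀ᶠ z in 𝓝 y, ‖coordMetric c z‖ < ‖coordMetric c y‖ + 1 ∧ z ∈ chartTarget c :=
    (hcont.eventually (gt_mem_nhds (lt_add_one _))).and ((isOpen_chartTarget c).mem_nhds hy)
  obtain ⟨r, hr, hball⟩ := Metric.eventually_nhds_iff_ball.1 hnear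
  set D := ‖coordMetric c y‖ + 1
  have hD : 0 ≤ D := by positivity
  refine ⟨(√D).toNNReal, Metric.ball y r, nhdsWithin_le_nhds (Metric.ball_mem_nhds y hr),
    LipschitzOnWith.of_dist_le_mul fun a ha b hb ↦ ?_⟩
  have hseg : ∀ τ ∈ Icc (0 : ℝ) 1, b + τ • (a - b) ∈ Metric.ball y r := fun τ hτ ↦
    (convex_ball y r).add_smul_sub_mem hb ha hτ
  have hg : ∀ τ ∈ Icc (0 : ℝ) 1,
      coordMetric c (b + τ • (a - b)) (a - b) (a - b) ≤ (√D * dist a b) ^ 2 := fun τ hτ ↦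
    calc coordMetric c (b + τ • (a - b)) (a - b) (a - b)
        ≤ ‖coordMetric c (b + τ • (a - b))‖ * ‖a - b‖ * ‖a - b‖ :=
          (le_abs_self _).trans ((coordMetric c _).le_opNorm₂ _ _)
      _ ≤ D * ‖a - b‖ * ‖a - b‖ := by gcongr; exact (hball _ (hseg τ hτ)).1.le
      _ = (√D * dist a b) ^ 2 := by rw [mul_pow, Real.sq_sqrt hD, dist_eq_norm]; ring
  have hdist := dist_chart_symm_segment_le zero_le_one (by positivity)
    (fun τ hτ ↦ (hball _ (hseg τ hτ)).2) hg
  rwa [one_smul, add_sub_cancel, one_mul, ← Real.coe_toNNReal _ (Real.sqrt_nonneg D)] at hdist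

lemma eventually_dist_chart_symm_le {c : M} {y : 𝔼 n} (hy : y ∈ chartTarget c)
    (w : 𝔼 n) {ε : ℝ} (hε : 0 < ε) :
    ∀ᶠ s in 𝓝[>] (0 : ℝ), dist ((extChartAt (𝓡 n) c).symm (y + s • w))
      ((extChartAt (𝓡 n) c).symm y) ≤ s * (√(coordMetric c y w w) + ε) := by
  have hcont : ContinuousAt (fun z ↦ √(coordMetric c z w w)) y :=
    ((((isLocalMetric_coordMetric c).contDiffAt hy).continuousAt.clm_apply
      continuousAt_const).clm_apply continuousAt_const).sqrt
  have hnear : ∀ᶠ z in 𝓝 y,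
      √(coordMetric c z w w) < √(coordMetric c y w w) + ε ∧ z ∈ chartTarget c :=
    (hcont.eventually (gt_mem_nhds (lt_add_of_pos_right _ hε))).and
      ((isOpen_chartTarget c).mem_nhds hy)
  have hline : Filter.Tendsto (fun τ : ℝ ↦ y + τ • w) (𝓝 0) (𝓝 y) :=
    Continuous.tendsto' (by fun_prop) _ _ (by simp)
  obtain ⟨r, hr, hball⟩ := Metric.eventually_nhds_iff_ball.1 (hline.eventually hnear)
  filter_upwards [Ioo_mem_nhdsGT hr] with s hs
  have hmem : ∀ τ ∈ Icc 0 s, τ ∈ Metric.ball (0 : ℝ) r := fun τ hτ ↦ by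
    rw [Metric.mem_ball, dist_zero_right, Real.norm_eq_abs, abs_of_nonneg hτ.1]
    exact hτ.2.trans_lt hs.2
  exact dist_chart_symm_segment_le hs.1.le (by positivity) (fun τ hτ ↦ (hball τ (hmem τ hτ)).2)
    fun τ hτ ↦ (Real.sqrt_le_left (by positivity)).1 (hball τ (hmem τ hτ)).1.le

lemma SlopeLE.abs_fderiv_le {c : M} {y : 𝔼 n} (hy : y ∈ chartTarget c) {θ : M → ℝ} {ℓ : ℝ}
    (hℓ : 0 ≤ ℓ) (hθ : SlopeLE θ ℓ ((extChartAt (𝓡 n) c).symm y)) {F : 𝔼 n → ℝ}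
    (hF : F =ᶠ[𝓝 y] fun z ↦ θ ((extChartAt (𝓡 n) c).symm z)) (hd : DifferentiableAt ℝ F y)
    (w : 𝔼 n) : |fderiv ℝ F y w| ≤ ℓ * √(coordMetric c y w w) := by
  have hline : Filter.Tendsto (fun τ : ℝ ↦ y + τ • w) (𝓝[>] 0) (𝓝 y) :=
    (Continuous.tendsto' (by fun_prop) _ _ (by simp)).mono_left nhdsWithin_le_nhds
  have hder : HasDerivAt (fun s : ℝ ↦ F (y + s • w)) (fderiv ℝ F y w) 0 :=
    hd.hasFDerivAt.hasLineDerivAt w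
  have hslope : Filter.Tendsto (slope (fun s : ℝ ↦ F (y + s • w)) 0) (𝓝[>] 0)
      (𝓝 (fderiv ℝ F y w)) :=
    (hasDerivAt_iff_tendsto_slope.1 hder).mono_left
      (nhdsWithin_mono (0 : ℝ) fun s (hs : 0 < s) ↦ hs.ne')
  have hbound : ∀ ε > 0, |fderiv ℝ F y w| ≤ (ℓ + ε) * (√(coordMetric c y w w) + ε) := by
    intro ε hε
    refine le_of_tendsto hslope.abs ?_
    filter_upwards [eventually_dist_chart_symm_le hy w hε, self_mem_nhdsWithin,
      hline.eventually hF, hline.eventually ((contMDiffAt_chart_symm hy).continuousAt.eventually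
        (hθ (ℓ + ε) (lt_add_of_pos_right _ hε)))] with s hdist (hs : 0 < s) hFs hθs
    rw [slope_def_field, sub_zero, zero_smul, add_zero, abs_div, abs_of_pos hs, div_le_iff₀ hs,
      hFs, hF.self_of_nhds]
    exact (hθs.trans (mul_le_mul_of_nonneg_left hdist (by positivity))).trans_eq (by ring)
  have hlim : Filter.Tendsto (fun ε : ℝ ↦ (ℓ + ε) * (√(coordMetric c y w w) + ε)) (𝓝[>] 0)
      (𝓝 (ℓ * √(coordMetric c y w w))) :=
    (Continuous.tendsto' (by fun_prop) _ _ (by simp)).mono_left nhdsWithin_le_nhds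
  exact ge_of_tendsto hlim (by filter_upwards [self_mem_nhdsWithin] with ε hε using hbound ε hε)

end Slope

section DivergenceTheorem

lemma contDiff_indicator_of_isOpen {E F : Type*} [NormedAddCommGroup E] [NormedSpace ℝ E]
    [NormedAddCommGroup F] [NormedSpace ℝ F] {k : WithTop ℕ∞} {U K : Set E} (hU : IsOpen U)
    (hK : IsClosed K) (hKU : K ⊆ U) {f : E → F} (hf : ∀ y ∈ U, ContDiffAt ℝ k f y)
    (hf0 : ∀ y ∈ U, y ∉ K → f y = 0) : ContDiff ℝ k (U.indicator f) := by
  refine contDiff_iff_contDiffAt.2 fun y ↦ ?_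
  by_cases hy : y ∈ U
  · refine (hf y hy).congr_of_eventuallyEq ?_
    filter_upwards [hU.mem_nhds hy] with z hz using indicator_of_mem hz _
  · refine (contDiffAt_const (c := (0 : F))).congr_of_eventuallyEq ?_
    filter_upwards [hK.isOpen_compl.mem_nhds fun h ↦ hy (hKU h)] with z hz
    by_cases hzU : z ∈ U
    · rw [indicator_of_mem hzU, hf0 z hzU hz]
    · exact indicator_of_notMem hzU _

lemma integral_mul_trace_fderiv {n : ℕ} {Q : 𝔼 n → ℝ} {N : NNReal} (hQ : LipschitzWith N Q)
    {W : 𝔼 n → 𝔼 n} (hW : ContDiff ℝ 1 W) (hWc : HasCompactSupport W) :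
    ∫ y, Q y * LinearMap.trace ℝ (𝔼 n) (fderiv ℝ W y) = -∫ y, fderiv ℝ Q y (W y) := by
  set e : Fin n → 𝔼 n := fun i ↦ EuclideanSpace.single i 1
  have hcomp (i : Fin n) : ContDiff ℝ 1 fun y ↦ W y i := contDiff_euclidean.1 hW i
  have hcomp_supp (i : Fin n) : HasCompactSupport fun y ↦ W y i :=
    hWc.comp_left (g := fun v : 𝔼 n ↦ v i) rfl
  have hline (i : Fin n) (y : 𝔼 n) :
      lineDeriv ℝ (fun z ↦ W z i) y (e i) = fderiv ℝ W y (e i) i := by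
    have hWy := (hW.differentiable (by simp) y).hasFDerivAt
    exact (((EuclideanSpace.proj (𝕜 := ℝ) i).hasFDerivAt.comp y hWy).hasLineDerivAt (e i)).lineDeriv
  have hcont (i : Fin n) : Continuous fun y ↦ fderiv ℝ W y (e i) i :=
    (EuclideanSpace.proj (𝕜 := ℝ) i).continuous.comp
      ((hW.continuous_fderiv (by simp)).clm_apply continuous_const)
  have hint_trace (i : Fin n) : Integrable fun y ↦ Q y * fderiv ℝ W y (e i) i := by
    refine (hQ.continuous.mul (hcont i)).integrable_of_hasCompactSupport ?_
    exact ((hWc.fderiv (𝕜 := ℝ)).comp_left (g := fun A : 𝔼 n →L[ℝ] 𝔼 n ↦ A (e i) i) rfl).mul_left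
  have hint_line (i : Fin n) : Integrable fun y ↦ lineDeriv ℝ Q y (e i) * W y i :=
    ((hcomp i).continuous.integrable_of_hasCompactSupport (hcomp_supp i)).bdd_mul
      (aestronglyMeasurable_lineDeriv hQ.continuous _)
      (.of_forall fun _ ↦ norm_lineDeriv_le_of_lipschitz ℝ hQ)
  have hparts (i : Fin n) :
      ∫ y, Q y * fderiv ℝ W y (e i) i = -∫ y, lineDeriv ℝ Q y (e i) * W y i := by
    obtain ⟨D, hD⟩ := (hcomp i).lipschitzWith_of_hasCompactSupport (hcomp_supp i) (by simp)
    rw [hQ.integral_lineDeriv_mul_eq hD (hcomp_supp i), ← integral_neg]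
    simp only [lineDeriv_neg, neg_mul, neg_neg, hline, mul_comm (Q _)]
  have hsum (v : 𝔼 n) : ∑ i, v i • e i = v := by
    simpa using (EuclideanSpace.basisFun (Fin n) ℝ).sum_repr v
  have hfderiv : ∀ᵐ y, fderiv ℝ Q y (W y) = ∑ i, lineDeriv ℝ Q y (e i) * W y i := by
    filter_upwards [hQ.ae_differentiableAt] with y hy
    conv_lhs => rw [← hsum (W y), map_sum]
    exact Finset.sum_congr rfl fun i _ ↦ by
      rw [map_smul, smul_eq_mul, mul_comm, hy.lineDeriv_eq_fderiv]
  rw [integral_congr_ae hfderiv, integral_finsetSum _ fun i _ ↦ hint_line i,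
    ← Finset.sum_neg_distrib]
  simp only [trace_eq_sum_single, Finset.mul_sum]
  exact (integral_finsetSum _ fun i _ ↦ hint_trace i).trans
    (Finset.sum_congr rfl fun i _ ↦ hparts i)

lemma exists_smooth_partition (n : ℕ) {M : Type*} [MetricSpace M]
    [ChartedSpace (𝔼 n) M] [IsManifold (𝓡 n) ∞ M] [SecondCountableTopology M] {K : Set M}
    (hK : IsCompact K) :
    ∃ (J : Finset M) (ψ : M → M → ℝ) (C : M → Set M),
      (∀ i, IsCompact (C i) ∧ C i ⊆ chartDom (n := n) i) ∧
      (∀ i x, ContMDiffAt (𝓡 n) 𝓘(ℝ, ℝ) ∞ (ψ i) x) ∧ (∀ i x, 0 ≤ ψ i x) ∧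
      (∀ i, ∀ x ∉ C i, ψ i x = 0) ∧ ∀ x ∈ K, ∀ᶠ z in 𝓝 x, ∑ i ∈ J, ψ i z = 1 := by
  have : LocallyCompactSpace M := Manifold.locallyCompact_of_finiteDimensional (𝓡 n)
  choose C hC hcC hCdom using fun c : M ↦
    exists_compact_subset (isOpen_chartDom (n := n) c) (mem_chart_source _ c)
  obtain ⟨ψ, hψC⟩ := SmoothPartitionOfUnity.exists_isSubordinate (𝓡 n) (isClosed_univ (X := M))
    (fun c ↦ interior (C c)) (fun _ ↦ isOpen_interior) fun c _ ↦ mem_iUnion.2 ⟨c, hcC c⟩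
  obtain ⟨K', hK', hKK'⟩ := exists_compact_superset hK
  have hfin := ψ.locallyFinite.finite_nonempty_inter_compact hK'
  refine ⟨hfin.toFinset, fun i ↦ ψ i, C, fun i ↦ ⟨hC i, hCdom i⟩,
    fun i _ ↦ (ψ i).contMDiff.contMDiffAt, ψ.nonneg, fun i x hx ↦ ?_, fun x hx ↦ ?_⟩
  · by_contra hne
    exact hx (interior_subset (hψC i (subset_tsupport _ hne)))
  · filter_upwards [isOpen_interior.mem_nhds (hKK' hx)] with z hz
    rw [← ψ.sum_eq_one (mem_univ z), finsum_eq_sum_of_support_subset]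
    intro i hi
    rw [Finite.coe_toFinset]
    exact ⟨z, hi, interior_subset hz⟩

section Manifold

variable {n : ℕ} {M : Type*} [MetricSpace M] [ChartedSpace (𝔼 n) M]

lemma chart_image_subset {c : M} {K : Set M} (hKc : K ⊆ chartDom (n := n) c) :
    extChartAt (𝓡 n) c '' K ⊆ chartTarget c :=
  image_subset_iff.2 fun _ hx ↦ chart_mem_chartTarget (hKc hx)

variable [IsManifold (𝓡 n) ∞ M]

lemma isCompact_chart_image {c : M} {K : Set M} (hK : IsCompact K) (hKc : K ⊆ chartDom (n := n) c) :
    IsCompact (extChartAt (𝓡 n) c '' K) :=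
  hK.image_of_continuousOn fun _ hx ↦ (contMDiffAt_chart (hKc hx)).continuousAt.continuousWithinAt

variable [RiemannianBundle (fun x : M ↦ TangentSpace (𝓡 n) x)]

/-- The vector field `√(det g) V` read in the chart centred at `c`, extended by zero. Its Euclidean
divergence is `√(det g) div V`. -/
def densityField (c : M) (V : VField n M) : 𝔼 n → 𝔼 n :=
  (chartTarget c).indicator fun y ↦ coordDensity c y • coordField c V y

lemma densityField_of_mem {c : M} {y : 𝔼 n} (hy : y ∈ chartTarget c) (V : VField n M) :
    densityField c V y = coordDensity c y • coordField c V y :=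
  indicator_of_mem hy _

lemma densityField_eq_zero {c : M} {K : Set M} {V : VField n M} (hV : ∀ x ∉ K, V x = 0) {y : 𝔼 n}
    (hy : y ∉ extChartAt (𝓡 n) c '' K) : densityField c V y = 0 := by
  by_cases hyc : y ∈ chartTarget c
  · have hyK : (extChartAt (𝓡 n) c).symm y ∉ K := fun h ↦ hy ⟨_, h, chart_right_inv hyc⟩
    rw [densityField_of_mem hyc, coordField, hV _ hyK, map_zero, smul_zero]
  · exact indicator_of_notMem hyc _

variable [IsContMDiffRiemannianBundle (𝓡 n) ∞ (𝔼 n) (fun x : M ↦ TangentSpace (𝓡 n) x)]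

lemma contDiff_densityField {c : M} {K : Set M} (hK : IsCompact K) (hKc : K ⊆ chartDom (n := n) c)
    {V : VField n M} (hV : ∀ x, SmoothAt V x) (hV0 : ∀ x ∉ K, V x = 0) :
    ContDiff ℝ ∞ (densityField c V) := by
  refine contDiff_indicator_of_isOpen (isOpen_chartTarget c) (isCompact_chart_image hK hKc).isClosed
    (chart_image_subset hKc)
    (fun y hy ↦ (contDiffAt_coordDensity hy).smul ((hV _).contDiffAt_coordField hy))
    fun y hy hyK ↦ ?_
  rw [← densityField_of_mem hy, densityField_eq_zero hV0 hyK]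

lemma trace_fderiv_densityField {c : M} {y : 𝔼 n} (hy : y ∈ chartTarget c) {V : VField n M}
    (hV : SmoothAt V ((extChartAt (𝓡 n) c).symm y)) :
    LinearMap.trace ℝ (𝔼 n) (fderiv ℝ (densityField c V) y)
      = coordDensity c y * divergence V ((extChartAt (𝓡 n) c).symm y) := by
  have hnear : densityField c V =ᶠ[𝓝 y] fun z ↦ coordDensity c z • coordField c V z := by
    filter_upwards [(isOpen_chartTarget c).mem_nhds hy] with z hz using densityField_of_mem hz V
  rw [hnear.fderiv_eq, divergence_chart (chart_symm_mem_chartDom hy) hV, chart_right_inv hy]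
  exact trace_fderiv_density_smul (isLocalMetric_coordMetric c) hy
    ((hV.contDiffAt_coordField hy).differentiableAt (by simp))

variable [IsRiemannianManifold (𝓡 n) M]

lemma exists_lipschitzWith_eventuallyEq_comp_chart_symm {c : M} {K : Set (𝔼 n)} (hK : IsCompact K)
    (hKc : K ⊆ chartTarget c) {θ : M → ℝ} (hθ : LocallyLipschitz θ) :
    ∃ (N : NNReal) (Q : 𝔼 n → ℝ), LipschitzWith N Q ∧
      ∀ y ∈ K, Q =ᶠ[𝓝 y] fun z ↦ θ ((extChartAt (𝓡 n) c).symm z) := by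
  have hlip : LocallyLipschitzOn (chartTarget c) fun y ↦ θ ((extChartAt (𝓡 n) c).symm y) := by
    intro y hy
    obtain ⟨N, t, ht, hN⟩ := hθ ((extChartAt (𝓡 n) c).symm y)
    obtain ⟨L, s, hs, hL⟩ := locallyLipschitzOn_chart_symm c hy
    exact ⟨N * L, s ∩ (extChartAt (𝓡 n) c).symm ⁻¹' t,
      Filter.inter_mem hs
        (mem_nhdsWithin_of_mem_nhds ((contMDiffAt_chart_symm hy).continuousAt ht)),
      hN.comp (hL.mono inter_subset_left) fun _ hz ↦ hz.2⟩
  obtain ⟨K', hK', hKK', hK'c⟩ := exists_compact_between hK (isOpen_chartTarget c) hKc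
  obtain ⟨N, hN⟩ := (hlip.mono hK'c).exists_lipschitzOnWith_of_compact hK'
  obtain ⟨Q, hQ, hQeq⟩ := hN.extend_real
  refine ⟨N, Q, hQ, fun y hy ↦ ?_⟩
  filter_upwards [isOpen_interior.mem_nhds (hKK' hy)] with z hz
    using (hQeq (interior_subset hz)).symm

variable [MeasurableSpace M] [BorelSpace M] [SecondCountableTopology M]

omit [IsRiemannianManifold (𝓡 n) M] in
lemma integral_mul_divergence_chart {c : M} {K : Set M} (hK : IsCompact K)
    (hKc : K ⊆ chartDom (n := n) c) {V : VField n M} (hV : ∀ x, SmoothAt V x)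
    (hV0 : ∀ x ∉ K, V x = 0) {θ : M → ℝ} (hθ : Continuous θ) {Q : 𝔼 n → ℝ} {N : NNReal}
    (hQ : LipschitzWith N Q)
    (hQθ : ∀ x ∈ K, Q (extChartAt (𝓡 n) c x) = θ x) :
    ∫ x, θ x * divergence V x ∂(vol n M) = -∫ y, fderiv ℝ Q y (densityField c V y) := by
  set K' := extChartAt (𝓡 n) c '' K
  have hK' : IsCompact K' := isCompact_chart_image hK hKc
  have hdiv0 : ∀ x ∉ K, divergence V x = 0 := fun x hx ↦ divergence_of_eventually_zero (by
    filter_upwards [hK.isClosed.isOpen_compl.mem_nhds hx] with z hz using hV0 z hz)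
  have hfderiv0 : ∀ y ∉ K', fderiv ℝ (densityField c V) y = 0 := fun y hy ↦ by
    have hnear : densityField c V =ᶠ[𝓝 y] fun _ ↦ 0 := by
      filter_upwards [hK'.isClosed.isOpen_compl.mem_nhds hy] with z hz
        using densityField_eq_zero hV0 hz
    rw [hnear.fderiv_eq, fderiv_fun_const, Pi.zero_apply]
  have hintegral : ∫ y in chartTarget c,
        Q y * LinearMap.trace ℝ (𝔼 n) (fderiv ℝ (densityField c V) y)
      = ∫ y, Q y * LinearMap.trace ℝ (𝔼 n) (fderiv ℝ (densityField c V) y) :=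
    setIntegral_eq_integral_of_forall_compl_eq_zero fun y hy ↦ by
      rw [hfderiv0 y fun h ↦ hy (chart_image_subset hKc h), ContinuousLinearMap.toLinearMap_zero,
        map_zero, mul_zero]
  have hmeas : AEStronglyMeasurable (fun x ↦ θ x * divergence V x) (vol n M) :=
    (hθ.mul (continuous_divergence hV)).aestronglyMeasurable
  rw [integral_vol_chart c hmeas fun x hx ↦ by rw [hdiv0 x fun h ↦ hx (hKc h), mul_zero],
    ← integral_mul_trace_fderiv hQ ((contDiff_densityField hK hKc hV hV0).of_le (by simp))
      (HasCompactSupport.intro hK' fun y hy ↦ densityField_eq_zero hV0 hy), ← hintegral]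
  refine setIntegral_congr_fun (measurableSet_chartTarget c) fun y hy ↦ ?_
  have htrace := trace_fderiv_densityField hy (hV ((extChartAt (𝓡 n) c).symm y))
  by_cases hyK : (extChartAt (𝓡 n) c).symm y ∈ K
  · have hQy := hQθ _ hyK
    rw [chart_right_inv hy] at hQy
    rw [hQy, htrace]
    ring
  · rw [htrace, hdiv0 _ hyK, mul_zero, mul_zero, mul_zero]

lemma abs_integral_mul_divergence_le_of_chartDom {c : M} {K : Set M} (hK : IsCompact K)
    (hKc : K ⊆ chartDom (n := n) c) {V : VField n M} (hV : ∀ x, SmoothAt V x)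
    (hV0 : ∀ x ∉ K, V x = 0) {θ ℓ : M → ℝ} (hθ : LocallyLipschitz θ) (hℓ : Continuous ℓ)
    (hℓ0 : ∀ x, 0 ≤ ℓ x) (hθℓ : ∀ x, SlopeLE θ (ℓ x) x) :
    |∫ x, θ x * divergence V x ∂(vol n M)| ≤ ∫ x, ℓ x * ‖V x‖ ∂(vol n M) := by
  set φ := (extChartAt (𝓡 n) c).symm
  have hK' := isCompact_chart_image hK hKc
  have hK'c := chart_image_subset hKc
  have hnorm := continuous_norm hV
  obtain ⟨N, Q, hQ, hQθ⟩ := exists_lipschitzWith_eventuallyEq_comp_chart_symm hK' hK'c hθ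
  have hbound_int : IntegrableOn (fun y ↦ coordDensity c y * (ℓ (φ y) * ‖V (φ y)‖))
      (chartTarget c) := by
    refine IntegrableOn.of_forall_sdiff_eq_zero (ContinuousOn.integrableOn_compact hK' ?_)
      (measurableSet_chartTarget c) fun y hy ↦ ?_
    · exact ((continuousOn_coordDensity c).mul ((hℓ.mul hnorm).comp_continuousOn
        (continuousOn_extChartAt_symm c))).mono hK'c
    · rw [hV0 _ fun h ↦ hy.2 ⟨_, h, chart_right_inv hy.1⟩, norm_zero, mul_zero, mul_zero]
  have hmeas : AEStronglyMeasurable (fun x ↦ ℓ x * ‖V x‖) (vol n M) :=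
    (hℓ.mul hnorm).aestronglyMeasurable
  have hintegral : ∫ y in chartTarget c, fderiv ℝ Q y (densityField c V y)
      = ∫ y, fderiv ℝ Q y (densityField c V y) :=
    setIntegral_eq_integral_of_forall_compl_eq_zero fun y hy ↦ by
      rw [densityField, indicator_of_notMem hy, map_zero]
  rw [integral_mul_divergence_chart hK hKc hV hV0 hθ.continuous hQ fun x hx ↦
      (hQθ _ (mem_image_of_mem _ hx)).self_of_nhds.trans (congrArg θ (chart_left_inv (hKc hx))),
    integral_vol_chart c hmeas fun x hx ↦ by
      rw [hV0 x fun h ↦ hx (hKc h), norm_zero, mul_zero],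
    abs_neg, ← Real.norm_eq_abs, ← hintegral]
  refine norm_integral_le_of_norm_le hbound_int ?_
  filter_upwards [ae_restrict_mem (measurableSet_chartTarget c),
    ae_restrict_of_ae hQ.ae_differentiableAt] with y hy hQy
  by_cases hyK : y ∈ extChartAt (𝓡 n) c '' K
  · have hslope := (hθℓ (φ y)).abs_fderiv_le hy (hℓ0 _) (hQθ y hyK) hQy (coordField c V y)
    rw [coordMetric_coordField hy, real_inner_self_eq_norm_sq, Real.sqrt_sq (norm_nonneg _)]
      at hslope
    rw [densityField_of_mem hy, map_smul, norm_smul, Real.norm_of_nonneg (coordDensity_pos hy).le]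
    exact mul_le_mul_of_nonneg_left hslope (coordDensity_pos hy).le
  · rw [densityField_eq_zero hV0 hyK, map_zero, norm_zero]
    exact mul_nonneg (coordDensity_pos hy).le (mul_nonneg (hℓ0 _) (norm_nonneg _))

lemma abs_integral_mul_divergence_le {K : Set M} (hK : IsCompact K) {V : VField n M}
    (hV : ∀ x, SmoothAt V x) {θ ℓ : M → ℝ} (hθ : LocallyLipschitz θ) (hθ0 : ∀ x ∉ K, θ x = 0)
    (hℓ : Continuous ℓ) (hℓ_nonneg : ∀ x, 0 ≤ ℓ x) (hℓ0 : ∀ x ∉ K, ℓ x = 0)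
    (hθℓ : ∀ x, SlopeLE θ (ℓ x) x) :
    |∫ x, θ x * divergence V x ∂(vol n M)| ≤ ∫ x, ℓ x * ‖V x‖ ∂(vol n M) := by
  have : LocallyCompactSpace M := Manifold.locallyCompact_of_finiteDimensional (𝓡 n)
  obtain ⟨J, ψ, C, hC, hψ, hψ_nonneg, hψ0, hψ_sum⟩ := exists_smooth_partition n hK
  set W : M → VField n M := fun i x ↦ ψ i x • V x with hW_def
  have hW (i x : M) : SmoothAt (W i) x := (hV x).smul (hψ i x)
  have hdiv (x : M) : θ x * divergence V x = ∑ i ∈ J, θ x * divergence (W i) x := by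
    by_cases hx : x ∈ K
    · rw [← Finset.mul_sum, ← divergence_sum J fun i ↦ hW i x]
      congr 1
      refine divergence_congr (hV x) ?_ |>.symm
      filter_upwards [hψ_sum x hx] with z hz
      rw [Finset.sum_apply, hW_def, ← Finset.sum_smul, hz, one_smul]
    · simp only [hθ0 x hx, zero_mul, Finset.sum_const_zero]
  have hnorm (x : M) : ℓ x * ‖V x‖ = ∑ i ∈ J, ℓ x * ‖W i x‖ := by
    by_cases hx : x ∈ K
    · simp only [hW_def, norm_smul, Real.norm_of_nonneg (hψ_nonneg _ x)]
      rw [← Finset.mul_sum, ← Finset.sum_mul, (hψ_sum x hx).self_of_nhds, one_mul]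
    · simp only [hℓ0 x hx, zero_mul, Finset.sum_const_zero]
  have hdiv_int (i : M) : Integrable (fun x ↦ θ x * divergence (W i) x) (vol n M) :=
    (hθ.continuous.mul (continuous_divergence (hW i))).integrable_of_hasCompactSupport
      (HasCompactSupport.intro hK fun x hx ↦ by rw [Pi.mul_apply, hθ0 x hx, zero_mul])
  have hnorm_int (i : M) : Integrable (fun x ↦ ℓ x * ‖W i x‖) (vol n M) :=
    (hℓ.mul (continuous_norm (hW i))).integrable_of_hasCompactSupport
      (HasCompactSupport.intro hK fun x hx ↦ by rw [Pi.mul_apply, hℓ0 x hx, zero_mul])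
  simp only [hdiv, hnorm]
  rw [integral_finsetSum _ fun i _ ↦ hdiv_int i, integral_finsetSum _ fun i _ ↦ hnorm_int i]
  refine (Finset.abs_sum_le_sum_abs _ _).trans (Finset.sum_le_sum fun i _ ↦ ?_)
  exact abs_integral_mul_divergence_le_of_chartDom (hC i).1 (hC i).2 (hW i)
    (fun x hx ↦ by simp only [hW_def, hψ0 i x hx, zero_smul]) hθ hℓ hℓ_nonneg hθℓ

lemma abs_integral_sq_mul_divergence_le {V : VField n M} (hV : ∀ x, SmoothAt V x) {χ : M → ℝ}
    {L : NNReal} (hχ : LipschitzWith L χ) (hχc : HasCompactSupport χ) :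
    |∫ x, χ x ^ 2 * divergence V x ∂(vol n M)| ≤ 2 * L * ∫ x, |χ x| * ‖V x‖ ∂(vol n M) := by
  have hsq : LocallyLipschitz fun t : ℝ ↦ t ^ 2 := (contDiff_id (𝕜 := ℝ).pow 2).locallyLipschitz
  have h := abs_integral_mul_divergence_le hχc.isCompact hV (hsq.comp hχ.locallyLipschitz)
    (ℓ := fun x ↦ 2 * L * |χ x|)
    (fun x hx ↦ by
      rw [Function.comp_apply, image_eq_zero_of_notMem_tsupport hx, zero_pow two_ne_zero])
    (continuous_const.mul hχ.continuous.abs) (fun x ↦ by positivity)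
    (fun x hx ↦ by rw [image_eq_zero_of_notMem_tsupport hx, abs_zero, mul_zero]) (slopeLE_sq hχ)
  simpa only [Function.comp_apply, mul_assoc, integral_const_mul] using h

end Manifold

end DivergenceTheorem

section TimeDependent

section HilbertSchmidt

variable {E : Type*} [NormedAddCommGroup E] [NormedSpace ℝ E]

/-- The squared Hilbert-Schmidt norm `tr (N* N)` of an endomorphism `N`, with respect to an inner
product `B`: the adjoint `N*` is `B⁻¹ Nᵀ B`, where `B` is seen as a map from `E` to its dual. -/
def hilbertSchmidtSq (B : E →L[ℝ] E →L[ℝ] ℝ) (N : E →L[ℝ] E) : ℝ :=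
  LinearMap.trace ℝ E
    (B.inverse.comp (((compL ℝ E E ℝ).flip N).comp (B.comp N)) : E →L[ℝ] E)

lemma hilbertSchmidtSq_eq_sum {B : E →L[ℝ] E →L[ℝ] ℝ} (hB : B.IsInvertible) {ι : Type*} [Fintype ι]
    {e : ι → E}
    (he : ∀ A : E →L[ℝ] E, ∑ i, B (A (e i)) (e i) = LinearMap.trace ℝ E (A : E →ₗ[ℝ] E))
    (N : E →L[ℝ] E) : hilbertSchmidtSq B N = ∑ i, B (N (e i)) (N (e i)) := by
  rw [hilbertSchmidtSq, ← he]
  exact Finset.sum_congr rfl fun i _ ↦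
    congrArg (fun l : E →L[ℝ] ℝ ↦ l (e i)) (hB.self_apply_inverse _)

lemma continuousOn_hilbertSchmidtSq [FiniteDimensional ℝ E] {X : Type*} [TopologicalSpace X]
    {S : Set X} {B : X → E →L[ℝ] E →L[ℝ] ℝ} {N : X → E →L[ℝ] E} (hB : ContinuousOn B S)
    (hB_inv : ContinuousOn (fun x ↦ (B x).inverse) S) (hN : ContinuousOn N S) :
    ContinuousOn (fun x ↦ hilbertSchmidtSq (B x) (N x)) S := by
  have htrace : Continuous fun A : E →L[ℝ] E ↦ LinearMap.trace ℝ E (A : E →ₗ[ℝ] E) :=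
    (LinearMap.trace ℝ E ∘ₗ ContinuousLinearMap.coeLM ℝ).continuous_of_finiteDimensional
  exact htrace.comp_continuousOn (hB_inv.clm_comp
    (((ContinuousLinearMap.continuous _).comp_continuousOn hN).clm_comp (hB.clm_comp hN)))

end HilbertSchmidt

variable {n : ℕ} {M : Type*} [TopologicalSpace M] [ChartedSpace (𝔼 n) M]

lemma continuousOn_of_eq_comp_chart {X : Type*} [TopologicalSpace X] {I : Set ℝ} {f : ℝ × M → X}
    (h : ∀ c : M, ∃ F : ℝ × 𝔼 n → X, ContinuousOn F (I ×ˢ chartTarget c) ∧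
      ∀ s ∈ I, ∀ z ∈ chartDom (n := n) c, f (s, z) = F (s, extChartAt (𝓡 n) c z)) :
    ContinuousOn f (I ×ˢ univ) := by
  rintro ⟨s, x⟩ ⟨hs, -⟩
  have hx : x ∈ chartDom (n := n) x := mem_chart_source _ x
  obtain ⟨F, hF, hfF⟩ := h x
  have hchart : ContinuousOn (extChartAt (𝓡 n) x) (chartDom (n := n) x) := by
    simpa only [extChartAt_source] using continuousOn_extChartAt (I := 𝓡 n) x
  have hcomp : ContinuousOn (fun q : ℝ × M ↦ F (q.1, extChartAt (𝓡 n) x q.2))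
      (I ×ˢ chartDom (n := n) x) :=
    hF.comp (continuousOn_fst.prodMk (hchart.comp continuousOn_snd fun _ hq ↦ hq.2))
      fun _ hq ↦ ⟨hq.1, chart_mem_chartTarget hq.2⟩
  refine (hcomp.congr fun q hq ↦ hfF q.1 hq.1 q.2 hq.2) (s, x) ⟨hs, hx⟩ |>.mono_of_mem_nhdsWithin ?_
  rw [nhdsWithin_prod_eq, nhdsWithin_univ]
  exact Filter.prod_mem_prod self_mem_nhdsWithin ((isOpen_chartDom x).mem_nhds hx)

variable [IsManifold (𝓡 n) ∞ M]

section Metric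

variable [RiemannianBundle (fun x : M ↦ TangentSpace (𝓡 n) x)]
  [IsContMDiffRiemannianBundle (𝓡 n) ∞ (𝔼 n) (fun x : M ↦ TangentSpace (𝓡 n) x)]

lemma continuousOn_coordMetric_snd (c : M) (I : Set ℝ) :
    ContinuousOn (fun q : ℝ × 𝔼 n ↦ coordMetric c q.2) (I ×ˢ chartTarget c) :=
  (isLocalMetric_coordMetric c).smooth.continuousOn.comp continuousOn_snd fun _ hq ↦ hq.2

lemma gradSq_chart {c x : M} (hx : x ∈ chartDom (n := n) c) {V : VField n M} (hV : SmoothAt V x) :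
    gradSq V x = hilbertSchmidtSq (coordMetric c (extChartAt (𝓡 n) c x))
      (cov (coordMetric c) (coordField c V) (extChartAt (𝓡 n) c x)) := by
  have hinv := (isLocalMetric_coordMetric c).isInvertible (chart_mem_chartTarget hx)
  rw [hilbertSchmidtSq_eq_sum hinv (sum_coordMetric_frame hx), gradSq]
  simp only [← toCoord_nabla hx hV, coordMetric_chart hx, real_inner_self_eq_norm_sq]

end Metric

/-- A time-dependent vector field which is smooth on `[0, T] × M`. -/
def SmoothPath (T : ℝ) (u : ℝ → VField n M) : Prop :=
  ContMDiffOn (𝓘(ℝ, ℝ).prod (𝓡 n)) (𝓡 n).tangent ∞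
    (fun q : ℝ × M ↦ (⟨q.2, u q.1 q.2⟩ : TangentBundle (𝓡 n) M)) (Icc 0 T ×ˢ univ)

/-- A time-dependent vector field in the chart centred at `c`, as a function of time and space. -/
def coordPath (u : ℝ → VField n M) (c : M) (q : ℝ × 𝔼 n) : 𝔼 n :=
  coordField c (u q.1) q.2

/-- The total derivative of `coordPath`, one-sided at the times `0` and `T`. -/
def coordPathDeriv (T : ℝ) (u : ℝ → VField n M) (c : M) (q : ℝ × 𝔼 n) : ℝ × 𝔼 n →L[ℝ] 𝔼 n :=
  fderivWithin ℝ (coordPath u c) (Icc 0 T ×ˢ chartTarget c) q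

variable {T : ℝ} {u : ℝ → VField n M}

namespace SmoothPath

lemma smoothAt (hu : SmoothPath T u) {t : ℝ} (ht : t ∈ Icc 0 T) (x : M) : SmoothAt (u t) x := by
  have hslice : ContMDiff (𝓡 n) (𝓘(ℝ, ℝ).prod (𝓡 n)) ∞ (fun z : M ↦ (t, z)) :=
    contMDiff_const.prodMk contMDiff_id
  exact (contMDiffOn_univ.1 (hu.comp hslice.contMDiffOn fun _ _ ↦ ⟨ht, mem_univ _⟩)).contMDiffAt

lemma contDiffOn_coordPath (hu : SmoothPath T u) (c : M) :
    ContDiffOn ℝ ∞ (coordPath u c) (Icc 0 T ×ˢ chartTarget c) := by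
  have hchart : ContMDiffOn 𝓘(ℝ, ℝ × 𝔼 n) (𝓘(ℝ, ℝ).prod (𝓡 n)) ∞
      (fun q : ℝ × 𝔼 n ↦ (q.1, (extChartAt (𝓡 n) c).symm q.2)) (Icc 0 T ×ˢ chartTarget c) :=
    contDiff_fst.contMDiff.contMDiffOn.prodMk ((contMDiffOn_extChartAt_symm c).comp
      contDiff_snd.contMDiff.contMDiffOn fun _ hq ↦ hq.2)
  have htriv := ((trivializationAt (𝔼 n) (TangentSpace (𝓡 n)) c).contMDiffOn_iff
    fun q hq ↦ (Trivialization.mem_source _).2 (mem_baseSet (chart_symm_mem_chartDom hq.2))).1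
      (hu.comp hchart fun _ hq ↦ ⟨hq.1, mem_univ _⟩)
  rw [← contMDiffOn_iff_contDiffOn]
  exact htriv.2.congr fun _ hq ↦ toCoord_eq_snd (chart_symm_mem_chartDom hq.2) _

lemma hasFDerivWithinAt_coordPath (hu : SmoothPath T u) {c : M} {t : ℝ} (ht : t ∈ Icc 0 T)
    {y : 𝔼 n} (hy : y ∈ chartTarget c) :
    HasFDerivWithinAt (coordPath u c) (coordPathDeriv T u c (t, y)) (Icc 0 T ×ˢ chartTarget c)
      (t, y) :=
  ((hu.contDiffOn_coordPath c).differentiableOn (by simp) (t, y) ⟨ht, hy⟩).hasFDerivWithinAt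

lemma continuousOn_coordPathDeriv (hT : 0 < T) (hu : SmoothPath T u) (c : M) :
    ContinuousOn (coordPathDeriv T u c) (Icc 0 T ×ˢ chartTarget c) :=
  (hu.contDiffOn_coordPath c).continuousOn_fderivWithin
    ((uniqueDiffOn_Icc hT).prod (isOpen_chartTarget c).uniqueDiffOn) (by simp)

lemma fderiv_coordField (hu : SmoothPath T u) {c : M} {t : ℝ} (ht : t ∈ Icc 0 T) {y : 𝔼 n}
    (hy : y ∈ chartTarget c) :
    fderiv ℝ (coordField c (u t)) y
      = (coordPathDeriv T u c (t, y)).comp (ContinuousLinearMap.inr ℝ ℝ (𝔼 n)) := by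
  have hslice : HasFDerivWithinAt (fun z : 𝔼 n ↦ (t, z)) (ContinuousLinearMap.inr ℝ ℝ (𝔼 n))
      (chartTarget c) y := (hasFDerivAt_prodMk_right t y).hasFDerivWithinAt
  have hcomp := (hu.hasFDerivWithinAt_coordPath ht hy).comp y hslice fun _ hz ↦ ⟨ht, hz⟩
  exact (hcomp.hasFDerivAt ((isOpen_chartTarget c).mem_nhds hy)).fderiv

variable [RiemannianBundle (fun x : M ↦ TangentSpace (𝓡 n) x)]

lemma hasDerivWithinAt (hu : SmoothPath T u) {c x : M} (hx : x ∈ chartDom (n := n) c) {t : ℝ}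
    (ht : t ∈ Icc 0 T) :
    HasDerivWithinAt (fun s ↦ u s x)
      (ofCoord c x (coordPathDeriv T u c (t, extChartAt (𝓡 n) c x) (1, 0))) (Icc 0 T) t := by
  have hy := chart_mem_chartTarget hx
  have hslice : HasDerivWithinAt (fun s : ℝ ↦ (s, extChartAt (𝓡 n) c x)) ((1 : ℝ), 0) (Icc 0 T) t :=
    (hasDerivWithinAt_id t _).prodMk (hasDerivWithinAt_const _ _ _)
  have hmaps : MapsTo (fun s : ℝ ↦ (s, extChartAt (𝓡 n) c x)) (Icc 0 T)
      (Icc 0 T ×ˢ chartTarget c) := fun _ hs ↦ ⟨hs, hy⟩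
  have hcoord := (hu.hasFDerivWithinAt_coordPath ht hy).comp_hasDerivWithinAt t hslice hmaps
  refine ((ofCoord c x).hasFDerivAt.comp_hasDerivWithinAt t hcoord).congr_of_mem (fun s _ ↦ ?_) ht
  change u s x = ofCoord c x (coordField c (u s) (extChartAt (𝓡 n) c x))
  rw [coordField_chart hx, ofCoord_toCoord hx]

lemma derivWithin_eq (hT : 0 < T) (hu : SmoothPath T u) {c x : M} (hx : x ∈ chartDom (n := n) c)
    {t : ℝ} (ht : t ∈ Icc 0 T) :
    derivWithin (fun s ↦ u s x) (Icc 0 T) t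
      = ofCoord c x (coordPathDeriv T u c (t, extChartAt (𝓡 n) c x) (1, 0)) :=
  (hu.hasDerivWithinAt hx ht).derivWithin (uniqueDiffOn_Icc hT t ht)

lemma hasDerivWithinAt_norm_sq_div_two (hT : 0 < T) (hu : SmoothPath T u) (x : M) {t : ℝ}
    (ht : t ∈ Icc 0 T) :
    HasDerivWithinAt (fun s ↦ ‖u s x‖ ^ 2 / 2)
      (inner ℝ (derivWithin (fun s ↦ u s x) (Icc 0 T) t) (u t x)) (Icc 0 T) t := by
  have hx : x ∈ chartDom (n := n) x := mem_chart_source _ x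
  have hderiv := hu.hasDerivWithinAt hx ht
  rw [← hu.derivWithin_eq hT hx ht] at hderiv
  refine (hderiv.norm_sq.div_const 2).congr_deriv ?_
  rw [real_inner_comm]
  ring

variable [IsContMDiffRiemannianBundle (𝓡 n) ∞ (𝔼 n) (fun x : M ↦ TangentSpace (𝓡 n) x)]

lemma continuousOn_norm_sq (hu : SmoothPath T u) :
    ContinuousOn (fun q : ℝ × M ↦ ‖u q.1 q.2‖ ^ 2) (Icc 0 T ×ˢ univ) := by
  refine continuousOn_of_eq_comp_chart fun c ↦
    ⟨fun q ↦ coordMetric c q.2 (coordPath u c q) (coordPath u c q), ?_, fun s _ z hz ↦ ?_⟩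
  · have hpath := (hu.contDiffOn_coordPath c).continuousOn
    exact ((continuousOn_coordMetric_snd c _).clm_apply hpath).clm_apply hpath
  · simp only [coordPath]
    rw [coordField_chart hz, coordMetric_chart hz, real_inner_self_eq_norm_sq]

lemma continuousOn_inner_derivWithin (hT : 0 < T) (hu : SmoothPath T u) :
    ContinuousOn (fun q : ℝ × M ↦
      (inner ℝ (derivWithin (fun s ↦ u s q.2) (Icc 0 T) q.1) (u q.1 q.2) : ℝ))
      (Icc 0 T ×ˢ univ) := by
  refine continuousOn_of_eq_comp_chart fun c ↦
    ⟨fun q ↦ coordMetric c q.2 (coordPathDeriv T u c q (1, 0)) (coordPath u c q), ?_,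
      fun s hs z hz ↦ ?_⟩
  · exact ((continuousOn_coordMetric_snd c _).clm_apply
      ((hu.continuousOn_coordPathDeriv hT c).clm_apply continuousOn_const)).clm_apply
        (hu.contDiffOn_coordPath c).continuousOn
  · simp only [coordPath]
    rw [coordField_chart hz, hu.derivWithin_eq hT hz hs, ← coordMetric_chart hz,
      toCoord_ofCoord hz]

lemma continuousOn_cov_coordField (hT : 0 < T) (hu : SmoothPath T u) (c : M) :
    ContinuousOn (fun q : ℝ × 𝔼 n ↦ cov (coordMetric c) (coordField c (u q.1)) q.2)
      (Icc 0 T ×ˢ chartTarget c) := by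
  have hchristoffel : ContinuousOn (fun y ↦ (christoffel (coordMetric c) y).flip) (chartTarget c) :=
    (flipₗᵢ ℝ (𝔼 n) (𝔼 n) (𝔼 n)).continuous.comp_continuousOn fun _ hy ↦
      ((isLocalMetric_coordMetric c).contDiffAt_christoffel hy).continuousAt.continuousWithinAt
  refine ContinuousOn.congr (((hu.continuousOn_coordPathDeriv hT c).clm_comp
    (continuousOn_const (c := ContinuousLinearMap.inr ℝ ℝ (𝔼 n)))).add
      ((hchristoffel.comp continuousOn_snd fun _ hq ↦ hq.2).clm_apply
        (hu.contDiffOn_coordPath c).continuousOn)) fun q hq ↦ ?_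
  rw [cov, hu.fderiv_coordField hq.1 hq.2]
  rfl

lemma continuousOn_gradSq (hT : 0 < T) (hu : SmoothPath T u) :
    ContinuousOn (fun q : ℝ × M ↦ gradSq (u q.1) q.2) (Icc 0 T ×ˢ univ) := by
  have hinv (c : M) : ContinuousOn (fun y ↦ (coordMetric (n := n) c y).inverse) (chartTarget c) :=
    fun _ hy ↦ ((isLocalMetric_coordMetric c).contDiffAt_inverse hy).continuousAt.continuousWithinAt
  exact continuousOn_of_eq_comp_chart fun c ↦
    ⟨fun q ↦ hilbertSchmidtSq (coordMetric c q.2) (cov (coordMetric c) (coordField c (u q.1)) q.2),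
      continuousOn_hilbertSchmidtSq (continuousOn_coordMetric_snd c _)
        ((hinv c).comp continuousOn_snd fun _ hq ↦ hq.2) (hu.continuousOn_cov_coordField hT c),
      fun _ hs z hz ↦ gradSq_chart hz (hu.smoothAt hs z)⟩

end SmoothPath

end TimeDependent

section LocalEnergy

variable {n : ℕ} {M : Type*} [TopologicalSpace M] [ChartedSpace (𝔼 n) M] [IsManifold (𝓡 n) ∞ M]
  [RiemannianBundle (fun x : M ↦ TangentSpace (𝓡 n) x)]

omit [IsManifold (𝓡 n) ∞ M] in
lemma inner_gradient (f : M → ℝ) (x : M) (a : TangentSpace (𝓡 n) x) :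
    inner ℝ (gradient f x) a = mvfderiv (𝓡 n) f x a :=
  inner_sharp (α := dFun f) (mvfderiv (𝓡 n) f x).toLinearMap.isLinear a

lemma gradSq_nonneg (u : VField n M) (x : M) : 0 ≤ gradSq u x :=
  Finset.sum_nonneg fun _ _ ↦ sq_nonneg _

lemma norm_gradEnergy_sq_le (u : VField n M) (x : M) :
    ‖gradEnergy u x‖ ^ 2 ≤ gradSq u x * ‖u x‖ ^ 2 := by
  rw [← (frame x).sum_sq_norm_inner_right, gradSq, Finset.sum_mul]
  refine Finset.sum_le_sum fun i _ ↦ ?_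
  rw [real_inner_comm, inner_gradEnergy, ← mul_pow]
  exact pow_le_pow_left₀ (norm_nonneg _) (norm_inner_le_norm _ _) 2

lemma two_mul_mul_norm_gradEnergy_le (u : VField n M) (x : M) (s : ℝ) :
    2 * (s * ‖gradEnergy u x‖) ≤ s ^ 2 * gradSq u x + ‖u x‖ ^ 2 := by
  have hgrad := Real.le_sqrt_of_sq_le (norm_gradEnergy_sq_le u x)
  rw [Real.sqrt_mul (gradSq_nonneg u x), Real.sqrt_sq (norm_nonneg _)] at hgrad
  calc 2 * (s * ‖gradEnergy u x‖) ≤ 2 * (|s| * (√(gradSq u x) * ‖u x‖)) := by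
        gcongr
        exact le_abs_self s
    _ = 2 * (|s| * √(gradSq u x)) * ‖u x‖ := by ring
    _ ≤ (|s| * √(gradSq u x)) ^ 2 + ‖u x‖ ^ 2 := two_mul_le_add_sq _ _
    _ = s ^ 2 * gradSq u x + ‖u x‖ ^ 2 := by
        rw [mul_pow, sq_abs, Real.sq_sqrt (gradSq_nonneg u x)]

/-- The energy current `(|u|²/2 + q) u - ν ∇(|u|²/2)` of a flow with velocity `u` and
pressure `q`. -/
def energyCurrent (ν : ℝ) (u : VField n M) (q : M → ℝ) : VField n M := fun x ↦
  (‖u x‖ ^ 2 / 2 + q x) • u x - ν • gradEnergy u x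

lemma energyCurrent_eq (ν : ℝ) (u : VField n M) (q : M → ℝ) :
    energyCurrent ν u q = (fun x ↦ (1 / 2 : ℝ) • ((inner ℝ (u x) (u x) : ℝ) • u x))
      + ((fun x ↦ q x • u x) + fun x ↦ (-ν) • gradEnergy u x) := by
  ext x : 1
  rw [Pi.add_apply, Pi.add_apply, energyCurrent, real_inner_self_eq_norm_sq]
  module

variable {ν : ℝ} {u : VField n M} {q : M → ℝ}

lemma two_mul_mul_norm_energyCurrent_le (hν : 0 ≤ ν) {s : ℝ} (hs : s ∈ Icc 0 1) (x : M) :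
    2 * (s * ‖energyCurrent ν u q x‖) ≤ 2 * ‖(‖u x‖ ^ 2 / 2 + q x) • u x‖
      + ν * (s ^ 2 * gradSq u x + ‖u x‖ ^ 2) := by
  have htriangle : ‖energyCurrent ν u q x‖
      ≤ ‖(‖u x‖ ^ 2 / 2 + q x) • u x‖ + ν * ‖gradEnergy u x‖ := by
    refine (norm_sub_le _ _).trans_eq ?_
    rw [norm_smul ν, Real.norm_of_nonneg hν]
  calc 2 * (s * ‖energyCurrent ν u q x‖)
      ≤ 2 * (s * (‖(‖u x‖ ^ 2 / 2 + q x) • u x‖ + ν * ‖gradEnergy u x‖)) := by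
        gcongr
        exact hs.1
    _ = 2 * (s * ‖(‖u x‖ ^ 2 / 2 + q x) • u x‖) + ν * (2 * (s * ‖gradEnergy u x‖)) := by ring
    _ ≤ _ := by
        gcongr
        · exact mul_le_of_le_one_left (norm_nonneg _) hs.2
        · exact two_mul_mul_norm_gradEnergy_le u x s

variable [IsContMDiffRiemannianBundle (𝓡 n) ∞ (𝔼 n) (fun x : M ↦ TangentSpace (𝓡 n) x)]

lemma smoothAt_energyCurrent (hu : ∀ z, SmoothAt u z) {x : M}
    (hq : ContMDiffAt (𝓡 n) 𝓘(ℝ, ℝ) ∞ q x) : SmoothAt (energyCurrent ν u q) x := by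
  rw [energyCurrent_eq]
  exact (((hu x).smul ((hu x).inner_bundle (hu x))).smul contMDiffAt_const).add
    (((hu x).smul hq).add ((smoothAt_gradEnergy hu x).smul contMDiffAt_const))

lemma divergence_energyCurrent (hu : ∀ z, SmoothAt u z) {x : M}
    (hq : ContMDiffAt (𝓡 n) 𝓘(ℝ, ℝ) ∞ q x) (hdiv : divergence u x = 0) :
    divergence (energyCurrent ν u q) x
      = inner ℝ (nabla u x (u x)) (u x) + inner ℝ (gradient q x) (u x)
        - ν * divergence (gradEnergy u) x := by
  have hnorm : ContMDiffAt (𝓡 n) 𝓘(ℝ, ℝ) ∞ (fun z ↦ (inner ℝ (u z) (u z) : ℝ)) x :=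
    (hu x).inner_bundle (hu x)
  have hkinetic := (hu x).smul hnorm
  have hpressure := (hu x).smul hq
  have hviscous := (smoothAt_gradEnergy hu x).smul (contMDiffAt_const (c := -ν))
  rw [energyCurrent_eq, divergence_add (hkinetic.smul contMDiffAt_const) (hpressure.add hviscous),
    divergence_add hpressure hviscous, divergence_smul contMDiffAt_const hkinetic,
    divergence_smul contMDiffAt_const (smoothAt_gradEnergy hu x), divergence_smul hnorm (hu x),
    divergence_smul hq (hu x), hdiv, mvfderiv_inner (hu x) (hu x),
    real_inner_comm (nabla u x (u x)) (u x), inner_gradient]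
  simp only [mvfderiv_const, zero_apply]
  ring

lemma inner_eq_of_momentum (hu : ∀ z, SmoothAt u z) {x : M}
    (hq : ContMDiffAt (𝓡 n) 𝓘(ℝ, ℝ) ∞ q x) (hdiv : divergence u x = 0)
    {a : TangentSpace (𝓡 n) x}
    (ha : a + nabla u x (u x) + ν • hodgeLaplacian u x = -gradient q x) :
    inner ℝ a (u x) = -divergence (energyCurrent ν u q) x - ν * gradSq u x
      - ν * ricci x (u x) (u x) := by
  have hpaired := congrArg (fun v ↦ (inner ℝ v (u x) : ℝ)) ha
  simp only [inner_add_left, real_inner_smul_left, inner_neg_left, inner_hodgeLaplacian hu]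
    at hpaired
  rw [divergence_energyCurrent hu hq hdiv]
  linarith

lemma inner_le_of_momentum {κ : ℝ} (hν : 0 ≤ ν) (hRic : RicciBoundedBelow n M κ)
    (hu : ∀ z, SmoothAt u z) {x : M} (hq : ContMDiffAt (𝓡 n) 𝓘(ℝ, ℝ) ∞ q x)
    (hdiv : divergence u x = 0) {a : TangentSpace (𝓡 n) x}
    (ha : a + nabla u x (u x) + ν • hodgeLaplacian u x = -gradient q x) :
    inner ℝ a (u x) ≤ -divergence (energyCurrent ν u q) x - ν * gradSq u x
      + 2 * ν * max κ 0 * (‖u x‖ ^ 2 / 2) := by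
  have hricci : -(max κ 0) * ‖u x‖ ^ 2 ≤ ricci x (u x) (u x) :=
    (mul_le_mul_of_nonneg_right (neg_le_neg (le_max_left κ 0)) (sq_nonneg _)).trans (hRic x (u x))
  rw [inner_eq_of_momentum hu hq hdiv ha]
  linarith [mul_le_mul_of_nonneg_left hricci hν]

lemma continuous_norm_flux (hu : ∀ z, SmoothAt u z) (hq : Continuous q) :
    Continuous fun x ↦ ‖(‖u x‖ ^ 2 / 2 + q x) • u x‖ := by
  have hnorm := continuous_norm hu
  simp only [norm_smul]
  fun_prop

end LocalEnergy

section LocalizedEnergy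

variable {n : ℕ} {M : Type*} [MetricSpace M] [SecondCountableTopology M]
  [MeasurableSpace M] [BorelSpace M] [ChartedSpace (𝔼 n) M] [IsManifold (𝓡 n) ∞ M]
  [RiemannianBundle (fun x : M ↦ TangentSpace (𝓡 n) x)]
  [IsContMDiffRiemannianBundle (𝓡 n) ∞ (𝔼 n) (fun x : M ↦ TangentSpace (𝓡 n) x)]
  {ν : ℝ} {u : VField n M} {q : M → ℝ} {χ : M → ℝ} {K : Set M}

lemma two_mul_setIntegral_mul_norm_energyCurrent_le (hν : 0 ≤ ν) (hu : ∀ z, SmoothAt u z)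
    (hq : ∀ z, ContMDiffAt (𝓡 n) 𝓘(ℝ, ℝ) ∞ q z) (hgradSq : Continuous (gradSq u))
    (hχ : Continuous χ) (hχ01 : ∀ x, χ x ∈ Icc 0 1) (hK : IsCompact K) :
    2 * ∫ x in K, χ x * ‖energyCurrent ν u q x‖ ∂(vol n M)
      ≤ 2 * ∫ x in K, ‖(‖u x‖ ^ 2 / 2 + q x) • u x‖ ∂(vol n M)
        + ν * (∫ x in K, χ x ^ 2 * gradSq u x ∂(vol n M) + ∫ x in K, ‖u x‖ ^ 2 ∂(vol n M)) := by
  have hnorm := continuous_norm hu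
  have hcurrent := continuous_norm fun x ↦ smoothAt_energyCurrent (ν := ν) hu (hq x)
  have hflux := continuous_norm_flux hu (continuous_iff_continuousAt.2 fun z ↦ (hq z).continuousAt)
  have hint {f : M → ℝ} (hf : Continuous f) : IntegrableOn f K (vol n M) :=
    hf.continuousOn.integrableOn_compact hK
  rw [← integral_add (hint (by fun_prop)) (hint (by fun_prop)), ← integral_const_mul,
    ← integral_const_mul, ← integral_const_mul,
    ← integral_add (hint (by fun_prop)) (hint (by fun_prop))]
  exact setIntegral_mono_on (hint (by fun_prop)) (hint (by fun_prop)) hK.measurableSet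
    fun x _ ↦ two_mul_mul_norm_energyCurrent_le hν (hχ01 x) x

variable [IsRiemannianManifold (𝓡 n) M]

lemma neg_setIntegral_sq_mul_divergence_le {V : VField n M} (hV : ∀ x, SmoothAt V x) {L : NNReal}
    (hχ : LipschitzWith L χ) (hχ0 : ∀ x, 0 ≤ χ x) (hK : IsCompact K) (hχK : ∀ x ∉ K, χ x = 0) :
    -∫ x in K, χ x ^ 2 * divergence V x ∂(vol n M)
      ≤ 2 * L * ∫ x in K, χ x * ‖V x‖ ∂(vol n M) := by
  have hmain := abs_integral_sq_mul_divergence_le hV hχ (HasCompactSupport.intro hK hχK)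
  simp only [abs_of_nonneg (hχ0 _)] at hmain
  rw [setIntegral_eq_integral_of_forall_compl_eq_zero fun x hx ↦ by rw [hχK x hx]; ring,
    setIntegral_eq_integral_of_forall_compl_eq_zero fun x hx ↦ by rw [hχK x hx]; ring]
  exact (neg_le_abs _).trans hmain

lemma setIntegral_sq_mul_inner_le {κ : ℝ} (hν : 0 ≤ ν) (hRic : RicciBoundedBelow n M κ)
    {a : VField n M} (hu : ∀ z, SmoothAt u z) (hq : ∀ z, ContMDiffAt (𝓡 n) 𝓘(ℝ, ℝ) ∞ q z)
    (hdiv : ∀ z, divergence u z = 0)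
    (ha : ∀ x, a x + nabla u x (u x) + ν • hodgeLaplacian u x = -gradient q x)
    (ha_cont : Continuous fun x ↦ (inner ℝ (a x) (u x) : ℝ)) (hgradSq : Continuous (gradSq u))
    {L : NNReal} (hχ : LipschitzWith L χ) (hχ01 : ∀ x, χ x ∈ Icc 0 1) (hK : IsCompact K)
    (hχK : ∀ x ∉ K, χ x = 0) :
    ∫ x in K, χ x ^ 2 * inner ℝ (a x) (u x) ∂(vol n M)
      ≤ -(ν * (1 - L)) * ∫ x in K, χ x ^ 2 * gradSq u x ∂(vol n M)
        + 2 * L * ∫ x in K, ‖(‖u x‖ ^ 2 / 2 + q x) • u x‖ ∂(vol n M)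
        + ν * L * ∫ x in K, ‖u x‖ ^ 2 ∂(vol n M)
        + 2 * ν * max κ 0 * ∫ x in K, χ x ^ 2 * (‖u x‖ ^ 2 / 2) ∂(vol n M) := by
  have hcurrent (x : M) : SmoothAt (energyCurrent ν u q) x := smoothAt_energyCurrent hu (hq x)
  have hdiv_cont := continuous_divergence hcurrent
  have hnorm := continuous_norm hu
  have hχ_cont := hχ.continuous
  have hint {f : M → ℝ} (hf : Continuous f) : IntegrableOn f K (vol n M) :=
    hf.continuousOn.integrableOn_compact hK
  have hmomentum : ∫ x in K, χ x ^ 2 * inner ℝ (a x) (u x) ∂(vol n M)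
      ≤ ∫ x in K, (-(χ x ^ 2 * divergence (energyCurrent ν u q) x) - ν * (χ x ^ 2 * gradSq u x)
        + 2 * ν * max κ 0 * (χ x ^ 2 * (‖u x‖ ^ 2 / 2))) ∂(vol n M) := by
    refine setIntegral_mono_on (hint (by fun_prop)) (hint (by fun_prop)) hK.measurableSet
      fun x _ ↦ ?_
    linarith [mul_le_mul_of_nonneg_left (inner_le_of_momentum hν hRic hu (hq x) (hdiv x) (ha x))
      (sq_nonneg (χ x))]
  rw [integral_add (hint (by fun_prop)) (hint (by fun_prop)), integral_sub (hint (by fun_prop))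
    (hint (by fun_prop)), integral_neg, integral_const_mul, integral_const_mul] at hmomentum
  have hcutoff := neg_setIntegral_sq_mul_divergence_le hcurrent hχ (fun x ↦ (hχ01 x).1) hK hχK
  have hflux := mul_le_mul_of_nonneg_left (two_mul_setIntegral_mul_norm_energyCurrent_le
    hν hu hq hgradSq hχ_cont hχ01 hK) L.coe_nonneg
  linarith

end LocalizedEnergy

section Gronwall

variable {a b k : ℝ}

lemma le_mul_exp_of_le_add_integral {z : ℝ → ℝ} {A : ℝ} (hk : 0 ≤ k)
    (hz : ContinuousOn z (Icc a b)) (hle : ∀ t ∈ Icc a b, z t ≤ A + k * ∫ s in a..t, z s) {t : ℝ}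
    (ht : t ∈ Icc a b) : z t ≤ A * Real.exp (k * (t - a)) := by
  have hab : a ≤ b := ht.1.trans ht.2
  have hint : IntervalIntegrable z volume a b := hz.intervalIntegrable_of_Icc hab
  have hcont : ContinuousOn (fun t ↦ A + k * ∫ s in a..t, z s) (Icc a b) := by
    rw [← uIcc_of_le hab]
    exact ((intervalIntegral.continuousOn_primitive_interval' hint left_mem_uIcc).const_mul k
      |>.const_add A)
  have hderiv : ∀ x ∈ Ico a b,
      HasDerivWithinAt (fun t ↦ A + k * ∫ s in a..t, z s) (k * z x) (Ici x) x := fun x hx ↦ by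
    have hxz : ContinuousWithinAt z (Ioi x) x :=
      (hz x (Ico_subset_Icc_self hx)).mono_of_mem_nhdsWithin (Icc_mem_nhdsGT_of_mem hx)
    have hmeas : StronglyMeasurableAtFilter z (𝓝[>] x) :=
      (hz.stronglyMeasurableAtFilter_nhdsWithin measurableSet_Icc x).filter_mono
        (nhdsWithin_le_of_mem (Icc_mem_nhdsGT_of_mem hx))
    have hax : IntervalIntegrable z volume a x :=
      hint.mono_set (uIcc_subset_uIcc_left (by rw [uIcc_of_le hab]; exact Ico_subset_Icc_self hx))
    exact ((intervalIntegral.integral_hasDerivWithinAt_right hax hmeas hxz).const_mul k).const_add A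
  have hgronwall := le_gronwallBound_of_liminf_deriv_right_le (δ := A) (ε := 0) hcont
    (fun x hx r hr ↦ (hderiv x hx).liminf_right_slope_le hr) (by simp)
    (fun x hx ↦ by
      rw [add_zero]
      exact mul_le_mul_of_nonneg_left (hle x (Ico_subset_Icc_self hx)) hk) t ht
  rw [gronwallBound_ε0] at hgronwall
  exact (hle t ht).trans hgronwall

lemma add_mul_integral_le_mul_exp {c : ℝ} {y y' g f : ℝ → ℝ} (hc : 0 ≤ c) (hk : 0 ≤ k)
    (hy' : IntervalIntegrable y' volume a b) (hg : IntervalIntegrable g volume a b)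
    (hf : IntervalIntegrable f volume a b) (hg0 : ∀ s ∈ Icc a b, 0 ≤ g s)
    (hf0 : ∀ s ∈ Icc a b, 0 ≤ f s) (hy : ∀ t ∈ Icc a b, y t = y a + ∫ s in a..t, y' s)
    (hle : ∀ s ∈ Icc a b, y' s ≤ -c * g s + f s + k * y s) {t : ℝ} (ht : t ∈ Icc a b) :
    y t + c * ∫ s in a..t, g s ≤ (y a + ∫ s in a..b, f s) * Real.exp (k * (t - a)) := by
  have hab : a ≤ b := ht.1.trans ht.2
  have hprim : ∀ {h : ℝ → ℝ}, IntervalIntegrable h volume a b →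
      ContinuousOn (fun t ↦ ∫ s in a..t, h s) (Icc a b) := fun hh ↦ by
    simpa only [uIcc_of_le hab] using
      intervalIntegral.continuousOn_primitive_interval' hh left_mem_uIcc
  have hcont : ContinuousOn (fun t ↦ y t + c * ∫ s in a..t, g s) (Icc a b) :=
    ((continuousOn_const.add (hprim hy')).congr hy).add ((hprim hg).const_mul c)
  refine le_mul_exp_of_le_add_integral hk hcont (fun t ht ↦ ?_) ht
  have hsub : uIcc a t ⊆ uIcc a b := uIcc_subset_uIcc_left (by rwa [uIcc_of_le hab])
  have hIcc : Icc a t ⊆ Icc a b := Icc_subset_Icc_right ht.2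
  have hgt := (hg.mono_set hsub).const_mul (-c)
  have hft := hf.mono_set hsub
  have hzt := ((hcont.mono hIcc).intervalIntegrable_of_Icc (μ := volume) ht.1).const_mul k
  have hslope : ∫ s in a..t, y' s
      ≤ ∫ s in a..t, (-c * g s + f s + k * (y s + c * ∫ r in a..s, g r)) := by
    refine intervalIntegral.integral_mono_on ht.1 (hy'.mono_set hsub) ((hgt.add hft).add hzt)
      fun s hs ↦ (hle s (hIcc hs)).trans ?_
    gcongr
    exact le_add_of_nonneg_right (mul_nonneg hc (intervalIntegral.integral_nonneg hs.1
      fun r hr ↦ hg0 r (hIcc ⟨hr.1, hr.2.trans hs.2⟩)))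
  rw [intervalIntegral.integral_add (hgt.add hft) hzt, intervalIntegral.integral_add hgt hft,
    intervalIntegral.integral_const_mul, intervalIntegral.integral_const_mul] at hslope
  have hforcing : ∫ s in a..t, f s ≤ ∫ s in a..b, f s :=
    intervalIntegral.integral_mono_interval le_rfl ht.1 ht.2
      ((ae_restrict_mem measurableSet_Ioc).mono fun s hs ↦ hf0 s (Ioc_subset_Icc_self hs)) hf
  linarith [hy t ht]

end Gronwall

section SpaceTime

variable {X : Type*} [TopologicalSpace X] {a b : ℝ} {f : ℝ → X → ℝ}

lemma continuous_slice (hf : ContinuousOn (fun q : ℝ × X ↦ f q.1 q.2) (Icc a b ×ˢ univ)) {s : ℝ}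
    (hs : s ∈ Icc a b) : Continuous (f s) := by
  rw [← continuousOn_univ]
  exact hf.comp (by fun_prop : Continuous fun x : X ↦ (s, x)).continuousOn
    fun x _ ↦ ⟨hs, mem_univ _⟩

variable [T2Space X] [SecondCountableTopology X] [MeasurableSpace X] [BorelSpace X]
  {μ : Measure X} [IsFiniteMeasureOnCompacts μ] [SFinite μ] {K : Set X}

lemma integrable_prod_restrict (hK : IsCompact K)
    (hf : ContinuousOn (fun q : ℝ × X ↦ f q.1 q.2) (Icc a b ×ˢ univ)) :
    Integrable (fun q : ℝ × X ↦ f q.1 q.2)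
      ((volume.restrict (Icc a b)).prod (μ.restrict K)) := by
  rw [Measure.prod_restrict]
  exact (hf.mono (prod_mono_right (subset_univ _))).integrableOn_compact (isCompact_Icc.prod hK)

lemma intervalIntegrable_setIntegral (hK : IsCompact K) (hab : a ≤ b)
    (hf : ContinuousOn (fun q : ℝ × X ↦ f q.1 q.2) (Icc a b ×ˢ univ)) :
    IntervalIntegrable (fun s ↦ ∫ x in K, f s x ∂μ) volume a b := by
  rw [intervalIntegrable_iff_integrableOn_Icc_of_le hab]
  exact (integrable_prod_restrict hK hf).integral_prod_left

lemma integral_setIntegral_eq (hK : IsCompact K) (hab : a ≤ b)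
    (hf : ContinuousOn (fun q : ℝ × X ↦ f q.1 q.2) (Icc a b ×ˢ univ)) :
    ∫ s in a..b, ∫ x in K, f s x ∂μ
      = ∫ q, f q.1 q.2 ∂((volume.restrict (Icc a b)).prod (μ.restrict K)) := by
  rw [intervalIntegral.integral_of_le hab, ← integral_Icc_eq_integral_Ioc,
    integral_prod _ (integrable_prod_restrict hK hf)]

lemma setIntegral_integral_comm (hK : IsCompact K) (hab : a ≤ b)
    (hf : ContinuousOn (fun q : ℝ × X ↦ f q.1 q.2) (Icc a b ×ˢ univ)) :
    ∫ x in K, (∫ s in a..b, f s x) ∂μ = ∫ s in a..b, ∫ x in K, f s x ∂μ := by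
  simp only [integral_setIntegral_eq hK hab hf,
    integral_prod_symm _ (integrable_prod_restrict hK hf), intervalIntegral.integral_of_le hab,
    integral_Icc_eq_integral_Ioc]

lemma ofReal_integral_setIntegral (hK : IsCompact K) (hab : a ≤ b)
    (hf : ContinuousOn (fun q : ℝ × X ↦ f q.1 q.2) (Icc a b ×ˢ univ)) (hf0 : ∀ s x, 0 ≤ f s x) :
    ENNReal.ofReal (∫ s in a..b, ∫ x in K, f s x ∂μ)
      = ∫⁻ s in Icc a b, ∫⁻ x in K, ENNReal.ofReal (f s x) ∂μ := by
  have hint := integrable_prod_restrict (μ := μ) hK hf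
  rw [integral_setIntegral_eq hK hab hf, ofReal_integral_eq_lintegral_ofReal hint
    (.of_forall fun q ↦ hf0 q.1 q.2), lintegral_prod _ hint.aemeasurable.ennreal_ofReal]

lemma integral_setIntegral_le_toReal (hK : IsCompact K) (hab : a ≤ b)
    (hf : ContinuousOn (fun q : ℝ × X ↦ f q.1 q.2) (Icc a b ×ˢ univ)) (hf0 : ∀ s x, 0 ≤ f s x)
    (hfin : ∫⁻ s in Icc a b, ∫⁻ x, ENNReal.ofReal (f s x) ∂μ ≠ ⊤) :
    ∫ s in a..b, ∫ x in K, f s x ∂μ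
      ≤ (∫⁻ s in Icc a b, ∫⁻ x, ENNReal.ofReal (f s x) ∂μ).toReal := by
  rw [← ENNReal.ofReal_le_iff_le_toReal hfin, ofReal_integral_setIntegral hK hab hf hf0]
  exact lintegral_mono fun s ↦ setLIntegral_le_lintegral _ _

lemma tendsto_lintegral_setLIntegral {S : ℕ → Set X} (hS : ∀ k, IsCompact (S k))
    (hmono : Monotone S) (hcover : AECover μ Filter.atTop S)
    (hf : ContinuousOn (fun q : ℝ × X ↦ f q.1 q.2) (Icc a b ×ˢ univ)) :
    Filter.Tendsto (fun k ↦ ∫⁻ s in Icc a b, ∫⁻ x in S k, ENNReal.ofReal (f s x) ∂μ) Filter.atTop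
      (𝓝 (∫⁻ s in Icc a b, ∫⁻ x, ENNReal.ofReal (f s x) ∂μ)) := by
  refine lintegral_tendsto_of_tendsto_of_monotone (fun k ↦ ?_) ?_ ?_
  · exact (integrable_prod_restrict (hS k) hf).aemeasurable.ennreal_ofReal.lintegral_prod_right'
  · exact .of_forall fun s i j hij ↦ lintegral_mono_set (hmono hij)
  · filter_upwards [ae_restrict_mem measurableSet_Icc] with s hs
    exact hcover.lintegral_tendsto_of_countably_generated
      (continuous_slice hf hs).measurable.ennreal_ofReal.aemeasurable

lemma setIntegral_eq_add_integral (hK : IsCompact K) {f' : ℝ → X → ℝ}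
    (hderiv : ∀ t ∈ Icc a b, ∀ x, HasDerivWithinAt (fun s ↦ f s x) (f' t x) (Icc a b) t)
    (hf : ContinuousOn (fun q : ℝ × X ↦ f q.1 q.2) (Icc a b ×ˢ univ))
    (hf' : ContinuousOn (fun q : ℝ × X ↦ f' q.1 q.2) (Icc a b ×ˢ univ)) {t : ℝ}
    (ht : t ∈ Icc a b) :
    ∫ x in K, f t x ∂μ = ∫ x in K, f a x ∂μ + ∫ s in a..t, ∫ x in K, f' s x ∂μ := by
  have hIcc : Icc a t ⊆ Icc a b := Icc_subset_Icc_right ht.2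
  have hslice : ∀ s ∈ Icc a b, IntegrableOn (f s) K μ := fun s hs ↦
    (continuous_slice hf hs).continuousOn.integrableOn_compact hK
  have hftc : ∀ x, ∫ s in a..t, f' s x = f t x - f a x := fun x ↦ by
    have hcont : ContinuousOn (fun s ↦ f' s x) (Icc a t) :=
      hf'.comp (by fun_prop : Continuous fun s : ℝ ↦ (s, x)).continuousOn
        fun s hs ↦ ⟨hIcc hs, mem_univ _⟩
    exact intervalIntegral.integral_eq_sub_of_hasDerivAt_of_le ht.1
      (fun s hs ↦ (hderiv s (hIcc hs) x).continuousWithinAt.mono hIcc)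
      (fun s hs ↦ (hderiv s (hIcc (Ioo_subset_Icc_self hs)) x).hasDerivAt
        (Icc_mem_nhds hs.1 (hs.2.trans_le ht.2)))
      (hcont.intervalIntegrable_of_Icc ht.1)
  rw [← setIntegral_integral_comm hK ht.1 (hf'.mono (prod_mono_left hIcc)), ← sub_eq_iff_eq_add',
    ← integral_sub (hslice t ht) (hslice a (left_mem_Icc.2 (ht.1.trans ht.2)))]
  simp only [hftc]

end SpaceTime

section Cutoff

lemma exists_cutoff {X : Type*} [PseudoMetricSpace X] (o : X) {R : NNReal} (hR : 0 < R) :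
    ∃ χ : X → ℝ, LipschitzWith R⁻¹ χ ∧ (∀ x, χ x ∈ Icc 0 1) ∧
      (∀ x ∈ Metric.closedBall o R, χ x = 1) ∧ ∀ x ∉ Metric.closedBall o (2 * R), χ x = 0 := by
  have hR' : 0 < (R : ℝ) := hR
  refine ⟨fun x ↦ thickenedIndicator hR' (Metric.closedBall o R) x, ?_, fun x ↦ ⟨?_, ?_⟩,
    fun x hx ↦ ?_, fun x hx ↦ ?_⟩
  · simpa only [Real.toNNReal_coe, one_mul, Function.comp_def] using
      NNReal.isometry_coe.lipschitz.comp (lipschitzWith_thickenedIndicator hR' _)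
  · exact NNReal.coe_nonneg _
  · exact_mod_cast thickenedIndicator_le_one hR' _ x
  · exact NNReal.coe_eq_one.2 (thickenedIndicator_one hR' _ hx)
  · refine NNReal.coe_eq_zero.2 (thickenedIndicator_zero hR' _ fun hthick ↦ hx ?_)
    obtain ⟨z, hz, hxz⟩ := Metric.mem_thickening_iff.1 hthick
    rw [Metric.mem_closedBall] at hz ⊢
    linarith [dist_triangle x z o]

variable {X : Type*} [TopologicalSpace X] [T2Space X] [MeasurableSpace X] [BorelSpace X]
  {μ : Measure X} [IsFiniteMeasureOnCompacts μ] {χ : X → ℝ} {B K : Set X}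

lemma ofReal_setIntegral_sq_mul (hK : IsCompact K) (hχ : Continuous χ) {f : X → ℝ}
    (hf : Continuous f) (hf0 : ∀ x, 0 ≤ f x) :
    ENNReal.ofReal (∫ x in K, χ x ^ 2 * f x ∂μ)
      = ∫⁻ x in K, ENNReal.ofReal (χ x ^ 2 * f x) ∂μ :=
  ofReal_integral_eq_lintegral_ofReal
    (((hχ.pow 2).mul hf).continuousOn.integrableOn_compact hK)
    (.of_forall fun x ↦ mul_nonneg (sq_nonneg _) (hf0 x))

lemma ofReal_setIntegral_sq_mul_le_lintegral (hK : IsCompact K) (hχ : Continuous χ)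
    (hχ01 : ∀ x, χ x ∈ Icc 0 1) {f : X → ℝ} (hf : Continuous f) (hf0 : ∀ x, 0 ≤ f x) :
    ENNReal.ofReal (∫ x in K, χ x ^ 2 * f x ∂μ) ≤ ∫⁻ x, ENNReal.ofReal (f x) ∂μ := by
  rw [ofReal_setIntegral_sq_mul hK hχ hf hf0]
  refine (lintegral_mono fun x ↦ ENNReal.ofReal_le_ofReal ?_).trans (setLIntegral_le_lintegral K _)
  exact mul_le_of_le_one_left (hf0 x) (pow_le_one₀ (hχ01 x).1 (hχ01 x).2)

omit [TopologicalSpace X] [T2Space X] [BorelSpace X] [IsFiniteMeasureOnCompacts μ] in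
lemma setLIntegral_le_setLIntegral_sq_mul (hB : MeasurableSet B) (hBK : B ⊆ K)
    (hχ_one : ∀ x ∈ B, χ x = 1) (f : X → ℝ) :
    ∫⁻ x in B, ENNReal.ofReal (f x) ∂μ ≤ ∫⁻ x in K, ENNReal.ofReal (χ x ^ 2 * f x) ∂μ := by
  refine (setLIntegral_mono' hB fun x hx ↦ ?_).trans (lintegral_mono_set hBK)
  rw [hχ_one x hx, one_pow, one_mul]

lemma setLIntegral_le_ofReal_setIntegral_sq_mul (hK : IsCompact K) (hB : MeasurableSet B)
    (hBK : B ⊆ K) (hχ : Continuous χ) (hχ_one : ∀ x ∈ B, χ x = 1) {f : X → ℝ} (hf : Continuous f)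
    (hf0 : ∀ x, 0 ≤ f x) :
    ∫⁻ x in B, ENNReal.ofReal (f x) ∂μ ≤ ENNReal.ofReal (∫ x in K, χ x ^ 2 * f x ∂μ) :=
  (setLIntegral_le_setLIntegral_sq_mul hB hBK hχ_one f).trans_eq
    (ofReal_setIntegral_sq_mul hK hχ hf hf0).symm

lemma lintegral_setLIntegral_le_ofReal_integral_setIntegral_sq_mul [SecondCountableTopology X]
    [SFinite μ] (hK : IsCompact K) (hB : MeasurableSet B) (hBK : B ⊆ K) (hχ : Continuous χ)
    (hχ_one : ∀ x ∈ B, χ x = 1) {a b : ℝ} (hab : a ≤ b) {f : ℝ → X → ℝ}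
    (hf : ContinuousOn (fun q : ℝ × X ↦ f q.1 q.2) (Icc a b ×ˢ univ)) (hf0 : ∀ s x, 0 ≤ f s x) :
    ∫⁻ s in Icc a b, ∫⁻ x in B, ENNReal.ofReal (f s x) ∂μ
      ≤ ENNReal.ofReal (∫ s in a..b, ∫ x in K, χ x ^ 2 * f s x ∂μ) := by
  have hχ_sq : ContinuousOn (fun q : ℝ × X ↦ χ q.2 ^ 2) (Icc a b ×ˢ univ) := by fun_prop
  rw [ofReal_integral_setIntegral (f := fun s x ↦ χ x ^ 2 * f s x) hK hab (hχ_sq.mul hf)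
    fun s x ↦ mul_nonneg (sq_nonneg _) (hf0 s x)]
  exact lintegral_mono fun s ↦ setLIntegral_le_setLIntegral_sq_mul hB hBK hχ_one (f s)

end Cutoff

section EnergyInequality

variable {n : ℕ} {M : Type*} [MetricSpace M] [SecondCountableTopology M]
  [MeasurableSpace M] [BorelSpace M] [ChartedSpace (𝔼 n) M] [IsManifold (𝓡 n) ∞ M]
  [RiemannianBundle (fun x : M ↦ TangentSpace (𝓡 n) x)]
  {κ ν T : ℝ} {u₀ : VField n M} {u : ℝ → VField n M} {p : ℝ → M → ℝ} {χ : M → ℝ} {K : Set M}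

omit [SecondCountableTopology M] [BorelSpace M] in
lemma ofReal_half_mul_normSq (v : VField n M) :
    ENNReal.ofReal (1 / 2) * normSq v = ∫⁻ x, ENNReal.ofReal (‖v x‖ ^ 2 / 2) ∂(vol n M) := by
  rw [normSq, ← lintegral_const_mul' _ _ ENNReal.ofReal_ne_top]
  refine lintegral_congr fun x ↦ ?_
  rw [← ENNReal.ofReal_mul (by norm_num), one_div_mul_eq_div]

lemma ofReal_add_ofReal_mul_le {a b c d e w : ℝ} (ha : 0 ≤ a) (hb : 0 ≤ b) (hw : 0 ≤ w)
    (he : 0 ≤ e) (h : a + w * b ≤ (c + d) * e) :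
    ENNReal.ofReal a + ENNReal.ofReal w * ENNReal.ofReal b
      ≤ (ENNReal.ofReal c + ENNReal.ofReal d) * ENNReal.ofReal e := by
  rw [← ENNReal.ofReal_mul hw, ← ENNReal.ofReal_add ha (mul_nonneg hw hb)]
  refine (ENNReal.ofReal_le_ofReal h).trans ?_
  rw [ENNReal.ofReal_mul' he]
  gcongr
  exact ENNReal.ofReal_add_le

/-- A bound for the error made by localizing the energy balance with a cutoff function, per unit of
its Lipschitz constant. -/
def cutoffError (ν T : ℝ) (u : ℝ → VField n M) (p : ℝ → M → ℝ) : ℝ :=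
  2 * (∫⁻ t in Icc 0 T, ∫⁻ x,
      ENNReal.ofReal ‖(‖u t x‖ ^ 2 / 2 + p t x) • u t x‖ ∂(vol n M)).toReal
    + ν * (∫⁻ t in Icc 0 T, normSq (u t)).toReal

namespace IsSmoothSolution

omit [SecondCountableTopology M] [MeasurableSpace M] [BorelSpace M] in
lemma contMDiffAt_pressure (hsol : IsSmoothSolution ν T u₀ u p) {t : ℝ} (ht : t ∈ Icc 0 T) (x : M) :
    ContMDiffAt (𝓡 n) 𝓘(ℝ, ℝ) ∞ (p t) x := by
  have hslice : ContMDiff (𝓡 n) (𝓘(ℝ, ℝ).prod (𝓡 n)) ∞ (fun z : M ↦ (t, z)) :=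
    contMDiff_const.prodMk contMDiff_id
  exact (contMDiffOn_univ.1
    (hsol.smooth_pressure.comp hslice.contMDiffOn fun _ _ ↦ ⟨ht, mem_univ _⟩)).contMDiffAt

variable [IsContMDiffRiemannianBundle (𝓡 n) ∞ (𝔼 n) (fun x : M ↦ TangentSpace (𝓡 n) x)]

omit [SecondCountableTopology M] [MeasurableSpace M] [BorelSpace M] in
lemma continuousOn_norm_flux (hsol : IsSmoothSolution ν T u₀ u p) :
    ContinuousOn (fun q : ℝ × M ↦ ‖(‖u q.1 q.2‖ ^ 2 / 2 + p q.1 q.2) • u q.1 q.2‖)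
      (Icc 0 T ×ˢ univ) := by
  have hsq := SmoothPath.continuousOn_norm_sq hsol.smooth_velocity
  have hnorm : ContinuousOn (fun q : ℝ × M ↦ ‖u q.1 q.2‖) (Icc 0 T ×ˢ univ) :=
    hsq.sqrt.congr fun q _ ↦ (Real.sqrt_sq (norm_nonneg _)).symm
  simp only [norm_smul]
  exact ((hsq.div_const 2).add hsol.smooth_pressure.continuousOn).norm.mul hnorm

lemma setIntegral_sq_mul_energy_eq (hsol : IsSmoothSolution ν T u₀ u p) (hT : 0 < T)
    (hχ : Continuous χ) (hK : IsCompact K) {t : ℝ} (ht : t ∈ Icc 0 T) :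
    ∫ x in K, χ x ^ 2 * (‖u t x‖ ^ 2 / 2) ∂(vol n M)
      = ∫ x in K, χ x ^ 2 * (‖u₀ x‖ ^ 2 / 2) ∂(vol n M)
        + ∫ s in 0..t, ∫ x in K,
          χ x ^ 2 * inner ℝ (derivWithin (fun s ↦ u s x) (Icc 0 T) s) (u s x) ∂(vol n M) := by
  have hu : SmoothPath T u := hsol.smooth_velocity
  have hχ_sq : ContinuousOn (fun q : ℝ × M ↦ χ q.2 ^ 2) (Icc 0 T ×ˢ univ) := by fun_prop
  rw [← hsol.initial]
  exact setIntegral_eq_add_integral (f := fun s x ↦ χ x ^ 2 * (‖u s x‖ ^ 2 / 2)) hK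
    (fun s hs x ↦ (hu.hasDerivWithinAt_norm_sq_div_two hT x hs).const_mul (χ x ^ 2))
    (hχ_sq.mul (hu.continuousOn_norm_sq.div_const 2))
    (hχ_sq.mul (hu.continuousOn_inner_derivWithin hT)) ht

lemma integral_error_le (hsol : IsSmoothSolution ν T u₀ u p) (hint : HasIntegrableEnergy T u p)
    (hν : 0 ≤ ν) (hT : 0 ≤ T) (L : NNReal) (hK : IsCompact K) :
    ∫ s in 0..T, (2 * L * ∫ x in K, ‖(‖u s x‖ ^ 2 / 2 + p s x) • u s x‖ ∂(vol n M)
        + ν * L * ∫ x in K, ‖u s x‖ ^ 2 ∂(vol n M)) ≤ L * cutoffError ν T u p := by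
  have hflux := hsol.continuousOn_norm_flux
  have hnorm := SmoothPath.continuousOn_norm_sq hsol.smooth_velocity
  have hflux_int := intervalIntegrable_setIntegral (μ := vol n M)
    (f := fun s x ↦ ‖(‖u s x‖ ^ 2 / 2 + p s x) • u s x‖) hK hT hflux
  have hnorm_int := intervalIntegrable_setIntegral (μ := vol n M)
    (f := fun s x ↦ ‖u s x‖ ^ 2) hK hT hnorm
  have hflux_le := integral_setIntegral_le_toReal hK hT hflux (fun _ _ ↦ norm_nonneg _)
    hint.flux.ne
  have hnorm_le := integral_setIntegral_le_toReal hK hT hnorm (fun _ _ ↦ sq_nonneg _)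
    hint.energy.ne
  rw [intervalIntegral.integral_add (hflux_int.const_mul _) (hnorm_int.const_mul _),
    intervalIntegral.integral_const_mul, intervalIntegral.integral_const_mul]
  refine (add_le_add (mul_le_mul_of_nonneg_left hflux_le (by positivity))
    (mul_le_mul_of_nonneg_left hnorm_le (by positivity))).trans_eq ?_
  simp only [cutoffError, normSq]
  ring

variable [IsRiemannianManifold (𝓡 n) M]

lemma localized_energy_le (hsol : IsSmoothSolution ν T u₀ u p) (hint : HasIntegrableEnergy T u p)
    (hν : 0 ≤ ν) (hT : 0 < T) (hRic : RicciBoundedBelow n M κ) {L : NNReal} (hL : L ≤ 1)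
    (hχ : LipschitzWith L χ) (hχ01 : ∀ x, χ x ∈ Icc 0 1) (hK : IsCompact K)
    (hχK : ∀ x ∉ K, χ x = 0) {t : ℝ} (ht : t ∈ Icc 0 T) :
    ∫ x in K, χ x ^ 2 * (‖u t x‖ ^ 2 / 2) ∂(vol n M)
        + ν * (1 - L) * ∫ s in 0..t, ∫ x in K, χ x ^ 2 * gradSq (u s) x ∂(vol n M)
      ≤ (∫ x in K, χ x ^ 2 * (‖u₀ x‖ ^ 2 / 2) ∂(vol n M) + L * cutoffError ν T u p)
        * Real.exp (2 * ν * t * max κ 0) := by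
  have hu : SmoothPath T u := hsol.smooth_velocity
  have hχ_cont : Continuous χ := hχ.continuous
  have hχ_sq : ContinuousOn (fun q : ℝ × M ↦ χ q.2 ^ 2) (Icc 0 T ×ˢ univ) := by fun_prop
  have hpower := hu.continuousOn_inner_derivWithin hT
  have hgrad := hu.continuousOn_gradSq hT
  have hpower_slice : ∀ s ∈ Icc 0 T, Continuous fun x ↦
      (inner ℝ (derivWithin (fun s ↦ u s x) (Icc 0 T) s) (u s x) : ℝ) :=
    fun s hs ↦ continuous_slice (f := fun s x ↦
      (inner ℝ (derivWithin (fun s ↦ u s x) (Icc 0 T) s) (u s x) : ℝ)) hpower hs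
  have hgrad_slice : ∀ s ∈ Icc 0 T, Continuous (gradSq (u s)) :=
    fun s hs ↦ continuous_slice (f := fun s x ↦ gradSq (u s) x) hgrad hs
  have hgronwall := add_mul_integral_le_mul_exp (a := 0) (b := T) (k := 2 * ν * max κ 0)
    (y := fun t ↦ ∫ x in K, χ x ^ 2 * (‖u t x‖ ^ 2 / 2) ∂(vol n M))
    (f := fun s ↦ 2 * L * ∫ x in K, ‖(‖u s x‖ ^ 2 / 2 + p s x) • u s x‖ ∂(vol n M)
      + ν * L * ∫ x in K, ‖u s x‖ ^ 2 ∂(vol n M))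
    (mul_nonneg hν (sub_nonneg.2 (NNReal.coe_le_one.2 hL))) (by positivity)
    (intervalIntegrable_setIntegral (f := fun s x ↦ χ x ^ 2 *
      (inner ℝ (derivWithin (fun s ↦ u s x) (Icc 0 T) s) (u s x) : ℝ)) hK hT.le (hχ_sq.mul hpower))
    (intervalIntegrable_setIntegral (f := fun s x ↦ χ x ^ 2 * gradSq (u s) x) hK hT.le
      (hχ_sq.mul hgrad))
    (((intervalIntegrable_setIntegral hK hT.le hsol.continuousOn_norm_flux).const_mul _).add
      ((intervalIntegrable_setIntegral hK hT.le hu.continuousOn_norm_sq).const_mul _))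
    (fun s _ ↦ integral_nonneg fun x ↦ mul_nonneg (sq_nonneg _) (gradSq_nonneg _ _))
    (fun s _ ↦ by positivity)
    (fun s hs ↦ hsol.initial ▸ hsol.setIntegral_sq_mul_energy_eq hT hχ_cont hK hs)
    (fun s hs ↦ (setIntegral_sq_mul_inner_le hν hRic (hu.smoothAt hs)
      (hsol.contMDiffAt_pressure hs) (hsol.incompressible s hs) (hsol.momentum s hs)
      (hpower_slice s hs) (hgrad_slice s hs) hχ hχ01 hK hχK).trans_eq (by ring)) ht
  rw [sub_zero, hsol.initial, mul_right_comm (2 * ν)] at hgronwall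
  refine hgronwall.trans ?_
  gcongr
  exact hsol.integral_error_le hint hν hT.le L hK

variable [CompleteSpace M]

lemma energy_closedBall_le (hsol : IsSmoothSolution ν T u₀ u p) (hint : HasIntegrableEnergy T u p)
    (hν : 0 ≤ ν) (hT : 0 < T) (hRic : RicciBoundedBelow n M κ) (o : M) {R : NNReal} (hR : 1 ≤ R)
    {t : ℝ} (ht : t ∈ Icc 0 T) :
    ∫⁻ x in Metric.closedBall o R, ENNReal.ofReal (‖u t x‖ ^ 2 / 2) ∂(vol n M)
        + ENNReal.ofReal (ν * (1 - (R : ℝ)⁻¹)) * ∫⁻ s in Icc 0 t, ∫⁻ x in Metric.closedBall o R,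
          ENNReal.ofReal (gradSq (u s) x) ∂(vol n M)
      ≤ (∫⁻ x, ENNReal.ofReal (‖u₀ x‖ ^ 2 / 2) ∂(vol n M)
          + ENNReal.ofReal ((R : ℝ)⁻¹ * cutoffError ν T u p))
        * ENNReal.ofReal (Real.exp (2 * ν * t * max κ 0)) := by
  obtain ⟨χ, hχ, hχ01, hχ_one, hχ_zero⟩ := exists_cutoff o (zero_lt_one.trans_le hR)
  have hu : SmoothPath T u := hsol.smooth_velocity
  have hχ_cont : Continuous χ := hχ.continuous
  set B := Metric.closedBall o (R : ℝ)
  set K := Metric.closedBall o (2 * R : ℝ)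
  have hK : IsCompact K := isCompact_closedBall_of_completeSpace n o _
  have hB : MeasurableSet B := Metric.isClosed_closedBall.measurableSet
  have hBK : B ⊆ K := Metric.closedBall_subset_closedBall (by linarith [R.coe_nonneg])
  have hlocal := hsol.localized_energy_le hint hν hT hRic (inv_le_one_of_one_le₀ hR) hχ hχ01 hK
    hχ_zero ht
  have hnorm : ∀ s ∈ Icc 0 T, Continuous fun x ↦ ‖u s x‖ ^ 2 / 2 := fun s hs ↦
    ((continuous_norm (hu.smoothAt hs)).pow 2).div_const 2
  have hnorm0 : ∀ s x, 0 ≤ ‖u s x‖ ^ 2 / 2 := fun s x ↦ by positivity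
  have hweight : 0 ≤ ν * (1 - (R : ℝ)⁻¹) :=
    mul_nonneg hν (sub_nonneg.2 (inv_le_one_of_one_le₀ (NNReal.one_le_coe.2 hR)))
  set A₀ := ∫ x in K, χ x ^ 2 * (‖u₀ x‖ ^ 2 / 2) ∂(vol n M)
  set A := ∫ x in K, χ x ^ 2 * (‖u t x‖ ^ 2 / 2) ∂(vol n M)
  set D := ∫ s in 0..t, ∫ x in K, χ x ^ 2 * gradSq (u s) x ∂(vol n M)
  have hinitial : ENNReal.ofReal A₀ ≤ ∫⁻ x, ENNReal.ofReal (‖u₀ x‖ ^ 2 / 2) ∂(vol n M) := by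
    simpa only [hsol.initial] using ofReal_setIntegral_sq_mul_le_lintegral (μ := vol n M) hK hχ_cont
      hχ01 (hnorm 0 (left_mem_Icc.2 hT.le)) (hnorm0 0)
  have henergy : ∫⁻ x in B, ENNReal.ofReal (‖u t x‖ ^ 2 / 2) ∂(vol n M) ≤ ENNReal.ofReal A :=
    setLIntegral_le_ofReal_setIntegral_sq_mul (μ := vol n M) hK hB hBK hχ_cont hχ_one
      (hnorm t ht) (hnorm0 t)
  have hgrad : ∫⁻ s in Icc 0 t, ∫⁻ x in B, ENNReal.ofReal (gradSq (u s) x) ∂(vol n M)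
      ≤ ENNReal.ofReal D :=
    lintegral_setLIntegral_le_ofReal_integral_setIntegral_sq_mul (μ := vol n M) hK hB hBK hχ_cont
      hχ_one ht.1
      ((hu.continuousOn_gradSq hT).mono (prod_mono_left (Icc_subset_Icc_right ht.2)))
      fun s ↦ gradSq_nonneg (u s)
  have hA : 0 ≤ A := integral_nonneg fun x ↦ mul_nonneg (sq_nonneg _) (hnorm0 t x)
  have hD : 0 ≤ D := intervalIntegral.integral_nonneg ht.1 fun s _ ↦
    integral_nonneg fun x ↦ mul_nonneg (sq_nonneg _) (gradSq_nonneg _ _)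
  calc _ ≤ ENNReal.ofReal A + ENNReal.ofReal (ν * (1 - (R : ℝ)⁻¹)) * ENNReal.ofReal D :=
        add_le_add henergy (mul_le_mul' le_rfl hgrad)
    _ ≤ (ENNReal.ofReal A₀ + ENNReal.ofReal ((R : ℝ)⁻¹ * cutoffError ν T u p))
        * ENNReal.ofReal (Real.exp (2 * ν * t * max κ 0)) :=
        ofReal_add_ofReal_mul_le hA hD hweight (Real.exp_pos _).le (by exact_mod_cast hlocal)
    _ ≤ _ := by gcongr

lemma tendsto_energy_closedBall (hsol : IsSmoothSolution ν T u₀ u p) (hν : 0 < ν) (hT : 0 < T)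
    (o : M) {R : ℕ → NNReal} (hR_mono : Monotone R)
    (hR : Filter.Tendsto (fun k ↦ (R k : ℝ)) Filter.atTop Filter.atTop) {t : ℝ}
    (ht : t ∈ Icc 0 T) :
    Filter.Tendsto (fun k ↦
        ∫⁻ x in Metric.closedBall o (R k), ENNReal.ofReal (‖u t x‖ ^ 2 / 2) ∂(vol n M)
          + ENNReal.ofReal (ν * (1 - (R k : ℝ)⁻¹)) * ∫⁻ s in Icc 0 t,
            ∫⁻ x in Metric.closedBall o (R k), ENNReal.ofReal (gradSq (u s) x) ∂(vol n M))
      Filter.atTop (𝓝 (∫⁻ x, ENNReal.ofReal (‖u t x‖ ^ 2 / 2) ∂(vol n M)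
        + ENNReal.ofReal ν * ∫⁻ s in Icc 0 t, gradNormSq (u s))) := by
  have hu : SmoothPath T u := hsol.smooth_velocity
  have hcover : AECover (vol n M) Filter.atTop fun k ↦ Metric.closedBall o (R k : ℝ) :=
    aecover_closedBall hR
  have hmono : Monotone fun k ↦ Metric.closedBall o (R k : ℝ) := fun i j hij ↦
    Metric.closedBall_subset_closedBall (hR_mono hij)
  have hnorm : Continuous fun x ↦ ‖u t x‖ := continuous_norm (hu.smoothAt ht)
  have henergy : Filter.Tendsto (fun k ↦ ∫⁻ x in Metric.closedBall o (R k : ℝ),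
      ENNReal.ofReal (‖u t x‖ ^ 2 / 2) ∂(vol n M)) Filter.atTop
        (𝓝 (∫⁻ x, ENNReal.ofReal (‖u t x‖ ^ 2 / 2) ∂(vol n M))) :=
    hcover.lintegral_tendsto_of_countably_generated
      (hnorm.pow 2 |>.div_const 2).measurable.ennreal_ofReal.aemeasurable
  have hgrad : Filter.Tendsto (fun k ↦ ∫⁻ s in Icc 0 t, ∫⁻ x in Metric.closedBall o (R k : ℝ),
      ENNReal.ofReal (gradSq (u s) x) ∂(vol n M)) Filter.atTop
        (𝓝 (∫⁻ s in Icc 0 t, gradNormSq (u s))) :=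
    tendsto_lintegral_setLIntegral (μ := vol n M) (f := fun s x ↦ gradSq (u s) x)
      (fun k ↦ isCompact_closedBall_of_completeSpace n o (R k)) hmono hcover
      ((hu.continuousOn_gradSq hT).mono (prod_mono_left (Icc_subset_Icc_right ht.2)))
  have hweight : Filter.Tendsto (fun k ↦ ENNReal.ofReal (ν * (1 - (R k : ℝ)⁻¹))) Filter.atTop
      (𝓝 (ENNReal.ofReal ν)) :=
    ENNReal.tendsto_ofReal (by
      simpa using ((tendsto_inv_atTop_zero.comp hR).const_sub 1).const_mul ν)
  exact henergy.add (ENNReal.Tendsto.mul hweight (Or.inl (ENNReal.ofReal_pos.2 hν).ne') hgrad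
    (Or.inr ENNReal.ofReal_ne_top))

lemma energy_le (hsol : IsSmoothSolution ν T u₀ u p) (hint : HasIntegrableEnergy T u p)
    (hν : 0 < ν) (hT : 0 < T) (hRic : RicciBoundedBelow n M κ) (o : M) {t : ℝ}
    (ht : t ∈ Icc 0 T) :
    ENNReal.ofReal (1 / 2) * normSq (u t)
        + ENNReal.ofReal ν * ∫⁻ s in Icc 0 t, gradNormSq (u s)
      ≤ ENNReal.ofReal (1 / 2) * normSq u₀ * ENNReal.ofReal (Real.exp (2 * ν * t * max κ 0)) := by
  obtain ⟨R, hR1, hR_mono, hR⟩ : ∃ R : ℕ → NNReal, (∀ k, 1 ≤ R k) ∧ Monotone R ∧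
      Filter.Tendsto (fun k ↦ (R k : ℝ)) Filter.atTop Filter.atTop :=
    ⟨fun k ↦ k + 1, fun k ↦ le_add_of_nonneg_left zero_le, fun i j hij ↦ by simpa using hij, by
      simpa using Filter.tendsto_atTop_add_const_right _ (1 : ℝ) tendsto_natCast_atTop_atTop⟩
  have herror : Filter.Tendsto (fun k ↦ ENNReal.ofReal ((R k : ℝ)⁻¹ * cutoffError ν T u p))
      Filter.atTop (𝓝 0) := by
    simpa using ENNReal.tendsto_ofReal
      ((tendsto_inv_atTop_zero.comp hR).mul_const (cutoffError ν T u p))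
  have hright := ENNReal.Tendsto.mul_const (b := ENNReal.ofReal (Real.exp (2 * ν * t * max κ 0)))
    (herror.const_add (∫⁻ x, ENNReal.ofReal (‖u₀ x‖ ^ 2 / 2) ∂(vol n M)))
    (Or.inr ENNReal.ofReal_ne_top)
  rw [add_zero] at hright
  rw [ofReal_half_mul_normSq, ofReal_half_mul_normSq]
  exact le_of_tendsto_of_tendsto' (hsol.tendsto_energy_closedBall hν hT o hR_mono hR ht) hright
    fun k ↦ hsol.energy_closedBall_le hint hν.le hT hRic o (hR1 k) ht

end IsSmoothSolution

end EnergyInequality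

end RiemNS

end

theorem mainTheorem12 {n : ℕ} {M : Type*} [MetricSpace M] [SecondCountableTopology M]
    [MeasurableSpace M] [BorelSpace M]
    [ChartedSpace (EuclideanSpace ℝ (Fin n)) M] [IsManifold (𝓡 n) ∞ M]
    [RiemannianBundle (fun x : M ↦ TangentSpace (𝓡 n) x)]
    [IsContMDiffRiemannianBundle (𝓡 n) ∞ (EuclideanSpace ℝ (Fin n))
      (fun x : M ↦ TangentSpace (𝓡 n) x)]
    [IsRiemannianManifold (𝓡 n) M] [CompleteSpace M]
    (κ : ℝ) (hRic : RiemNS.RicciBoundedBelow n M κ)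
    (ν T : ℝ) (hν : 0 < ν)
    (u₀ : RiemNS.VField n M) (u : ℝ → RiemNS.VField n M) (p : ℝ → M → ℝ)
    (hsol : RiemNS.IsSmoothSolution ν T u₀ u p)
    (hint : RiemNS.HasIntegrableEnergy T u p) :
    ∀ t ∈ Icc (0 : ℝ) T,
      ENNReal.ofReal (1 / 2) * RiemNS.normSq (u t)
          + ENNReal.ofReal ν * ∫⁻ s in Icc (0 : ℝ) t, RiemNS.gradNormSq (u s)
        ≤ ENNReal.ofReal (1 / 2) * RiemNS.normSq u₀
          * ENNReal.ofReal (Real.exp (2 * ν * t * max κ 0)) := by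
  intro t ht
  rcases (ht.1.trans ht.2).eq_or_lt with hT | hT
  · obtain rfl : t = 0 := le_antisymm (hT ▸ ht.2) ht.1
    simp [hsol.initial]
  rcases isEmpty_or_nonempty M with hM | ⟨⟨o⟩⟩
  · simp [RiemNS.normSq, RiemNS.gradNormSq]
  · exact hsol.energy_le hint hν hT hRic o ht
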